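/- Let $n\ge 1$ and let $\mathcal B$ be a compact smooth $(n+1)$-dimensional manifold with (closed) boundary $\partial\mathcal B$, interior $\mathbb B^\circ$, and a collar neighbourhood of the boundary with coordinates $(x,y)\in[0,1)\times\partial\mathcal B$. Let $g$ be a degenerate Riemannian metric on $\mathcal B$: a smooth symmetric 2-tensor, positive definite on $\mathbb B^\circ$, with $g=dx^2+x^2h(x)$ on the collar, where $[0,1)\ni x\mapsto h(x)$ is a smooth family (up to $x=0$) of Riemannian metrics on $\partial\mathcal B$. Write $\mathbb B=(\mathcal B,g)$, let $\mu_g$ be the Riemannian measure, $\nabla$ the gradient, $\Delta$ the Laplace–Beltrami operator of $g$, acting in the sense of distributions on $\mathbb B^\circ$, and let $\langle\cdot,\cdot\rangle$ be the complex bilinear extension of $g$. Let $H^1(\mathbb B)$ be the completion of the space $C_c^\infty(\mathbb B^\circ)$ of complex-valued test functions with respect to the inner product $\int_{\mathbb B}u\overline v\,d\mu_g+\int_{\mathbb B}\langle\nabla u,\overline{\nabla v}\rangle\,d\mu_g$. Let $\mathsf x$ be the function on $\mathcal B$ equal to $x$ on the collar and to $1$ elsewhere; for $\gamma\in\mathbb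 R$ let $\mathcal H^{0,\gamma}(\mathbb B)$ be the Mellin–Sobolev space of order $0$, that is, the space of all $f$ with $\mathsf x^{-\gamma}f\in L^2(\mathbb B,\mu_g)$. **Theorem.** Let $\gamma>-1$. (a) If $u,v\in H^1(\mathbb B)$ and $\Delta v\in\mathcal H^{0,\gamma}(\mathbb B)$, then $\langle\nabla u,\nabla v\rangle$ and $u\,\Delta v$ are $\mu_g$-integrable and $$\int_{\mathbb B}\langle\nabla u,\nabla v\rangle\,d\mu_g=-\int_{\mathbb B}u\,\Delta v\,d\mu_g .$$ (b) In particular, if $u\in H^1(\mathbb B)$ and $\Delta u\in\mathcal H^{0,\gamma}(\mathbb B)$, then $\Delta u$ is $\mu_g$-integrable and $\int_{\mathbb B}\Delta u\,d\mu_g=0$. -/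

import Mathlib

open Set Filter Topology MeasureTheory Manifold Bundle
open scoped ContDiff ENNReal Matrix

noncomputable section

/-- A conic manifold of dimension `n + 1`: a smooth manifold with boundary `B` (compactness is
assumed separately) whose boundary is a copy of the closed `n`-manifold `Y`, with a collar
`[0,1) × Y` and a symmetric 2-tensor `g`, smooth on `B`, positive definite in the interior, which
in the collar is `dx² + x² h(x)` for a smooth family `h(x)`, `x ∈ [0,1)`, of Riemannian metrics on
`Y`. -/
structure ConicManifold (n : ℕ) (B Y : Type*)
    [TopologicalSpace B] [ChartedSpace (EuclideanHalfSpace (n + 1)) B]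
    [IsManifold (𝓡∂ (n + 1)) ∞ B]
    [TopologicalSpace Y] [ChartedSpace (EuclideanSpace ℝ (Fin n)) Y]
    [IsManifold (𝓡 n) ∞ Y] where
  /-- the collar coordinates `(x, y) ∈ [0,1) × Y` near the boundary -/
  collar : PartialEquiv (ℝ × Y) B
  collar_source : collar.source = Ico (0 : ℝ) 1 ×ˢ univ
  isOpen_collar_target : IsOpen collar.target
  contMDiffOn_collar :
    ContMDiffOn (𝓘(ℝ, ℝ).prod (𝓡 n)) (𝓡∂ (n + 1)) ∞ collar collar.source
  contMDiffOn_collar_symm :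
    ContMDiffOn (𝓡∂ (n + 1)) (𝓘(ℝ, ℝ).prod (𝓡 n)) ∞ collar.symm collar.target
  boundary_eq : (𝓡∂ (n + 1)).boundary B = collar '' ({(0 : ℝ)} ×ˢ univ)
  /-- the family of metrics on the cross-section; only `x ∈ [0,1)` matters -/
  h : ℝ → ContMDiffRiemannianMetric (𝓡 n) ∞ (EuclideanSpace ℝ (Fin n))
    (fun y : Y => TangentSpace (𝓡 n) y)
  contMDiffOn_h :
    ContMDiffOn (𝓘(ℝ, ℝ).prod (𝓡 n))
      ((𝓡 n).prod 𝓘(ℝ, EuclideanSpace ℝ (Fin n) →L[ℝ] EuclideanSpace ℝ (Fin n) →L[ℝ] ℝ)) ∞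
      (fun q : ℝ × Y =>
        TotalSpace.mk' (EuclideanSpace ℝ (Fin n) →L[ℝ] EuclideanSpace ℝ (Fin n) →L[ℝ] ℝ)
          (E := fun y : Y => TangentSpace (𝓡 n) y →L[ℝ] TangentSpace (𝓡 n) y →L[ℝ] ℝ)
          q.2 ((h q.1).inner q.2))
      (Ico (0 : ℝ) 1 ×ˢ univ)
  /-- the degenerate metric -/
  g : ∀ p : B, TangentSpace (𝓡∂ (n + 1)) p →L[ℝ] TangentSpace (𝓡∂ (n + 1)) p →L[ℝ] ℝ
  contMDiff_g :
    ContMDiff (𝓡∂ (n + 1))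
      ((𝓡∂ (n + 1)).prod
        𝓘(ℝ, EuclideanSpace ℝ (Fin (n + 1)) →L[ℝ] EuclideanSpace ℝ (Fin (n + 1)) →L[ℝ] ℝ)) ∞
      (fun p : B =>
        TotalSpace.mk'
          (EuclideanSpace ℝ (Fin (n + 1)) →L[ℝ] EuclideanSpace ℝ (Fin (n + 1)) →L[ℝ] ℝ)
          (E := fun p : B =>
            TangentSpace (𝓡∂ (n + 1)) p →L[ℝ] TangentSpace (𝓡∂ (n + 1)) p →L[ℝ] ℝ)
          p (g p))
  g_symm : ∀ (p : B) (v w : TangentSpace (𝓡∂ (n + 1)) p), g p v w = g p w v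
  g_pos : ∀ p ∈ (𝓡∂ (n + 1)).interior B, ∀ v : TangentSpace (𝓡∂ (n + 1)) p,
    v ≠ 0 → 0 < g p v v
  /-- `g = dx² + x² h(x)` on the collar -/
  g_collar : ∀ q ∈ collar.source, ∀ (a b : ℝ) (v w : TangentSpace (𝓡 n) q.2),
    g (collar q)
      (mfderivWithin (𝓘(ℝ, ℝ).prod (𝓡 n)) (𝓡∂ (n + 1)) collar collar.source q (a, v))
      (mfderivWithin (𝓘(ℝ, ℝ).prod (𝓡 n)) (𝓡∂ (n + 1)) collar collar.source q (b, w))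
      = a * b + q.1 ^ 2 * (h q.1).inner q.2 v w

namespace ConicManifold

variable {n : ℕ} {B Y : Type*}
  [TopologicalSpace B] [ChartedSpace (EuclideanHalfSpace (n + 1)) B]
  [IsManifold (𝓡∂ (n + 1)) ∞ B]
  [TopologicalSpace Y] [ChartedSpace (EuclideanSpace ℝ (Fin n)) Y]
  [IsManifold (𝓡 n) ∞ Y]

/-- The function equal to `x` on the collar `[0,1) × Y` and to `1` outside the collar. -/
def radial (M : ConicManifold n B Y) (p : B) : ℝ :=
  open scoped Classical in if p ∈ M.collar.target then (M.collar.symm p).1 else 1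

/-- The Gram matrix `(g_ij)` of the metric in the coordinates of the chart around `c`, at the point
with coordinates `z`: `g_ij = g(∂_i, ∂_j)`. -/
def chartMetric (M : ConicManifold n B Y) (c : B) (z : EuclideanSpace ℝ (Fin (n + 1))) :
    Matrix (Fin (n + 1)) (Fin (n + 1)) ℝ :=
  Matrix.of fun i j =>
    M.g ((extChartAt (𝓡∂ (n + 1)) c).symm z)
      (mfderivWithin 𝓘(ℝ, EuclideanSpace ℝ (Fin (n + 1))) (𝓡∂ (n + 1))
        (extChartAt (𝓡∂ (n + 1)) c).symm (range (𝓡∂ (n + 1))) z (EuclideanSpace.single i 1))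
      (mfderivWithin 𝓘(ℝ, EuclideanSpace ℝ (Fin (n + 1))) (𝓡∂ (n + 1))
        (extChartAt (𝓡∂ (n + 1)) c).symm (range (𝓡∂ (n + 1))) z (EuclideanSpace.single j 1))

/-- The density `√det (g_ij)` in the chart around `c`. -/
def chartDensity (M : ConicManifold n B Y) (c : B) (z : EuclideanSpace ℝ (Fin (n + 1))) : ℝ :=
  Real.sqrt (M.chartMetric c z).det

/-- The measure on `B` that is `√det (g_ij) dz` in the chart around `c` and vanishes outside the
domain of this chart. -/
def chartMeasure [MeasurableSpace B] (M : ConicManifold n B Y) (c : B) : Measure B :=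
  Measure.map (extChartAt (𝓡∂ (n + 1)) c).symm
    ((volume.restrict (extChartAt (𝓡∂ (n + 1)) c).target).withDensity
      (fun z => ENNReal.ofReal (M.chartDensity c z)))

/-- The Riemannian measure `dμ_g`: the chart measures agree on the overlaps of the charts, and `μ_g`
is obtained by glueing them, that is, as their least upper bound. -/
def riemMeasure [MeasurableSpace B] (M : ConicManifold n B Y) : Measure B :=
  ⨆ c : B, M.chartMeasure c

/-- The Gram matrix of `g` on the tangent space at `p`, in its standard basis. -/
def gram (M : ConicManifold n B Y) (p : B) : Matrix (Fin (n + 1)) (Fin (n + 1)) ℝ :=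
  Matrix.of fun i j =>
    M.g p (EuclideanSpace.single i 1 : EuclideanSpace ℝ (Fin (n + 1)))
      (EuclideanSpace.single j 1 : EuclideanSpace ℝ (Fin (n + 1)))

/-- The complex bilinear extension of `g` to the complexified tangent space at `p`, whose elements
are given by their components in the standard basis. -/
def inner (M : ConicManifold n B Y) (p : B) (X Z : Fin (n + 1) → ℂ) : ℂ :=
  ∑ i, ∑ j, (M.gram p i j : ℂ) * X i * Z j

/-- The squared length `⟨X, conj X⟩` of a complex tangent vector. -/
def normSq (M : ConicManifold n B Y) (p : B) (X : Fin (n + 1) → ℂ) : ℝ :=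
  (M.inner p X (star X)).re

/-- The gradient of a differentiable function, `(∇φ)^i = ∑ j, g^{ij} ∂_j φ`. -/
def grad (M : ConicManifold n B Y) (φ : B → ℂ) (p : B) : Fin (n + 1) → ℂ :=
  let d : Fin (n + 1) → ℂ := fun j =>
    mfderiv (𝓡∂ (n + 1)) 𝓘(ℝ, ℂ) φ p
      (EuclideanSpace.single j 1 : EuclideanSpace ℝ (Fin (n + 1)))
  fun i => ∑ j, (((M.gram p)⁻¹ i j : ℝ) : ℂ) * d j

/-- The Laplace-Beltrami operator on smooth functions, at interior points:
`Δφ = (det g)^{-1/2} ∑ i, ∂_i ((det g)^{1/2} ∑ j, g^{ij} ∂_j φ)` in the chart around the point. -/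
def laplacian (M : ConicManifold n B Y) (φ : B → ℂ) (p : B) : ℂ :=
  ((M.chartDensity p (extChartAt (𝓡∂ (n + 1)) p p) : ℂ))⁻¹ *
    ∑ i, fderiv ℝ
      (fun z => (M.chartDensity p z : ℂ) *
        ∑ j, (((M.chartMetric p z)⁻¹ i j : ℝ) : ℂ) *
          fderiv ℝ (fun z' => φ ((extChartAt (𝓡∂ (n + 1)) p).symm z')) z
            (EuclideanSpace.single j 1))
      (extChartAt (𝓡∂ (n + 1)) p p) (EuclideanSpace.single i 1)

/-- Complex-valued smooth functions with compact support in the interior of `B` (extended by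
zero to the boundary). -/
def IsTest (_M : ConicManifold n B Y) (φ : B → ℂ) : Prop :=
  ContMDiff (𝓡∂ (n + 1)) 𝓘(ℝ, ℂ) ∞ φ ∧ HasCompactSupport φ ∧
    tsupport φ ⊆ (𝓡∂ (n + 1)).interior B

/-- Measurability of a complex vector field, up to null sets: its products with the gradients of
all test functions (which span the tangent spaces in the interior) are measurable. -/
def MeasurableField [MeasurableSpace B] (M : ConicManifold n B Y)
    (X : B → Fin (n + 1) → ℂ) : Prop :=
  ∀ ψ : B → ℂ, M.IsTest ψ →
    AEStronglyMeasurable (fun p => M.inner p (M.grad ψ p) (X p)) M.riemMeasure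

/-- `u ∈ H¹` with `∇u = X`. The completion of the test functions for
`(φ, ψ) ↦ ∫ φ ψ̄ + ∫ ⟨∇φ, ∇ψ̄⟩` is the closure of the set of pairs `(φ, ∇φ)` in the product of the
`L²` spaces of functions and of vector fields. -/
def HasH1Gradient [MeasurableSpace B] (M : ConicManifold n B Y)
    (u : B → ℂ) (X : B → Fin (n + 1) → ℂ) : Prop :=
  AEStronglyMeasurable u M.riemMeasure ∧ M.MeasurableField X ∧
    ∃ φ : ℕ → B → ℂ, (∀ k, M.IsTest (φ k)) ∧
      Tendsto (fun k => ∫⁻ p, ENNReal.ofReal (‖φ k p - u p‖ ^ 2) ∂M.riemMeasure) atTop (𝓝 0) ∧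
      Tendsto (fun k => ∫⁻ p, ENNReal.ofReal (M.normSq p (M.grad (φ k) p - X p)) ∂M.riemMeasure)
        atTop (𝓝 0)

/-- `u ∈ H¹`. -/
def MemH1 [MeasurableSpace B] (M : ConicManifold n B Y) (u : B → ℂ) : Prop :=
  ∃ X, M.HasH1Gradient u X

/-- `f ∈ 𝓗^{0,γ}`, that is, `x^{-γ} f ∈ L²(μ_g)`. Since `dμ_g = √det h(x) x^n dx dy` on the collar,
this says that `f` is locally `L²` in the interior and that `x^{(n+1)/2-γ} f` is in
`L²(√det h(x) dx/x dy)` near the boundary. -/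
def MemMellin [MeasurableSpace B] (M : ConicManifold n B Y) (γ : ℝ) (f : B → ℂ) : Prop :=
  MemLp (fun p => ((M.radial p ^ (-γ) : ℝ) : ℂ) * f p) 2 M.riemMeasure

/-- `Δv = f` in the sense of distributions on the interior of `B`, for locally integrable
`v` and `f`. -/
def HasDistribLaplacian [MeasurableSpace B] (M : ConicManifold n B Y) (v f : B → ℂ) : Prop :=
  LocallyIntegrableOn v ((𝓡∂ (n + 1)).interior B) M.riemMeasure ∧
  LocallyIntegrableOn f ((𝓡∂ (n + 1)).interior B) M.riemMeasure ∧
  ∀ φ : B → ℂ, M.IsTest φ →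
    ∫ p, f p * φ p ∂M.riemMeasure = ∫ p, v p * M.laplacian φ p ∂M.riemMeasure

end ConicManifold

end

open Set Filter Topology MeasureTheory Manifold Bundle
open scoped ContDiff ENNReal Matrix

set_option linter.unusedSectionVars false

namespace ConicManifold

variable {n : ℕ} {B Y : Type*}
  [TopologicalSpace B] [ChartedSpace (EuclideanHalfSpace (n + 1)) B]
  [IsManifold (𝓡∂ (n + 1)) ∞ B]
  [TopologicalSpace Y] [ChartedSpace (EuclideanSpace ℝ (Fin n)) Y]
  [IsManifold (𝓡 n) ∞ Y]

/-! ### Pointwise linear algebra -/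

section LinearAlgebra

/-! The formula holds by density, and the role of `γ > -1` is to make the pairing with `f = Δv`
continuous on `H¹`. For a test function `φ`, approximating `v` by test functions turns Green's
formula into `∫⟨∇φ,∇v⟩ = -∫ v Δφ = -∫ f φ` (`integral_inner_grad_eq_neg_of_hasDistribLaplacian`).
Now let test functions `φ_k` tend to `u` in `H¹`. The left side converges by Cauchy–Schwarz. On the
right `f` need not be square integrable, so the weight is split: `|∫(φ_k - u) f| ≤ ‖x^γ (φ_k - u)‖
‖x^{-γ} f‖` in `L²`, and the first factor tends to zero by the Hardy inequality `‖x^γ φ‖ ≤ C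
‖φ‖_{H¹}` (`exists_hardy`, `HasH1Gradient.tendsto_weighted`).

On the collar the density is comparable to `x^n`, and `|∂_x φ| ≤ |∇φ|` because `g = dx² + x² h`.
Hardy's inequality therefore reduces to the one-dimensional one with weight `x^a`, `a = 2γ + n`,
where `a > -1` and `a + 2 ≥ n` are guaranteed by `γ > -1` and `n ≥ 1`.

Part (b) is part (a) with the constant function `1` in place of `u`. It lies in `H¹` with gradient
zero (`hasH1Gradient_one`) since the tip has capacity zero: the set `{x ≤ s}` has measure `O(s²)`,
and cutoffs that are smooth functions of `log x / k` have energy `O(1/k)`. The logarithm is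
essential in the critical case `n = 1`.

Underneath lies the invariance of the coordinate definitions. The supremum of the chart measures is
`√det g dz` in every parametrization (`riemMeasure_glue`). The Laplacian, defined at each point by
that point's own chart, agrees with the one computed in any fixed chart
(`chartLaplacian_eq_laplacian`), because both satisfy the same Green formula. The inner product of
two measurable fields is measurable although fields are only tested against gradients
(`MeasurableField.inner`). -/

/-- The components of the differential of `φ` at `p`. -/
noncomputable def differential (φ : B → ℂ) (p : B) : Fin (n + 1) → ℂ := fun j =>
  mfderiv (𝓡∂ (n + 1)) 𝓘(ℝ, ℂ) φ p
    (EuclideanSpace.single j 1 : EuclideanSpace ℝ (Fin (n + 1)))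

lemma bilinear_apply {m : ℕ}
    (b : EuclideanSpace ℝ (Fin m) →ₗ[ℝ] EuclideanSpace ℝ (Fin m) →ₗ[ℝ] ℝ)
    (v w : EuclideanSpace ℝ (Fin m)) :
    b v w = v.ofLp ⬝ᵥ (Matrix.of (fun i j =>
      b (EuclideanSpace.single i 1) (EuclideanSpace.single j 1)) *ᵥ w.ofLp) := by
  have hv := (EuclideanSpace.basisFun (Fin m) ℝ).sum_repr v
  have hw := (EuclideanSpace.basisFun (Fin m) ℝ).sum_repr w
  conv_lhs => rw [← hv, ← hw]
  simp only [map_sum, LinearMap.sum_apply, map_smul, LinearMap.smul_apply, dotProduct,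
    Matrix.mulVec, smul_eq_mul, EuclideanSpace.basisFun_repr, EuclideanSpace.basisFun_apply,
    Finset.mul_sum, Matrix.of_apply]
  rw [Finset.sum_comm]
  refine Finset.sum_congr rfl fun i _ => Finset.sum_congr rfl fun j _ => ?_
  ring

lemma posDef_of_bilinear {m : ℕ}
    (b : EuclideanSpace ℝ (Fin m) →ₗ[ℝ] EuclideanSpace ℝ (Fin m) →ₗ[ℝ] ℝ)
    (hsymm : ∀ v w, b v w = b w v) (hpos : ∀ v, v ≠ 0 → 0 < b v v) :
    (Matrix.of fun i j =>
      b (EuclideanSpace.single i 1) (EuclideanSpace.single j 1)).PosDef := by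
  refine Matrix.PosDef.of_dotProduct_mulVec_pos ?_ fun x hx => ?_
  · ext i j
    exact hsymm _ _
  · have := hpos (WithLp.toLp 2 x) fun h => hx (congrArg WithLp.ofLp h)
    rw [bilinear_apply] at this
    simpa [star_trivial] using this

/-- The metric as a bilinear form on the model space. -/
noncomputable def bilin (M : ConicManifold n B Y) (p : B) :
    EuclideanSpace ℝ (Fin (n + 1)) →ₗ[ℝ] EuclideanSpace ℝ (Fin (n + 1)) →ₗ[ℝ] ℝ :=
  LinearMap.mk₂ ℝ (fun v w => M.g p v w)
    (fun v v' w => congrArg (fun f => f w) (map_add (M.g p) v v'))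
    (fun c v w => congrArg (fun f => f w) (map_smul (M.g p) c v))
    (fun v w w' => map_add (M.g p v) w w')
    (fun c v w => map_smul (M.g p v) c w)

lemma g_apply (M : ConicManifold n B Y) (p : B) (v w : EuclideanSpace ℝ (Fin (n + 1))) :
    M.g p v w = v.ofLp ⬝ᵥ (M.gram p *ᵥ w.ofLp) := by
  exact bilinear_apply (M.bilin p) v w

lemma gram_transpose (M : ConicManifold n B Y) (p : B) : (M.gram p)ᵀ = M.gram p := by
  ext i j
  exact M.g_symm p _ _

lemma gram_posDef (M : ConicManifold n B Y) {p : B} (hp : p ∈ (𝓡∂ (n + 1)).interior B) :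
    (M.gram p).PosDef :=
  posDef_of_bilinear (M.bilin p) (M.g_symm p) (M.g_pos p hp)

lemma inner_eq_dotProduct (M : ConicManifold n B Y) (p : B) (X Z : Fin (n + 1) → ℂ) :
    M.inner p X Z = X ⬝ᵥ ((M.gram p).map Complex.ofReal *ᵥ Z) := by
  simp only [inner, dotProduct, Matrix.mulVec, Finset.mul_sum, Matrix.map_apply]
  refine Finset.sum_congr rfl fun i _ => Finset.sum_congr rfl fun j _ => ?_
  ring

lemma grad_eq_mulVec (M : ConicManifold n B Y) (φ : B → ℂ) (p : B) :
    M.grad φ p = (M.gram p)⁻¹.map Complex.ofReal *ᵥ differential φ p := rfl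

lemma inner_sub_left (M : ConicManifold n B Y) (p : B) (X X' Z : Fin (n + 1) → ℂ) :
    M.inner p (X - X') Z = M.inner p X Z - M.inner p X' Z := by
  simp [inner_eq_dotProduct]

lemma inner_sub_right (M : ConicManifold n B Y) (p : B) (X Z Z' : Fin (n + 1) → ℂ) :
    M.inner p X (Z - Z') = M.inner p X Z - M.inner p X Z' := by
  simp [inner_eq_dotProduct, Matrix.mulVec_sub]

lemma inner_zero_left (M : ConicManifold n B Y) (p : B) (Z : Fin (n + 1) → ℂ) :
    M.inner p 0 Z = 0 := by
  simp [inner_eq_dotProduct]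

lemma inner_zero_right (M : ConicManifold n B Y) (p : B) (X : Fin (n + 1) → ℂ) :
    M.inner p X 0 = 0 := by
  simp [inner_eq_dotProduct]

lemma inner_comm (M : ConicManifold n B Y) (p : B) (X Z : Fin (n + 1) → ℂ) :
    M.inner p X Z = M.inner p Z X := by
  simp only [inner]
  rw [Finset.sum_comm]
  refine Finset.sum_congr rfl fun i _ => Finset.sum_congr rfl fun j _ => ?_
  rw [← M.gram_transpose p, Matrix.transpose_apply, M.gram_transpose p]
  ring

lemma inner_star (M : ConicManifold n B Y) (p : B) (X Z : Fin (n + 1) → ℂ) :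
    M.inner p (star X) (star Z) = star (M.inner p X Z) := by
  simp [inner, star_sum]

/-- Determinant and adjugate commute with ring homomorphisms. Invertibility is not needed, since a
singular matrix has inverse zero on both sides. -/
lemma map_ofReal_inv {m : ℕ} (A : Matrix (Fin m) (Fin m) ℝ) :
    A⁻¹.map Complex.ofReal = (A.map Complex.ofReal)⁻¹ := by
  have h : (Complex.ofRealHom.mapMatrix A).det = Complex.ofReal A.det :=
    (RingHom.map_det Complex.ofRealHom A).symm
  have h' : (Complex.ofRealHom.mapMatrix A).adjugate = Complex.ofRealHom.mapMatrix A.adjugate :=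
    (RingHom.map_adjugate Complex.ofRealHom A).symm
  change _ = (Complex.ofRealHom.mapMatrix A)⁻¹
  rw [Matrix.inv_def, Matrix.inv_def, h, h', Ring.inverse_eq_inv', Ring.inverse_eq_inv']
  ext i j
  simp

/-- At interior points the gradient represents the differential. -/
lemma inner_grad_left (M : ConicManifold n B Y) {p : B} (hp : p ∈ (𝓡∂ (n + 1)).interior B)
    (φ : B → ℂ) (X : Fin (n + 1) → ℂ) :
    M.inner p (M.grad φ p) X = differential φ p ⬝ᵥ X := by
  have hdet : IsUnit (M.gram p).det := (M.gram_posDef hp).det_pos.ne'.isUnit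
  rw [inner_comm, inner_eq_dotProduct, grad_eq_mulVec, Matrix.mulVec_mulVec]
  have : (M.gram p).map Complex.ofReal * (M.gram p)⁻¹.map Complex.ofReal = 1 := by
    change Complex.ofRealHom.mapMatrix _ * Complex.ofRealHom.mapMatrix _ = 1
    rw [← map_mul, Matrix.mul_nonsing_inv _ hdet, map_one]
  rw [this, Matrix.one_mulVec, dotProduct_comm]

/-- The metric is the Euclidean inner product in a suitable basis. -/
lemma exists_inner_eq (M : ConicManifold n B Y) {p : B} (hp : p ∈ (𝓡∂ (n + 1)).interior B) :
    ∃ R : (Fin (n + 1) → ℂ) →ₗ[ℂ] EuclideanSpace ℂ (Fin (n + 1)),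
      (∀ X Z, M.inner p X Z = ∑ i, R X i * R Z i) ∧ ∀ X, M.normSq p X = ‖R X‖ ^ 2 := by
  open scoped MatrixOrder Matrix.Norms.L2Operator in
  obtain ⟨A, hA⟩ : ∃ A : Matrix (Fin (n + 1)) (Fin (n + 1)) ℝ, M.gram p = Aᴴ * A :=
    CStarAlgebra.nonneg_iff_eq_star_mul_self.mp (M.gram_posDef hp).posSemidef.nonneg
  have key : ∀ X Z, M.inner p X Z =
      ∑ i, (A.map Complex.ofReal *ᵥ X) i * (A.map Complex.ofReal *ᵥ Z) i := by
    intro X Z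
    have : (M.gram p).map Complex.ofReal =
        (A.map Complex.ofReal)ᵀ * A.map Complex.ofReal := by
      rw [hA, Matrix.conjTranspose_eq_transpose_of_trivial]
      exact map_mul Complex.ofRealHom.mapMatrix Aᵀ A
    rw [inner_eq_dotProduct, this, ← Matrix.mulVec_mulVec, Matrix.dotProduct_mulVec,
      Matrix.vecMul_transpose]
    rfl
  refine ⟨(WithLp.linearEquiv 2 ℂ _).symm.toLinearMap ∘ₗ (A.map Complex.ofReal).mulVecLin,
    key, fun X => ?_⟩
  have hstar : A.map Complex.ofReal *ᵥ star X = star (A.map Complex.ofReal *ᵥ X) := by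
    ext i
    simp [Matrix.mulVec, dotProduct, star_sum]
  rw [normSq, key, hstar, EuclideanSpace.norm_sq_eq, Complex.re_sum]
  refine Finset.sum_congr rfl fun i _ => ?_
  simp only [Pi.star_apply, RCLike.star_def, Complex.mul_conj, Complex.ofReal_re]
  rw [Complex.normSq_eq_norm_sq]
  rfl

lemma normSq_nonneg (M : ConicManifold n B Y) {p : B} (hp : p ∈ (𝓡∂ (n + 1)).interior B)
    (X : Fin (n + 1) → ℂ) : 0 ≤ M.normSq p X := by
  obtain ⟨R, -, hR⟩ := M.exists_inner_eq hp
  rw [hR]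
  positivity

lemma norm_inner_le (M : ConicManifold n B Y) {p : B} (hp : p ∈ (𝓡∂ (n + 1)).interior B)
    (X Z : Fin (n + 1) → ℂ) :
    ‖M.inner p X Z‖ ≤ √(M.normSq p X) * √(M.normSq p Z) := by
  obtain ⟨R, hR, hR'⟩ := M.exists_inner_eq hp
  rw [hR, hR', hR', Real.sqrt_sq (norm_nonneg _), Real.sqrt_sq (norm_nonneg _)]
  calc ‖∑ i, R X i * R Z i‖ ≤ ∑ i, ‖R X i‖ * ‖R Z i‖ := by
        refine (norm_sum_le _ _).trans_eq ?_
        simp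
    _ ≤ √(∑ i, ‖R X i‖ ^ 2) * √(∑ i, ‖R Z i‖ ^ 2) := Real.sum_mul_le_sqrt_mul_sqrt _ _ _
    _ = _ := by rw [EuclideanSpace.norm_eq, EuclideanSpace.norm_eq]

lemma normSq_sub_le (M : ConicManifold n B Y) {p : B} (hp : p ∈ (𝓡∂ (n + 1)).interior B)
    (X Z : Fin (n + 1) → ℂ) :
    M.normSq p (X - Z) ≤ 2 * M.normSq p X + 2 * M.normSq p Z := by
  obtain ⟨R, -, hR'⟩ := M.exists_inner_eq hp
  rw [hR', hR', hR', map_sub]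
  have := norm_sub_le (R X) (R Z)
  nlinarith [norm_nonneg (R X - R Z), sq_nonneg (‖R X‖ - ‖R Z‖), norm_nonneg (R X),
    norm_nonneg (R Z)]

end LinearAlgebra

/-! ### Parametrizations of open subsets of the interior -/

section Param

/-- The differential of a map from the model space to `B`, as an endomorphism of the model
space. -/
noncomputable def derivMap (Φ : EuclideanSpace ℝ (Fin (n + 1)) → B)
    (z : EuclideanSpace ℝ (Fin (n + 1))) :
    EuclideanSpace ℝ (Fin (n + 1)) →ₗ[ℝ] EuclideanSpace ℝ (Fin (n + 1)) :=
  (mfderiv 𝓘(ℝ, EuclideanSpace ℝ (Fin (n + 1))) (𝓡∂ (n + 1)) Φ z).toLinearMap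

/-- The Jacobian matrix of a map from the model space to `B`, in the standard bases. -/
noncomputable def jacobian (Φ : EuclideanSpace ℝ (Fin (n + 1)) → B)
    (z : EuclideanSpace ℝ (Fin (n + 1))) : Matrix (Fin (n + 1)) (Fin (n + 1)) ℝ :=
  Matrix.of fun i j => derivMap Φ z (EuclideanSpace.single j 1) i

/-- The Gram matrix of the pullback of `g` under a map from the model space to `B`. -/
noncomputable def pullGram (M : ConicManifold n B Y) (Φ : EuclideanSpace ℝ (Fin (n + 1)) → B)
    (z : EuclideanSpace ℝ (Fin (n + 1))) : Matrix (Fin (n + 1)) (Fin (n + 1)) ℝ :=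
  Matrix.of fun i j => M.g (Φ z)
    (mfderiv 𝓘(ℝ, EuclideanSpace ℝ (Fin (n + 1))) (𝓡∂ (n + 1)) Φ z (EuclideanSpace.single i 1))
    (mfderiv 𝓘(ℝ, EuclideanSpace ℝ (Fin (n + 1))) (𝓡∂ (n + 1)) Φ z (EuclideanSpace.single j 1))

/-- `Φ` is a smooth parametrization of an open subset of the interior of `B` by the open set
`S`. -/
structure IsParam (Φ : EuclideanSpace ℝ (Fin (n + 1)) → B)
    (S : Set (EuclideanSpace ℝ (Fin (n + 1)))) : Prop where
  isOpen : IsOpen S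
  contMDiffOn : ContMDiffOn 𝓘(ℝ, EuclideanSpace ℝ (Fin (n + 1))) (𝓡∂ (n + 1)) ∞ Φ S
  injOn : InjOn Φ S
  mapsTo : MapsTo Φ S ((𝓡∂ (n + 1)).interior B)
  isOpen_image : IsOpen (Φ '' S)
  det_ne_zero : ∀ z ∈ S, (jacobian Φ z).det ≠ 0

variable {Φ : EuclideanSpace ℝ (Fin (n + 1)) → B} {S : Set (EuclideanSpace ℝ (Fin (n + 1)))}
  {z : EuclideanSpace ℝ (Fin (n + 1))}

lemma IsParam.contMDiffAt (h : IsParam Φ S) (hz : z ∈ S) :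
    ContMDiffAt 𝓘(ℝ, EuclideanSpace ℝ (Fin (n + 1))) (𝓡∂ (n + 1)) ∞ Φ z :=
  h.contMDiffOn.contMDiffAt (h.isOpen.mem_nhds hz)

lemma IsParam.mdifferentiableAt (h : IsParam Φ S) (hz : z ∈ S) :
    MDifferentiableAt 𝓘(ℝ, EuclideanSpace ℝ (Fin (n + 1))) (𝓡∂ (n + 1)) Φ z :=
  (h.contMDiffAt hz).mdifferentiableAt (by simp)

lemma derivMap_apply (v : EuclideanSpace ℝ (Fin (n + 1))) :
    (derivMap Φ z v).ofLp = jacobian Φ z *ᵥ v.ofLp := by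
  ext i
  have hv := (EuclideanSpace.basisFun (Fin (n + 1)) ℝ).sum_repr v
  conv_lhs => rw [← hv]
  simp only [map_sum, map_smul, EuclideanSpace.basisFun_repr, EuclideanSpace.basisFun_apply,
    WithLp.ofLp_sum, Finset.sum_apply, PiLp.smul_apply, smul_eq_mul, Matrix.mulVec, dotProduct]
  refine Finset.sum_congr rfl fun j _ => ?_
  rw [mul_comm]
  rfl

lemma pullGram_eq (M : ConicManifold n B Y) (Φ : EuclideanSpace ℝ (Fin (n + 1)) → B)
    (z : EuclideanSpace ℝ (Fin (n + 1))) :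
    M.pullGram Φ z = (jacobian Φ z)ᵀ * M.gram (Φ z) * jacobian Φ z := by
  ext i j
  have := M.g_apply (Φ z) (derivMap Φ z (EuclideanSpace.single i 1))
    (derivMap Φ z (EuclideanSpace.single j 1))
  rw [Matrix.mul_assoc, Matrix.mul_apply]
  exact this

lemma IsParam.pullGram_posDef (M : ConicManifold n B Y) (h : IsParam Φ S) (hz : z ∈ S) :
    (M.pullGram Φ z).PosDef := by
  rw [pullGram_eq, ← Matrix.conjTranspose_eq_transpose_of_trivial]
  refine (M.gram_posDef (h.mapsTo hz)).conjTranspose_mul_mul_same ?_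
  rw [Matrix.mulVec_injective_iff_isUnit, Matrix.isUnit_iff_isUnit_det]
  exact (h.det_ne_zero z hz).isUnit

lemma IsParam.sqrt_det_pullGram_pos (M : ConicManifold n B Y) (h : IsParam Φ S) (hz : z ∈ S) :
    0 < √(M.pullGram Φ z).det :=
  Real.sqrt_pos.2 (h.pullGram_posDef M hz).det_pos

lemma fderiv_comp_param (hΦ : MDifferentiableAt 𝓘(ℝ, EuclideanSpace ℝ (Fin (n + 1)))
    (𝓡∂ (n + 1)) Φ z) {φ : B → ℂ} (hφ : MDifferentiableAt (𝓡∂ (n + 1)) 𝓘(ℝ, ℂ) φ (Φ z))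
    (v : EuclideanSpace ℝ (Fin (n + 1))) :
    fderiv ℝ (φ ∘ Φ) z v =
      differential φ (Φ z) ⬝ᵥ fun i => ((jacobian Φ z *ᵥ v.ofLp) i : ℂ) := by
  rw [← mfderiv_eq_fderiv, mfderiv_comp z hφ hΦ]
  let L : EuclideanSpace ℝ (Fin (n + 1)) →ₗ[ℝ] ℂ :=
    (mfderiv (𝓡∂ (n + 1)) 𝓘(ℝ, ℂ) φ (Φ z)).toLinearMap
  let w : EuclideanSpace ℝ (Fin (n + 1)) :=
    mfderiv 𝓘(ℝ, EuclideanSpace ℝ (Fin (n + 1))) (𝓡∂ (n + 1)) Φ z v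
  change L w = _
  have hv := (EuclideanSpace.basisFun (Fin (n + 1)) ℝ).sum_repr w
  conv_lhs => rw [← hv]
  simp only [map_sum, map_smul, EuclideanSpace.basisFun_repr, EuclideanSpace.basisFun_apply,
    Complex.real_smul, dotProduct, ← derivMap_apply]
  exact Finset.sum_congr rfl fun j _ => mul_comm _ _

lemma fderiv_comp_param_single (hΦ : MDifferentiableAt 𝓘(ℝ, EuclideanSpace ℝ (Fin (n + 1)))
    (𝓡∂ (n + 1)) Φ z) {φ : B → ℂ} (hφ : MDifferentiableAt (𝓡∂ (n + 1)) 𝓘(ℝ, ℂ) φ (Φ z)) :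
    (fun j => fderiv ℝ (φ ∘ Φ) z (EuclideanSpace.single j 1)) =
      ((jacobian Φ z).map Complex.ofReal)ᵀ *ᵥ differential φ (Φ z) := by
  ext j
  rw [fderiv_comp_param hΦ hφ, dotProduct_comm]
  simp [Matrix.mulVec, dotProduct]

/-- Coordinate invariance of `g^{ij} ∂_jφ ∂_iψ`: the Gram matrix pulls back to `Jᵀ G J` and
differentials to `Jᵀ dφ`, so the Jacobians cancel. -/
lemma IsParam.inner_grad_grad (M : ConicManifold n B Y) (h : IsParam Φ S) (hz : z ∈ S)
    {φ ψ : B → ℂ} (hφ : MDifferentiableAt (𝓡∂ (n + 1)) 𝓘(ℝ, ℂ) φ (Φ z))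
    (hψ : MDifferentiableAt (𝓡∂ (n + 1)) 𝓘(ℝ, ℂ) ψ (Φ z)) :
    M.inner (Φ z) (M.grad φ (Φ z)) (M.grad ψ (Φ z)) =
      ∑ i, (∑ j, (((M.pullGram Φ z)⁻¹ i j : ℝ) : ℂ) *
        fderiv ℝ (φ ∘ Φ) z (EuclideanSpace.single j 1)) *
          fderiv ℝ (ψ ∘ Φ) z (EuclideanSpace.single i 1) := by
  have hJ : IsUnit ((jacobian Φ z).map Complex.ofReal).det := by
    have : ((jacobian Φ z).map Complex.ofReal).det = Complex.ofReal (jacobian Φ z).det :=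
      (RingHom.map_det Complex.ofRealHom (jacobian Φ z)).symm
    rw [this, isUnit_iff_ne_zero, Complex.ofReal_ne_zero]
    exact h.det_ne_zero z hz
  have hφ' := fderiv_comp_param_single (h.mdifferentiableAt hz) hφ
  have hψ' := fderiv_comp_param_single (h.mdifferentiableAt hz) hψ
  have hG : (M.pullGram Φ z)⁻¹.map Complex.ofReal =
      ((jacobian Φ z).map Complex.ofReal)⁻¹ * (M.gram (Φ z))⁻¹.map Complex.ofReal *
        (((jacobian Φ z).map Complex.ofReal)ᵀ)⁻¹ := by
    rw [pullGram_eq, Matrix.mul_inv_rev, Matrix.mul_inv_rev, ← Matrix.mul_assoc]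
    rw [← map_ofReal_inv]
    change Complex.ofRealHom.mapMatrix (_ * _ * _) = _
    rw [map_mul, map_mul]
    congr 1
    exact map_ofReal_inv (jacobian Φ z)ᵀ
  have hrhs : (∑ i, (∑ j, (((M.pullGram Φ z)⁻¹ i j : ℝ) : ℂ) *
        fderiv ℝ (φ ∘ Φ) z (EuclideanSpace.single j 1)) *
          fderiv ℝ (ψ ∘ Φ) z (EuclideanSpace.single i 1)) =
      ((M.pullGram Φ z)⁻¹.map Complex.ofReal *ᵥ
        (fun j => fderiv ℝ (φ ∘ Φ) z (EuclideanSpace.single j 1))) ⬝ᵥ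
        (fun j => fderiv ℝ (ψ ∘ Φ) z (EuclideanSpace.single j 1)) := rfl
  rw [hrhs, hφ', hψ', hG, inner_comm, M.inner_grad_left (h.mapsTo hz), grad_eq_mulVec,
    Matrix.mulVec_mulVec, Matrix.mul_assoc,
    Matrix.nonsing_inv_mul _ (by rwa [Matrix.det_transpose]), Matrix.mul_one,
    Matrix.dotProduct_mulVec _ ((jacobian Φ z).map Complex.ofReal)ᵀ, Matrix.vecMul_transpose,
    Matrix.mulVec_mulVec, ← Matrix.mul_assoc,
    Matrix.mul_nonsing_inv _ hJ, Matrix.one_mul, dotProduct_comm]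

/-- A differentiable local left inverse makes the derivative injective, so no nonzero vector lies in
the kernel of the Jacobian. -/
lemma det_jacobian_ne_zero (hΦ : MDifferentiableAt 𝓘(ℝ, EuclideanSpace ℝ (Fin (n + 1)))
    (𝓡∂ (n + 1)) Φ z) {Ψ : B → EuclideanSpace ℝ (Fin (n + 1))}
    (hΨ : MDifferentiableAt (𝓡∂ (n + 1)) 𝓘(ℝ, EuclideanSpace ℝ (Fin (n + 1))) Ψ (Φ z))
    (h : Ψ ∘ Φ =ᶠ[𝓝 z] id) : (jacobian Φ z).det ≠ 0 := by
  intro hdet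
  obtain ⟨v, hv, hv'⟩ := Matrix.exists_mulVec_eq_zero_iff.2 hdet
  have h1 : mfderiv 𝓘(ℝ, EuclideanSpace ℝ (Fin (n + 1))) 𝓘(ℝ, EuclideanSpace ℝ (Fin (n + 1)))
      (Ψ ∘ Φ) z = ContinuousLinearMap.id ℝ _ := by
    rw [h.mfderiv_eq, mfderiv_id]
  rw [mfderiv_comp z hΨ hΦ] at h1
  have h2 : mfderiv 𝓘(ℝ, EuclideanSpace ℝ (Fin (n + 1))) (𝓡∂ (n + 1)) Φ z
      (WithLp.toLp 2 v : EuclideanSpace ℝ (Fin (n + 1))) = 0 := by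
    refine PiLp.ext fun i => ?_
    refine (congrFun (derivMap_apply (Φ := Φ) (z := z) (WithLp.toLp 2 v)) i).trans ?_
    change (jacobian Φ z *ᵥ v) i = 0
    rw [hv']
    rfl
  have h3 := congrArg (fun L => L (WithLp.toLp 2 v : EuclideanSpace ℝ (Fin (n + 1)))) h1
  have h4 : (WithLp.toLp 2 v : EuclideanSpace ℝ (Fin (n + 1))) = 0 := by
    refine h3.symm.trans ?_
    refine (congrArg (mfderiv (𝓡∂ (n + 1)) 𝓘(ℝ, EuclideanSpace ℝ (Fin (n + 1))) Ψ (Φ z)) h2).trans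
      (map_zero _)
  exact hv (congrArg WithLp.ofLp h4)

/-- The pushforward of a constant vector field is smooth along the map. -/
lemma contMDiffOn_mfderiv_const {V F H N : Type*} [NormedAddCommGroup V] [NormedSpace ℝ V]
    [NormedAddCommGroup F] [NormedSpace ℝ F] [TopologicalSpace H] {I : ModelWithCorners ℝ F H}
    [TopologicalSpace N] [ChartedSpace H N] [IsManifold I ∞ N] {Ψ : V → N} {T : Set V}
    (hT : IsOpen T) (hΨ : ContMDiffOn 𝓘(ℝ, V) I ∞ Ψ T) (v : V) :
    ContMDiffOn 𝓘(ℝ, V) (I.prod 𝓘(ℝ, F)) ∞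
      (fun z => TotalSpace.mk' F (E := fun p : N => TangentSpace I p) (Ψ z)
        (mfderiv 𝓘(ℝ, V) I Ψ z v)) T := by
  have ht := hΨ.contMDiffOn_tangentMapWithin (m := ∞) (by simp) hT.uniqueMDiffOn
  have hs : ContMDiffOn 𝓘(ℝ, V) 𝓘(ℝ, V).tangent ∞
      (fun z => (⟨z, v⟩ : TangentBundle 𝓘(ℝ, V) V)) T :=
    fun z _ => contMDiffWithinAt_vectorSpace_iff_contDiffWithinAt.2 contDiffWithinAt_const
  refine (ht.comp hs (fun z hz => hz)).congr fun z hz => ?_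
  change _ = (⟨Ψ z, mfderivWithin _ _ Ψ T z _⟩ : TangentBundle I N)
  rw [mfderivWithin_of_isOpen hT hz]

/-- The coefficients of the pullback metric are smooth. -/
lemma IsParam.contDiffOn_pullGram (M : ConicManifold n B Y) (h : IsParam Φ S)
    (i j : Fin (n + 1)) : ContDiffOn ℝ ∞ (fun z => M.pullGram Φ z i j) S := by
  have h2 : ContMDiffOn 𝓘(ℝ, EuclideanSpace ℝ (Fin (n + 1))) ((𝓡∂ (n + 1)).prod 𝓘(ℝ, ℝ)) ∞
      (fun z => TotalSpace.mk' ℝ (E := Bundle.Trivial B ℝ) (Φ z) (M.pullGram Φ z i j)) S := by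
    apply ContMDiffOn.clm_bundle_apply₂ (F₁ := EuclideanSpace ℝ (Fin (n + 1)))
      (F₂ := EuclideanSpace ℝ (Fin (n + 1)))
    · exact M.contMDiff_g.comp_contMDiffOn h.contMDiffOn
    · exact contMDiffOn_mfderiv_const h.isOpen h.contMDiffOn _
    · exact contMDiffOn_mfderiv_const h.isOpen h.contMDiffOn _
  rw [← contMDiffOn_iff_contDiffOn]
  intro z hz
  have := h2 z hz
  simp only [contMDiffWithinAt_totalSpace] at this
  exact this.2

end Param

/-! ### Smoothness of the metric coefficients; charts as parametrizations -/

section ParamSmooth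

variable {Φ : EuclideanSpace ℝ (Fin (n + 1)) → B} {S : Set (EuclideanSpace ℝ (Fin (n + 1)))}
  {z : EuclideanSpace ℝ (Fin (n + 1))}

lemma _root_.ContDiffOn.matrix_det {V : Type*} [NormedAddCommGroup V] [NormedSpace ℝ V]
    {m : ℕ} {A : V → Matrix (Fin m) (Fin m) ℝ} {s : Set V}
    (hA : ∀ i j, ContDiffOn ℝ ∞ (fun z => A z i j) s) :
    ContDiffOn ℝ ∞ (fun z => (A z).det) s := by
  simp only [Matrix.det_apply]
  refine ContDiffOn.sum fun σ _ => ?_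
  exact (contDiffOn_prod fun i _ => hA (σ i) i).const_smul _

lemma _root_.ContDiffOn.matrix_inv {V : Type*} [NormedAddCommGroup V] [NormedSpace ℝ V]
    {m : ℕ} {A : V → Matrix (Fin m) (Fin m) ℝ} {s : Set V}
    (hA : ∀ i j, ContDiffOn ℝ ∞ (fun z => A z i j) s) (h0 : ∀ z ∈ s, (A z).det ≠ 0)
    (i j : Fin m) : ContDiffOn ℝ ∞ (fun z => (A z)⁻¹ i j) s := by
  have h : ContDiffOn ℝ ∞ (fun z => ((A z).det)⁻¹ * (A z).adjugate i j) s := by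
    refine ((ContDiffOn.matrix_det hA).inv h0).mul ?_
    simp only [Matrix.adjugate_apply]
    refine ContDiffOn.matrix_det fun k l => ?_
    simp only [Matrix.updateRow_apply]
    split_ifs
    · exact contDiffOn_const
    · exact hA k l
  refine h.congr fun z _ => ?_
  rw [Matrix.inv_def, Ring.inverse_eq_inv']
  rfl

lemma IsParam.contDiffOn_inv_pullGram (M : ConicManifold n B Y) (h : IsParam Φ S)
    (i j : Fin (n + 1)) : ContDiffOn ℝ ∞ (fun z => (M.pullGram Φ z)⁻¹ i j) S :=
  ContDiffOn.matrix_inv (h.contDiffOn_pullGram M)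
    (fun _ hz => (h.pullGram_posDef M hz).det_pos.ne') i j

lemma IsParam.contDiffOn_sqrt_det (M : ConicManifold n B Y) (h : IsParam Φ S) :
    ContDiffOn ℝ ∞ (fun z => √(M.pullGram Φ z).det) S :=
  (ContDiffOn.matrix_det (h.contDiffOn_pullGram M)).sqrt
    fun _ hz => (h.pullGram_posDef M hz).det_pos.ne'

/-- Interior points are defined through the preferred chart of each point; being interior does not
depend on the chart, so a single chart around `c` detects them. -/
lemma symm_mem_interior_iff {c : B} {z : EuclideanSpace ℝ (Fin (n + 1))}
    (hz : z ∈ (extChartAt (𝓡∂ (n + 1)) c).target) :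
    (extChartAt (𝓡∂ (n + 1)) c).symm z ∈ (𝓡∂ (n + 1)).interior B ↔
      z ∈ interior (extChartAt (𝓡∂ (n + 1)) c).target := by
  have hs := (extChartAt (𝓡∂ (n + 1)) c).map_target hz
  rw [extChartAt_source] at hs
  refine ((𝓡∂ (n + 1)).isInteriorPoint_iff_of_mem_atlas (n := ∞) (by simp)
    (chart_mem_atlas _ c) hs).trans ?_
  change extChartAt (𝓡∂ (n + 1)) c _ ∈ interior (extChartAt (𝓡∂ (n + 1)) c).target ↔ _
  rw [(extChartAt (𝓡∂ (n + 1)) c).right_inv hz]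

lemma mem_interior_iff {c p : B} (hp : p ∈ (extChartAt (𝓡∂ (n + 1)) c).source) :
    p ∈ (𝓡∂ (n + 1)).interior B ↔
      extChartAt (𝓡∂ (n + 1)) c p ∈ interior (extChartAt (𝓡∂ (n + 1)) c).target := by
  rw [← symm_mem_interior_iff ((extChartAt (𝓡∂ (n + 1)) c).map_source hp),
    (extChartAt (𝓡∂ (n + 1)) c).left_inv hp]

lemma image_symm_interior (c : B) :
    (extChartAt (𝓡∂ (n + 1)) c).symm '' interior (extChartAt (𝓡∂ (n + 1)) c).target =
      (extChartAt (𝓡∂ (n + 1)) c).source ∩ (𝓡∂ (n + 1)).interior B := by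
  ext p
  constructor
  · rintro ⟨z, hz, rfl⟩
    exact ⟨(extChartAt (𝓡∂ (n + 1)) c).map_target (interior_subset hz),
      (symm_mem_interior_iff (interior_subset hz)).2 hz⟩
  · rintro ⟨hp, hp'⟩
    exact ⟨_, (mem_interior_iff hp).1 hp', (extChartAt (𝓡∂ (n + 1)) c).left_inv hp⟩

variable (n B) in
lemma isOpen_interior : IsOpen ((𝓡∂ (n + 1)).interior B) :=
  (𝓡∂ (n + 1)).isOpen_interior (n := ∞) (by simp)

lemma isParam_chart (c : B) :
    IsParam (n := n) (extChartAt (𝓡∂ (n + 1)) c).symm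
      (interior (extChartAt (𝓡∂ (n + 1)) c).target) where
  isOpen := _root_.isOpen_interior
  contMDiffOn := (contMDiffOn_extChartAt_symm c).mono interior_subset
  injOn := (extChartAt (𝓡∂ (n + 1)) c).symm.injOn.mono interior_subset
  mapsTo := fun _ hz => (symm_mem_interior_iff (interior_subset hz)).2 hz
  isOpen_image := by
    rw [image_symm_interior]
    exact (isOpen_extChartAt_source c).inter (isOpen_interior n B)
  det_ne_zero := fun z hz => by
    have hz' := interior_subset hz
    have hs := (extChartAt (𝓡∂ (n + 1)) c).map_target hz'
    refine det_jacobian_ne_zero (Ψ := extChartAt (𝓡∂ (n + 1)) c) ?_ ?_ ?_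
    · exact ((contMDiffOn_extChartAt_symm (n := ∞) c).contMDiffAt
        (mem_interior_iff_mem_nhds.1 hz)).mdifferentiableAt (by simp)
    · exact (contMDiffAt_extChartAt' (n := ∞)
        (by rwa [extChartAt_source] at hs)).mdifferentiableAt (by simp)
    · filter_upwards [mem_interior_iff_mem_nhds.1 hz] with w hw
      exact (extChartAt (𝓡∂ (n + 1)) c).right_inv hw

/-- At an interior point the range of the model is a neighbourhood, so the derivative within it is
the ordinary derivative. -/
lemma chartMetric_eq (M : ConicManifold n B Y) {c : B}
    (hz : z ∈ interior (extChartAt (𝓡∂ (n + 1)) c).target) :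
    M.chartMetric c z = M.pullGram (extChartAt (𝓡∂ (n + 1)) c).symm z := by
  have : range (𝓡∂ (n + 1)) ∈ 𝓝 z :=
    mem_of_superset (mem_interior_iff_mem_nhds.1 hz) (extChartAt_target_subset_range c)
  simp only [chartMetric, pullGram, mfderivWithin_of_mem_nhds this]

/-- The difference lies in the frontier of the half-space, and the frontier of a convex set is a
null set. -/
lemma volume_target_diff_interior (c : B) :
    volume ((extChartAt (𝓡∂ (n + 1)) c).target \ interior (extChartAt (𝓡∂ (n + 1)) c).target)
      = 0 := by
  refine measure_mono_null (t := frontier (range (𝓡∂ (n + 1)))) ?_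
    ((𝓡∂ (n + 1)).convex_range.addHaar_frontier _)
  rintro z ⟨hz, hz'⟩
  refine ⟨subset_closure (extChartAt_target_subset_range c hz), fun h => hz' ?_⟩
  rw [extChartAt_target] at hz ⊢
  have ho : IsOpen ((𝓡∂ (n + 1)).symm ⁻¹' (chartAt (EuclideanHalfSpace (n + 1)) c).target) :=
    (chartAt _ c).open_target.preimage (𝓡∂ (n + 1)).continuous_symm
  rw [interior_inter, ho.interior_eq]
  exact ⟨hz.1, h⟩

end ParamSmooth

/-! ### The Riemannian measure in coordinates -/

section Measure

variable {Φ : EuclideanSpace ℝ (Fin (n + 1)) → B} {S : Set (EuclideanSpace ℝ (Fin (n + 1)))}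
  {z : EuclideanSpace ℝ (Fin (n + 1))} [MeasurableSpace B] [BorelSpace B]

/-- The measure `√det (g_ij) dz` in the coordinates given by the parametrization `Φ`. -/
noncomputable def paramMeasure (M : ConicManifold n B Y)
    (Φ : EuclideanSpace ℝ (Fin (n + 1)) → B) (S : Set (EuclideanSpace ℝ (Fin (n + 1)))) :
    Measure B :=
  Measure.map Φ ((volume.restrict S).withDensity
    fun z => ENNReal.ofReal √(M.pullGram Φ z).det)

lemma IsParam.continuousOn (h : IsParam Φ S) : ContinuousOn Φ S := h.contMDiffOn.continuousOn

lemma IsParam.measurableSet_preimage (h : IsParam Φ S) {A : Set B} (hA : MeasurableSet A) :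
    MeasurableSet (S ∩ Φ ⁻¹' A) := by
  have := (h.continuousOn.domRestrict.measurable hA)
  have h2 := h.isOpen.measurableSet.subtype_image this
  convert h2 using 1
  ext z
  simp [and_comm]

lemma IsParam.aemeasurable (h : IsParam Φ S) : AEMeasurable Φ (volume.restrict S) :=
  h.continuousOn.aemeasurable h.isOpen.measurableSet

lemma IsParam.paramMeasure_apply (M : ConicManifold n B Y) (h : IsParam Φ S) {A : Set B}
    (hA : MeasurableSet A) :
    M.paramMeasure Φ S A = ∫⁻ z in S ∩ Φ ⁻¹' A, ENNReal.ofReal √(M.pullGram Φ z).det := by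
  have hac : AEMeasurable Φ ((volume.restrict S).withDensity
      fun z => ENNReal.ofReal √(M.pullGram Φ z).det) :=
    h.aemeasurable.mono_ac (withDensity_absolutelyContinuous _ _)
  rw [paramMeasure, Measure.map_apply_of_aemeasurable hac hA]
  -- Nothing is known about `Φ` off `S`, so `Φ ⁻¹' A` itself may fail to be measurable. As no mass
  -- lies off `S`, it can be replaced by its measurable intersection with `S`.
  have h0 : ((volume.restrict S).withDensity fun z => ENNReal.ofReal √(M.pullGram Φ z).det)
      Sᶜ = 0 := by
    refine withDensity_absolutelyContinuous _ _ ?_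
    rw [Measure.restrict_apply h.isOpen.measurableSet.compl]
    simp
  rw [← measure_inter_add_sdiff (Φ ⁻¹' A) h.isOpen.measurableSet,
    measure_mono_null (s := Φ ⁻¹' A \ S) (fun z hz => hz.2) h0, add_zero, inter_comm,
    withDensity_apply _ (h.measurableSet_preimage hA),
    Measure.restrict_restrict (h.measurableSet_preimage hA),
    inter_eq_left.2 inter_subset_left]

/-- A parametrization and a chart define the same measure where both are defined. -/
lemma IsParam.paramMeasure_eq_chart (M : ConicManifold n B Y) (h : IsParam Φ S) (c : B)
    {A : Set B} (hA : MeasurableSet A) (hA' : A ⊆ Φ '' S)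
    (hAc : A ⊆ (extChartAt (𝓡∂ (n + 1)) c).source) :
    M.paramMeasure Φ S A = M.paramMeasure (extChartAt (𝓡∂ (n + 1)) c).symm
      (interior (extChartAt (𝓡∂ (n + 1)) c).target) A := by
  have hc := isParam_chart (n := n) c
  set κ := extChartAt (𝓡∂ (n + 1)) c with hκ
  rw [h.paramMeasure_apply M hA, hc.paramMeasure_apply M hA]
  have hint : A ⊆ (𝓡∂ (n + 1)).interior B := fun p hp => by
    obtain ⟨z, hz, rfl⟩ := hA' hp
    exact h.mapsTo hz
  -- Change of variables along the transition map `κ ∘ Φ`, restricted to the part of the parameter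
  -- domain lying over `A`.
  have himage : (κ ∘ Φ) '' (S ∩ Φ ⁻¹' A) = interior κ.target ∩ κ.symm ⁻¹' A := by
    ext w
    constructor
    · rintro ⟨z, ⟨-, hzA⟩, rfl⟩
      refine ⟨(mem_interior_iff (hAc hzA)).1 (hint hzA), ?_⟩
      simp only [mem_preimage, Function.comp_apply]
      rwa [κ.left_inv (hAc hzA)]
    · rintro ⟨hw, hwA⟩
      obtain ⟨z, hz, hz'⟩ := hA' hwA
      refine ⟨z, ⟨hz, ?_⟩, ?_⟩
      · rw [mem_preimage, hz']
        exact hwA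
      · simp only [Function.comp_apply, hz']
        exact κ.right_inv (interior_subset hw)
  have hd : ∀ z ∈ S ∩ Φ ⁻¹' A, DifferentiableAt ℝ (κ ∘ Φ) z := by
    rintro z ⟨hz, hzA⟩
    have h1 : ContMDiffAt (𝓡∂ (n + 1)) 𝓘(ℝ, EuclideanSpace ℝ (Fin (n + 1))) ∞ κ (Φ z) :=
      contMDiffAt_extChartAt' (by
        have := hAc hzA
        rwa [hκ, extChartAt_source] at this)
    exact ((h1.comp z (h.contMDiffAt hz)).mdifferentiableAt (by simp)).differentiableAt
  have hinj : InjOn (κ ∘ Φ) (S ∩ Φ ⁻¹' A) := by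
    rintro z ⟨hz, hzA⟩ w ⟨hw, hwA⟩ hzw
    exact h.injOn hz hw (κ.injOn (hAc hzA) (hAc hwA) hzw)
  rw [← himage, lintegral_image_eq_lintegral_abs_det_fderiv_mul volume
    (h.measurableSet_preimage hA) (fun z hz => (hd z hz).hasFDerivAt.hasFDerivWithinAt) hinj]
  refine setLIntegral_congr_fun (h.measurableSet_preimage hA) ?_
  rintro z ⟨hz, hzA⟩
  have hκz : (κ ∘ Φ) z ∈ interior κ.target := (mem_interior_iff (hAc hzA)).1 (hint hzA)
  have hev : Φ =ᶠ[𝓝 z] κ.symm ∘ (κ ∘ Φ) := by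
    have : Φ ⁻¹' κ.source ∈ 𝓝 z := (h.contMDiffAt hz).continuousAt.preimage_mem_nhds
      ((isOpen_extChartAt_source c).mem_nhds (hAc hzA))
    filter_upwards [this] with w hw
    exact (κ.left_inv hw).symm
  set F : Matrix (Fin (n + 1)) (Fin (n + 1)) ℝ :=
    LinearMap.toMatrix (EuclideanSpace.basisFun (Fin (n + 1)) ℝ).toBasis
      (EuclideanSpace.basisFun (Fin (n + 1)) ℝ).toBasis (fderiv ℝ (κ ∘ Φ) z).toLinearMap with hF
  have hjac : jacobian Φ z = jacobian κ.symm ((κ ∘ Φ) z) * F := by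
    have h1 : mfderiv 𝓘(ℝ, EuclideanSpace ℝ (Fin (n + 1))) (𝓡∂ (n + 1)) Φ z =
        mfderiv 𝓘(ℝ, EuclideanSpace ℝ (Fin (n + 1))) (𝓡∂ (n + 1)) (κ.symm ∘ (κ ∘ Φ)) z :=
      hev.mfderiv_eq
    rw [mfderiv_comp z (hc.mdifferentiableAt hκz) (hd z ⟨hz, hzA⟩).mdifferentiableAt,
      mfderiv_eq_fderiv] at h1
    have h2 (v : EuclideanSpace ℝ (Fin (n + 1))) :
        derivMap Φ z v = derivMap κ.symm ((κ ∘ Φ) z) (fderiv ℝ (κ ∘ Φ) z v) :=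
      congrArg (fun L => L v) h1
    ext i j
    change derivMap Φ z (EuclideanSpace.single j 1) i = _
    rw [h2, derivMap_apply]
    simp only [Matrix.mulVec, dotProduct, Matrix.mul_apply, hF, LinearMap.toMatrix_apply,
      OrthonormalBasis.coe_toBasis, EuclideanSpace.basisFun_apply,
      OrthonormalBasis.coe_toBasis_repr_apply, EuclideanSpace.basisFun_repr]
    rfl
  have hdet : (fderiv ℝ (κ ∘ Φ) z).det = F.det := by
    rw [hF, LinearMap.det_toMatrix]
  -- By congruence the determinant acquires the factor `(det F)²`; its square root is exactly the
  -- `|det F|` of the substitution rule.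
  have hgram : M.pullGram Φ z = Fᵀ * M.pullGram κ.symm ((κ ∘ Φ) z) * F := by
    have hp : κ.symm ((κ ∘ Φ) z) = Φ z := κ.left_inv (hAc hzA)
    rw [pullGram_eq, pullGram_eq, hjac, hp, Matrix.transpose_mul]
    simp only [Matrix.mul_assoc]
  simp only
  rw [hdet, ← ENNReal.ofReal_mul (abs_nonneg _), hgram, Matrix.det_mul, Matrix.det_mul,
    Matrix.det_transpose, mul_right_comm, ← sq,
    Real.sqrt_mul (sq_nonneg _), Real.sqrt_sq_eq_abs]

lemma chartMeasure_eq (M : ConicManifold n B Y) (c : B) :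
    M.chartMeasure c = M.paramMeasure (extChartAt (𝓡∂ (n + 1)) c).symm
      (interior (extChartAt (𝓡∂ (n + 1)) c).target) := by
  rw [chartMeasure, paramMeasure]
  congr 1
  have h1 : volume.restrict (extChartAt (𝓡∂ (n + 1)) c).target =
      volume.restrict (interior (extChartAt (𝓡∂ (n + 1)) c).target) := by
    refine Measure.restrict_congr_set ?_
    rw [ae_eq_set]
    refine ⟨volume_target_diff_interior c, ?_⟩
    rw [sdiff_eq_empty.2 interior_subset, measure_empty]
  rw [h1]
  refine withDensity_congr_ae ?_
  filter_upwards [ae_restrict_mem _root_.isOpen_interior.measurableSet] with z hz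
  rw [chartDensity, chartMetric_eq M hz]

lemma IsParam.paramMeasure_inter (M : ConicManifold n B Y) (h : IsParam Φ S) {A : Set B}
    (hA : MeasurableSet A) : M.paramMeasure Φ S (A ∩ Φ '' S) = M.paramMeasure Φ S A := by
  rw [h.paramMeasure_apply M hA,
    h.paramMeasure_apply M (hA.inter h.isOpen_image.measurableSet)]
  congr 2
  ext z
  constructor
  · rintro ⟨hz, hz', -⟩
    exact ⟨hz, hz'⟩
  · rintro ⟨hz, hz'⟩
    exact ⟨hz, hz', mem_image_of_mem Φ hz⟩

variable [CompactSpace B]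

/-- In any coordinates, the Riemannian measure is `√det (g_ij) dz`, and the boundary is a null
set. -/
lemma riemMeasure_glue (M : ConicManifold n B Y) :
    M.riemMeasure ((𝓡∂ (n + 1)).boundary B) = 0 ∧
    ∀ (Φ : EuclideanSpace ℝ (Fin (n + 1)) → B) (S : Set (EuclideanSpace ℝ (Fin (n + 1)))),
      IsParam Φ S → ∀ A : Set B, MeasurableSet A → A ⊆ Φ '' S →
        M.riemMeasure A = M.paramMeasure Φ S A := by
  -- The finite chart cover is enumerated by a sequence below, which requires a point of `B`.
  obtain hB | hB := isEmpty_or_nonempty B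
  · refine ⟨by simp [riemMeasure, Set.eq_empty_of_isEmpty], fun Φ => (hB.false (Φ 0)).elim⟩
  obtain ⟨t, ht⟩ := isCompact_univ.elim_finite_subcover
    (fun c : B => (extChartAt (𝓡∂ (n + 1)) c).source) (fun c => isOpen_extChartAt_source c)
    (fun p _ => mem_iUnion.2 ⟨p, mem_extChartAt_source p⟩)
  obtain ⟨c, hc⟩ : ∃ c : ℕ → B, (t : Set B) = range c := by
    refine t.countable_toSet.exists_eq_range ?_
    obtain ⟨p⟩ := hB
    obtain ⟨q, hq, -⟩ := mem_iUnion₂.1 (ht (mem_univ p))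
    exact ⟨q, hq⟩
  set U : ℕ → Set B := fun k => (extChartAt (𝓡∂ (n + 1)) (c k)).source ∩
    (𝓡∂ (n + 1)).interior B with hU
  set D : ℕ → Set B := disjointed U with hD
  have hDU : ∀ k, D k ⊆ U k := disjointed_subset U
  have hDm : ∀ k, MeasurableSet (D k) := fun k => MeasurableSet.disjointed
    (fun i => ((isOpen_extChartAt_source (c i)).inter (isOpen_interior n B)).measurableSet) k
  have hDcover : ⋃ k, D k = (𝓡∂ (n + 1)).interior B := by
    rw [hD, iUnion_disjointed]
    refine Subset.antisymm (iUnion_subset fun k => inter_subset_right) fun p hp => ?_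
    obtain ⟨q, hq, hpq⟩ := mem_iUnion₂.1 (ht (mem_univ p))
    obtain ⟨k, rfl⟩ : q ∈ range c := hc ▸ hq
    exact mem_iUnion.2 ⟨k, hpq, hp⟩
  have hdisj : Pairwise (Function.onFun Disjoint D) := disjoint_disjointed U
  let P : ℕ → Measure B := fun k => M.paramMeasure (extChartAt (𝓡∂ (n + 1)) (c k)).symm
      (interior (extChartAt (𝓡∂ (n + 1)) (c k)).target)
  have hsplit (ν : Measure B) {A : Set B} (hA : MeasurableSet A)
      (hA' : A ⊆ (𝓡∂ (n + 1)).interior B) : ν A = ∑' k, ν (A ∩ D k) := by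
    rw [← measure_iUnion (fun i j hij => (hdisj hij).mono inter_subset_right inter_subset_right)
      (fun k => hA.inter (hDm k)), ← inter_iUnion, hDcover, inter_eq_left.2 hA']
  -- The glued measure: `ρ` follows the `k`-th chart on the `k`-th piece of a disjoint cover of the
  -- interior. It agrees with every parametrization measure, so it bounds all chart measures and
  -- hence their supremum. Conversely each of its pieces comes from a single chart measure and so
  -- lies below the supremum.
  let ρ : Measure B := Measure.sum fun k => (P k).restrict (D k)
  have hρ {A : Set B} (hA : MeasurableSet A) : ρ A = ∑' k, P k (A ∩ D k) := by
    rw [Measure.sum_apply _ hA]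
    exact tsum_congr fun k => Measure.restrict_apply hA
  have hkey {Φ : EuclideanSpace ℝ (Fin (n + 1)) → B}
      {S : Set (EuclideanSpace ℝ (Fin (n + 1)))} (h : IsParam Φ S) {A : Set B}
      (hA : MeasurableSet A) (hA' : A ⊆ Φ '' S) : ρ A = M.paramMeasure Φ S A := by
    have hAi : A ⊆ (𝓡∂ (n + 1)).interior B := fun p hp => by
      obtain ⟨z, hz, rfl⟩ := hA' hp
      exact h.mapsTo hz
    rw [hρ hA, hsplit _ hA hAi]
    refine tsum_congr fun k => ?_
    exact (h.paramMeasure_eq_chart M (c k) (hA.inter (hDm k)) (inter_subset_left.trans hA')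
      (inter_subset_right.trans ((hDU k).trans inter_subset_left))).symm
  have hle : M.riemMeasure ≤ ρ := by
    refine iSup_le fun q => Measure.le_iff.2 fun A hA => ?_
    rw [chartMeasure_eq, ← (isParam_chart q).paramMeasure_inter M hA,
      ← hkey (isParam_chart q) (hA.inter (isParam_chart q).isOpen_image.measurableSet)
        inter_subset_right]
    exact measure_mono inter_subset_left
  have hge {A : Set B} (hA : MeasurableSet A) (hA' : A ⊆ (𝓡∂ (n + 1)).interior B) :
      ρ A ≤ M.riemMeasure A := by
    rw [hρ hA, hsplit M.riemMeasure hA hA']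
    refine ENNReal.tsum_le_tsum fun k => ?_
    have := le_iSup (fun q => M.chartMeasure q) (c k)
    refine (le_of_eq ?_).trans (Measure.le_iff.1 this _ (hA.inter (hDm k)))
    rw [chartMeasure_eq]
  refine ⟨?_, fun Φ S h A hA hA' => ?_⟩
  · refine le_antisymm ((Measure.le_iff'.1 hle _).trans (le_of_eq ?_)) (zero_le)
    have hbm : MeasurableSet ((𝓡∂ (n + 1)).boundary B) :=
      ((𝓡∂ (n + 1)).isClosed_boundary (n := ∞) (by simp)).measurableSet
    rw [hρ hbm, ENNReal.tsum_eq_zero]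
    intro k
    have : (𝓡∂ (n + 1)).boundary B ∩ D k = ∅ := by
      refine Set.eq_empty_of_forall_notMem fun p hp => ?_
      rw [← (𝓡∂ (n + 1)).compl_interior] at hp
      exact hp.1 (hDU k hp.2).2
    rw [this, measure_empty]
  · have hAi : A ⊆ (𝓡∂ (n + 1)).interior B := fun p hp => by
      obtain ⟨z, hz, rfl⟩ := hA' hp
      exact h.mapsTo hz
    rw [← hkey h hA hA']
    exact le_antisymm (Measure.le_iff'.1 hle _) (hge hA hAi)

lemma riemMeasure_boundary (M : ConicManifold n B Y) :
    M.riemMeasure ((𝓡∂ (n + 1)).boundary B) = 0 := M.riemMeasure_glue.1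

lemma ae_mem_interior (M : ConicManifold n B Y) :
    ∀ᵐ p ∂M.riemMeasure, p ∈ (𝓡∂ (n + 1)).interior B := by
  rw [ae_iff]
  have := M.riemMeasure_boundary
  rwa [← (𝓡∂ (n + 1)).compl_interior] at this

lemma IsParam.riemMeasure_restrict (M : ConicManifold n B Y) (h : IsParam Φ S) :
    M.riemMeasure.restrict (Φ '' S) = M.paramMeasure Φ S := by
  ext A hA
  rw [Measure.restrict_apply hA, ← h.paramMeasure_inter M hA]
  exact M.riemMeasure_glue.2 Φ S h _ (hA.inter h.isOpen_image.measurableSet) inter_subset_right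

lemma IsParam.aemeasurable_density (M : ConicManifold n B Y) (h : IsParam Φ S) :
    AEMeasurable (fun z => ENNReal.ofReal √(M.pullGram Φ z).det) (volume.restrict S) :=
  ((h.contDiffOn_sqrt_det M).continuousOn.aemeasurable h.isOpen.measurableSet).ennreal_ofReal

lemma IsParam.setLIntegral_eq (M : ConicManifold n B Y) (h : IsParam Φ S) {f : B → ℝ≥0∞}
    (hf : AEMeasurable f M.riemMeasure) :
    ∫⁻ p in Φ '' S, f p ∂M.riemMeasure =
      ∫⁻ z in S, ENNReal.ofReal √(M.pullGram Φ z).det * f (Φ z) := by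
  have hac : AEMeasurable Φ ((volume.restrict S).withDensity
      fun z => ENNReal.ofReal √(M.pullGram Φ z).det) :=
    h.aemeasurable.mono_ac (withDensity_absolutelyContinuous _ _)
  have hf' : AEMeasurable f (M.paramMeasure Φ S) := by
    rw [← h.riemMeasure_restrict M]
    exact hf.restrict
  rw [h.riemMeasure_restrict M, paramMeasure, lintegral_map' hf' hac]
  exact lintegral_withDensity_eq_lintegral_mul₀' (h.aemeasurable_density M)
    (hf'.comp_aemeasurable hac)

lemma IsParam.setIntegral_eq (M : ConicManifold n B Y) (h : IsParam Φ S) {f : B → ℂ}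
    (hf : AEStronglyMeasurable f M.riemMeasure) :
    ∫ p in Φ '' S, f p ∂M.riemMeasure =
      ∫ z in S, (√(M.pullGram Φ z).det : ℂ) * f (Φ z) := by
  have hac : AEMeasurable Φ ((volume.restrict S).withDensity
      fun z => ENNReal.ofReal √(M.pullGram Φ z).det) :=
    h.aemeasurable.mono_ac (withDensity_absolutelyContinuous _ _)
  have hf' : AEStronglyMeasurable f (M.paramMeasure Φ S) := by
    rw [← h.riemMeasure_restrict M]
    exact hf.restrict
  rw [h.riemMeasure_restrict M, paramMeasure, integral_map hac hf',
    integral_withDensity_eq_integral_toReal_smul₀ (h.aemeasurable_density M)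
      (ae_of_all _ fun _ => ENNReal.ofReal_lt_top)]
  refine integral_congr_ae (ae_of_all _ fun z => ?_)
  simp only [ENNReal.toReal_ofReal (Real.sqrt_nonneg _), Complex.real_smul]

end Measure

/-! ### Product coordinates on the collar and the density `xⁿ` -/

section Collar

/-- The splitting of the model space into the first coordinate and the others. -/
noncomputable def consEquiv (n : ℕ) :
    (ℝ × EuclideanSpace ℝ (Fin n)) ≃L[ℝ] EuclideanSpace ℝ (Fin (n + 1)) :=
  LinearEquiv.toContinuousLinearEquiv
    { toFun := fun q => WithLp.toLp 2 (Fin.cons q.1 q.2.ofLp)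
      invFun := fun z => (z 0, WithLp.toLp 2 fun j => z j.succ)
      map_add' := fun q r => by
        ext i
        refine Fin.cases ?_ (fun j => ?_) i <;> simp
      map_smul' := fun c q => by
        ext i
        refine Fin.cases ?_ (fun j => ?_) i <;> simp
      left_inv := fun q => by
        refine Prod.ext ?_ ?_
        · simp
        · ext j
          simp
      right_inv := fun z => by
        ext i
        refine Fin.cases ?_ (fun j => ?_) i <;> simp }

/-- The vector of all coordinates but the first. -/
noncomputable def tail (z : EuclideanSpace ℝ (Fin (n + 1))) : EuclideanSpace ℝ (Fin n) :=
  ((consEquiv n).symm z).2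

lemma tail_apply (z : EuclideanSpace ℝ (Fin (n + 1))) (j : Fin n) : tail z j = z j.succ := rfl

lemma continuous_tail : Continuous (tail : EuclideanSpace ℝ (Fin (n + 1)) → _) :=
  continuous_snd.comp (consEquiv n).symm.continuous

lemma contDiff_tail : ContDiff ℝ ∞ (tail : EuclideanSpace ℝ (Fin (n + 1)) → _) :=
  contDiff_snd.comp (consEquiv n).symm.contDiff

lemma tail_single_zero : tail (EuclideanSpace.single (0 : Fin (n + 1)) (1 : ℝ)) = 0 := by
  ext j
  simp [tail_apply]

lemma tail_single_succ (j : Fin n) :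
    tail (EuclideanSpace.single j.succ (1 : ℝ)) = EuclideanSpace.single j 1 := by
  ext k
  simp [tail_apply]

/-- The product coordinates on the collar given by the chart of `Y` around `y₀`. -/
noncomputable def collarCoord (y₀ : Y) (z : EuclideanSpace ℝ (Fin (n + 1))) : ℝ × Y :=
  (z 0, (extChartAt (𝓡 n) y₀).symm (tail z))

/-- The parametrization of a part of the collar given by the chart of `Y` around `y₀`. -/
noncomputable def collarParam (M : ConicManifold n B Y) (y₀ : Y)
    (z : EuclideanSpace ℝ (Fin (n + 1))) : B :=
  M.collar (collarCoord y₀ z)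

/-- The domain of `collarParam`. -/
def collarDomain (y₀ : Y) : Set (EuclideanSpace ℝ (Fin (n + 1))) :=
  {z | z 0 ∈ Ioo (0 : ℝ) 1 ∧ tail z ∈ (extChartAt (𝓡 n) y₀).target}

lemma isOpen_collarDomain (y₀ : Y) : IsOpen (collarDomain (n := n) y₀) := by
  have h1 : Continuous fun z : EuclideanSpace ℝ (Fin (n + 1)) => z 0 := by fun_prop
  exact (isOpen_Ioo.preimage h1).inter
    ((isOpen_extChartAt_target (I := 𝓡 n) y₀).preimage continuous_tail)

lemma collarCoord_mem_source (M : ConicManifold n B Y) {y₀ : Y}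
    {z : EuclideanSpace ℝ (Fin (n + 1))} (hz : z ∈ collarDomain y₀) :
    collarCoord y₀ z ∈ M.collar.source := by
  rw [M.collar_source]
  exact ⟨⟨hz.1.1.le, hz.1.2⟩, mem_univ _⟩

lemma hasMFDerivAt_collarCoord {y₀ : Y} {z : EuclideanSpace ℝ (Fin (n + 1))}
    (hz : tail z ∈ (extChartAt (𝓡 n) y₀).target) :
    HasMFDerivAt 𝓘(ℝ, EuclideanSpace ℝ (Fin (n + 1))) (𝓘(ℝ, ℝ).prod (𝓡 n)) (collarCoord y₀) z
      ((((ContinuousLinearMap.fst ℝ ℝ (EuclideanSpace ℝ (Fin n))).comp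
        ((consEquiv n).symm : EuclideanSpace ℝ (Fin (n + 1)) →L[ℝ]
          ℝ × EuclideanSpace ℝ (Fin n)))).prod
        ((mfderiv 𝓘(ℝ, EuclideanSpace ℝ (Fin n)) (𝓡 n) (extChartAt (𝓡 n) y₀).symm (tail z)).comp
          ((ContinuousLinearMap.snd ℝ ℝ (EuclideanSpace ℝ (Fin n))).comp
        ((consEquiv n).symm : EuclideanSpace ℝ (Fin (n + 1)) →L[ℝ]
          ℝ × EuclideanSpace ℝ (Fin n))))) := by
  have h1 := (((ContinuousLinearMap.fst ℝ ℝ (EuclideanSpace ℝ (Fin n))).comp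
        ((consEquiv n).symm : EuclideanSpace ℝ (Fin (n + 1)) →L[ℝ]
          ℝ × EuclideanSpace ℝ (Fin n))).hasFDerivAt (x := z)).hasMFDerivAt
  have h2 := (((ContinuousLinearMap.snd ℝ ℝ (EuclideanSpace ℝ (Fin n))).comp
        ((consEquiv n).symm : EuclideanSpace ℝ (Fin (n + 1)) →L[ℝ]
          ℝ × EuclideanSpace ℝ (Fin n))).hasFDerivAt (x := z)).hasMFDerivAt
  have h3 : MDifferentiableAt 𝓘(ℝ, EuclideanSpace ℝ (Fin n)) (𝓡 n) (extChartAt (𝓡 n) y₀).symm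
      (tail z) :=
    ((contMDiffOn_extChartAt_symm (n := ∞) y₀).contMDiffAt
      ((isOpen_extChartAt_target (I := 𝓡 n) y₀).mem_nhds hz)).mdifferentiableAt (by simp)
  exact h1.prodMk (h3.hasMFDerivAt.comp z h2)

lemma contMDiffOn_collarCoord (y₀ : Y) :
    ContMDiffOn 𝓘(ℝ, EuclideanSpace ℝ (Fin (n + 1))) (𝓘(ℝ, ℝ).prod (𝓡 n)) ∞ (collarCoord y₀)
      {z | tail z ∈ (extChartAt (𝓡 n) y₀).target} := by
  have h1 : ContMDiff 𝓘(ℝ, EuclideanSpace ℝ (Fin (n + 1))) 𝓘(ℝ, ℝ) ∞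
      fun z : EuclideanSpace ℝ (Fin (n + 1)) => z 0 := by
    rw [contMDiff_iff_contDiff]
    fun_prop
  have h2 : ContMDiff 𝓘(ℝ, EuclideanSpace ℝ (Fin (n + 1))) 𝓘(ℝ, EuclideanSpace ℝ (Fin n)) ∞
      (tail : EuclideanSpace ℝ (Fin (n + 1)) → _) := by
    rw [contMDiff_iff_contDiff]
    exact contDiff_tail
  exact h1.contMDiffOn.prodMk
    ((contMDiffOn_extChartAt_symm (n := ∞) y₀).comp h2.contMDiffOn fun z hz => hz)

/-- The metric `h(x)` in the coordinates of the chart of `Y` around `y₀`. -/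
noncomputable def crossForm (M : ConicManifold n B Y) (y₀ : Y)
    (z : EuclideanSpace ℝ (Fin (n + 1))) :
    EuclideanSpace ℝ (Fin n) →ₗ[ℝ] EuclideanSpace ℝ (Fin n) →ₗ[ℝ] ℝ :=
  let b := (M.h (z 0)).inner ((extChartAt (𝓡 n) y₀).symm (tail z))
  let D := mfderiv 𝓘(ℝ, EuclideanSpace ℝ (Fin n)) (𝓡 n) (extChartAt (𝓡 n) y₀).symm (tail z)
  LinearMap.mk₂ ℝ (fun v w => b (D v) (D w))
    (fun v v' w => (congrArg (fun u => b u (D w)) (map_add D v v')).trans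
      (congrArg (fun f => f (D w)) (map_add b (D v) (D v'))))
    (fun c v w => (congrArg (fun u => b u (D w)) (map_smul D c v)).trans
      (congrArg (fun f => f (D w)) (map_smul b c (D v))))
    (fun v w w' => (congrArg (b (D v)) (map_add D w w')).trans (map_add (b (D v)) _ _))
    (fun c v w => (congrArg (b (D v)) (map_smul D c w)).trans (map_smul (b (D v)) _ _))

/-- The Gram matrix of `h(x)` in the coordinates of the chart of `Y` around `y₀`. -/
noncomputable def crossGram (M : ConicManifold n B Y) (y₀ : Y)
    (z : EuclideanSpace ℝ (Fin (n + 1))) : Matrix (Fin n) (Fin n) ℝ :=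
  Matrix.of fun i j => (M.h (z 0)).inner ((extChartAt (𝓡 n) y₀).symm (tail z))
    (mfderiv 𝓘(ℝ, EuclideanSpace ℝ (Fin n)) (𝓡 n) (extChartAt (𝓡 n) y₀).symm (tail z)
      (EuclideanSpace.single i 1))
    (mfderiv 𝓘(ℝ, EuclideanSpace ℝ (Fin n)) (𝓡 n) (extChartAt (𝓡 n) y₀).symm (tail z)
      (EuclideanSpace.single j 1))

lemma mfderiv_collarParam (M : ConicManifold n B Y) {y₀ : Y}
    {z : EuclideanSpace ℝ (Fin (n + 1))} (hz : z ∈ collarDomain y₀)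
    (v : EuclideanSpace ℝ (Fin (n + 1))) :
    mfderiv 𝓘(ℝ, EuclideanSpace ℝ (Fin (n + 1))) (𝓡∂ (n + 1)) (M.collarParam y₀) z v =
      mfderivWithin (𝓘(ℝ, ℝ).prod (𝓡 n)) (𝓡∂ (n + 1)) M.collar M.collar.source (collarCoord y₀ z)
        (v 0, mfderiv 𝓘(ℝ, EuclideanSpace ℝ (Fin n)) (𝓡 n) (extChartAt (𝓡 n) y₀).symm (tail z)
          (tail v)) := by
  have h1 := hasMFDerivAt_collarCoord (n := n) hz.2
  have h2 := ((M.contMDiffOn_collar _ (M.collarCoord_mem_source hz)).mdifferentiableWithinAt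
    (by simp)).hasMFDerivWithinAt
  have h3 := (h2.comp z (h1.hasMFDerivWithinAt (s := collarDomain y₀))
    (fun w hw => M.collarCoord_mem_source hw)).hasMFDerivAt
      ((isOpen_collarDomain y₀).mem_nhds hz)
  have h4 := h3.mfderiv
  exact congrArg (fun L => L v) h4

lemma pullGram_collarParam (M : ConicManifold n B Y) {y₀ : Y}
    {z : EuclideanSpace ℝ (Fin (n + 1))} (hz : z ∈ collarDomain y₀)
    (v w : EuclideanSpace ℝ (Fin (n + 1))) :
    M.g (M.collarParam y₀ z)
      (mfderiv 𝓘(ℝ, EuclideanSpace ℝ (Fin (n + 1))) (𝓡∂ (n + 1)) (M.collarParam y₀) z v)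
      (mfderiv 𝓘(ℝ, EuclideanSpace ℝ (Fin (n + 1))) (𝓡∂ (n + 1)) (M.collarParam y₀) z w) =
    v 0 * w 0 + z 0 ^ 2 * (M.h (z 0)).inner ((extChartAt (𝓡 n) y₀).symm (tail z))
      (mfderiv 𝓘(ℝ, EuclideanSpace ℝ (Fin n)) (𝓡 n) (extChartAt (𝓡 n) y₀).symm (tail z) (tail v))
      (mfderiv 𝓘(ℝ, EuclideanSpace ℝ (Fin n)) (𝓡 n) (extChartAt (𝓡 n) y₀).symm (tail z)
        (tail w)) := by
  rw [M.mfderiv_collarParam hz, M.mfderiv_collarParam hz]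
  exact M.g_collar _ (M.collarCoord_mem_source hz) _ _ _ _

lemma pullGram_collarParam_zero (M : ConicManifold n B Y) {y₀ : Y}
    {z : EuclideanSpace ℝ (Fin (n + 1))} (hz : z ∈ collarDomain y₀) (j : Fin (n + 1)) :
    M.pullGram (M.collarParam y₀) z 0 j = if j = 0 then 1 else 0 := by
  refine (M.pullGram_collarParam hz _ _).trans ?_
  have h0 : ∀ (u v : EuclideanSpace ℝ (Fin n)), u = 0 → M.crossForm y₀ z u v = 0 := by
    rintro _ v rfl
    simp
  have := h0 _ (tail (EuclideanSpace.single j 1)) tail_single_zero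
  rw [crossForm, LinearMap.mk₂_apply] at this
  rw [this]
  simp [eq_comm]

lemma pullGram_collarParam_succ (M : ConicManifold n B Y) {y₀ : Y}
    {z : EuclideanSpace ℝ (Fin (n + 1))} (hz : z ∈ collarDomain y₀) (i j : Fin n) :
    M.pullGram (M.collarParam y₀) z i.succ j.succ = z 0 ^ 2 * M.crossGram y₀ z i j := by
  refine (M.pullGram_collarParam hz _ _).trans ?_
  rw [tail_single_succ, tail_single_succ]
  simp [crossGram]

/-- The pulled back metric is block diagonal with blocks `1` and `x² h`; the second has size `n`,
whence the factor `x^{2n}`. -/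
lemma det_pullGram_collarParam (M : ConicManifold n B Y) {y₀ : Y}
    {z : EuclideanSpace ℝ (Fin (n + 1))} (hz : z ∈ collarDomain y₀) :
    (M.pullGram (M.collarParam y₀) z).det = (z 0 ^ n) ^ 2 * (M.crossGram y₀ z).det := by
  rw [Matrix.det_succ_row_zero, Finset.sum_eq_single 0]
  · have : (M.pullGram (M.collarParam y₀) z).submatrix Fin.succ (Fin.succAbove 0) =
        (z 0 ^ 2) • M.crossGram y₀ z := by
      ext i j
      simpa using M.pullGram_collarParam_succ hz i j
    rw [this, Matrix.det_smul, M.pullGram_collarParam_zero hz]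
    simp [← pow_mul, mul_comm]
  · intro j _ hj
    rw [M.pullGram_collarParam_zero hz, if_neg hj]
    simp
  · simp

/-- Unlike `g`, the metric `h(x)` stays positive definite at `x = 0`, and the derivative of the
inverse chart is invertible. -/
lemma crossGram_posDef (M : ConicManifold n B Y) {y₀ : Y}
    {z : EuclideanSpace ℝ (Fin (n + 1))} (hz : tail z ∈ (extChartAt (𝓡 n) y₀).target) :
    (M.crossGram y₀ z).PosDef := by
  refine posDef_of_bilinear (M.crossForm y₀ z) (fun v w => (M.h (z 0)).symm _ _ _)
    fun v hv => (M.h (z 0)).pos _ _ fun h0 => hv ?_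
  have h1 := isInvertible_mfderivWithin_extChartAt_symm (I := 𝓡 n) hz
  rw [show range (𝓡 n) = univ by simp, mfderivWithin_univ] at h1
  exact h1.injective (h0.trans (map_zero _).symm)

/-- The face `x = 0` is included: continuity up to the tip is what allows compactness to give
density bounds uniform in `x`. -/
lemma continuousOn_crossGram (M : ConicManifold n B Y) (y₀ : Y) (i j : Fin n) :
    ContinuousOn (fun z => M.crossGram y₀ z i j)
      {z | z 0 ∈ Ico (0 : ℝ) 1 ∧ tail z ∈ (extChartAt (𝓡 n) y₀).target} := by
  have htail : ContMDiff 𝓘(ℝ, EuclideanSpace ℝ (Fin (n + 1))) 𝓘(ℝ, EuclideanSpace ℝ (Fin n)) ∞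
      (tail : EuclideanSpace ℝ (Fin (n + 1)) → _) := by
    rw [contMDiff_iff_contDiff]
    exact contDiff_tail
  have hsec (v : EuclideanSpace ℝ (Fin n)) :=
    (contMDiffOn_mfderiv_const (isOpen_extChartAt_target (I := 𝓡 n) y₀)
      (contMDiffOn_extChartAt_symm (n := ∞) y₀) v).comp
      (s := {z : EuclideanSpace ℝ (Fin (n + 1)) | z 0 ∈ Ico (0 : ℝ) 1 ∧
        tail z ∈ (extChartAt (𝓡 n) y₀).target}) htail.contMDiffOn (fun z hz => hz.2)
  have h2 : ContMDiffOn 𝓘(ℝ, EuclideanSpace ℝ (Fin (n + 1))) ((𝓡 n).prod 𝓘(ℝ, ℝ)) ∞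
      (fun z => TotalSpace.mk' ℝ (E := Bundle.Trivial Y ℝ) ((extChartAt (𝓡 n) y₀).symm (tail z))
        (M.crossGram y₀ z i j)) {z : EuclideanSpace ℝ (Fin (n + 1)) | z 0 ∈ Ico (0 : ℝ) 1 ∧
        tail z ∈ (extChartAt (𝓡 n) y₀).target} := by
    apply ContMDiffOn.clm_bundle_apply₂ (F₁ := EuclideanSpace ℝ (Fin n))
      (F₂ := EuclideanSpace ℝ (Fin n))
    · exact M.contMDiffOn_h.comp ((contMDiffOn_collarCoord (n := n) y₀).mono fun z hz => hz.2)
        fun z hz => ⟨hz.1, mem_univ _⟩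
    · exact hsec _
    · exact hsec _
  intro z hz
  have := h2 z hz
  simp only [contMDiffWithinAt_totalSpace] at this
  exact this.2.continuousWithinAt

lemma isParam_collar (M : ConicManifold n B Y) (y₀ : Y) :
    IsParam (M.collarParam y₀) (collarDomain y₀) where
  isOpen := isOpen_collarDomain y₀
  contMDiffOn := M.contMDiffOn_collar.comp
    ((contMDiffOn_collarCoord y₀).mono fun z hz => hz.2) fun z hz => M.collarCoord_mem_source hz
  injOn := fun z hz w hw hzw => by
    have h := M.collar.injOn (M.collarCoord_mem_source hz) (M.collarCoord_mem_source hw) hzw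
    have h1 := congrArg Prod.fst h
    have h2 := (extChartAt (𝓡 n) y₀).symm.injOn hz.2 hw.2 (congrArg Prod.snd h)
    exact (consEquiv n).symm.injective (Prod.ext h1 h2)
  mapsTo := fun z hz => by
    rw [← (𝓡∂ (n + 1)).compl_boundary, M.boundary_eq]
    rintro ⟨q, hq, hqz⟩
    have hqs : q ∈ M.collar.source := by
      rw [M.collar_source]
      exact ⟨by rw [hq.1]; simp, mem_univ _⟩
    have := M.collar.injOn hqs (M.collarCoord_mem_source hz) hqz
    have h0 : z 0 = 0 := (congrArg Prod.fst this).symm.trans hq.1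
    exact hz.1.1.ne' h0
  isOpen_image := by
    have : M.collarParam y₀ '' collarDomain y₀ = M.collar.target ∩
        M.collar.symm ⁻¹' (Ioi 0 ×ˢ (extChartAt (𝓡 n) y₀).source) := by
      ext p
      constructor
      · rintro ⟨z, hz, rfl⟩
        refine ⟨M.collar.map_source (M.collarCoord_mem_source hz), ?_⟩
        rw [mem_preimage, collarParam, M.collar.left_inv (M.collarCoord_mem_source hz)]
        exact ⟨hz.1.1, (extChartAt (𝓡 n) y₀).map_target hz.2⟩
      · rintro ⟨hp, hp'⟩
        have hs := M.collar.map_target hp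
        rw [M.collar_source] at hs
        have hq : collarCoord y₀ (consEquiv n ((M.collar.symm p).1,
            extChartAt (𝓡 n) y₀ (M.collar.symm p).2)) = M.collar.symm p := by
          refine Prod.ext ?_ ?_
          · rfl
          · exact (extChartAt (𝓡 n) y₀).left_inv hp'.2
        refine ⟨consEquiv n ((M.collar.symm p).1,
          extChartAt (𝓡 n) y₀ (M.collar.symm p).2), ⟨⟨hp'.1, hs.1.2⟩, ?_⟩, ?_⟩
        · exact (extChartAt (𝓡 n) y₀).map_source hp'.2
        · rw [collarParam, hq, M.collar.right_inv hp]
    rw [this]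
    exact M.contMDiffOn_collar_symm.continuousOn.isOpen_inter_preimage M.isOpen_collar_target
      (isOpen_Ioi.prod (isOpen_extChartAt_source (I := 𝓡 n) y₀))
  -- Were the Jacobian singular, the Gram determinant would vanish; but it equals `x^{2n} det h >
  -- 0`.
  det_ne_zero := fun z hz h0 => by
    have h1 := M.det_pullGram_collarParam hz
    rw [pullGram_eq, Matrix.det_mul, h0, mul_zero] at h1
    have h2 := (M.crossGram_posDef hz.2).det_pos
    have h3 := hz.1.1
    have : 0 < (z 0 ^ n) ^ 2 * (M.crossGram y₀ z).det := by positivity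
    exact this.ne h1

/-- On compact pieces of the collar the density is comparable to `xⁿ`. -/
lemma exists_density_bounds (M : ConicManifold n B Y) (y₀ : Y)
    {K : Set (EuclideanSpace ℝ (Fin n))} (hK : IsCompact K)
    (hKt : K ⊆ (extChartAt (𝓡 n) y₀).target) :
    ∃ c C : ℝ, 0 < c ∧ 0 < C ∧ ∀ z : EuclideanSpace ℝ (Fin (n + 1)), z 0 ∈ Ioc (0 : ℝ) (1 / 2) →
      tail z ∈ K → c * z 0 ^ n ≤ √(M.pullGram (M.collarParam y₀) z).det ∧
        √(M.pullGram (M.collarParam y₀) z).det ≤ C * z 0 ^ n := by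
  -- This compact set contains the face `x = 0`, so `√det h` has a positive minimum and a finite
  -- maximum on it. The factor `xⁿ` is split off beforehand.
  have hcpt : IsCompact (consEquiv n '' (Icc (0 : ℝ) (1 / 2) ×ˢ K)) :=
    (isCompact_Icc.prod hK).image (consEquiv n).continuous
  have hsub : consEquiv n '' (Icc (0 : ℝ) (1 / 2) ×ˢ K) ⊆
      {z | z 0 ∈ Ico (0 : ℝ) 1 ∧ tail z ∈ (extChartAt (𝓡 n) y₀).target} := by
    rintro _ ⟨⟨x, w⟩, ⟨hx, hw⟩, rfl⟩
    exact ⟨⟨hx.1, lt_of_le_of_lt hx.2 (by norm_num)⟩, hKt hw⟩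
  have hmem : ∀ z : EuclideanSpace ℝ (Fin (n + 1)), z 0 ∈ Ioc (0 : ℝ) (1 / 2) →
      tail z ∈ K → z ∈ consEquiv n '' (Icc (0 : ℝ) (1 / 2) ×ˢ K) := fun z hz hw =>
    ⟨(z 0, tail z), ⟨⟨hz.1.le, hz.2⟩, hw⟩, (consEquiv n).apply_symm_apply z⟩
  have hcont : ContinuousOn (fun z => √(M.crossGram y₀ z).det)
      (consEquiv n '' (Icc (0 : ℝ) (1 / 2) ×ˢ K)) := by
    refine ContinuousOn.sqrt ?_
    have h1 : ContinuousOn (M.crossGram y₀) (consEquiv n '' (Icc (0 : ℝ) (1 / 2) ×ˢ K)) :=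
      continuousOn_pi.2 fun i => continuousOn_pi.2 fun j =>
        (M.continuousOn_crossGram y₀ i j).mono hsub
    exact Continuous.comp_continuousOn (continuous_id.matrix_det) h1
  have hpos : ∀ z ∈ consEquiv n '' (Icc (0 : ℝ) (1 / 2) ×ˢ K), 0 < √(M.crossGram y₀ z).det :=
    fun z hz => Real.sqrt_pos.2 (M.crossGram_posDef (hsub hz).2).det_pos
  obtain ⟨c, hc, hc'⟩ := hcpt.exists_forall_le' hcont hpos
  obtain ⟨C, hC⟩ := hcpt.exists_bound_of_continuousOn hcont
  refine ⟨c, max C 1, hc, by positivity, fun z hz hw => ?_⟩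
  have hzd : z ∈ collarDomain y₀ := ⟨⟨hz.1, lt_of_le_of_lt hz.2 (by norm_num)⟩, hKt hw⟩
  have hz0 : 0 ≤ z 0 ^ n := pow_nonneg hz.1.le n
  rw [M.det_pullGram_collarParam hzd, Real.sqrt_mul (sq_nonneg _), Real.sqrt_sq hz0, mul_comm c,
    mul_comm (max C 1)]
  refine ⟨mul_le_mul_of_nonneg_left (hc' z (hmem z hz hw)) hz0, mul_le_mul_of_nonneg_left ?_ hz0⟩
  exact ((le_abs_self _).trans (hC z (hmem z hz hw))).trans (le_max_left _ _)

end Collar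

/-! ### The function `radial` -/

section Radial

lemma radial_of_mem (M : ConicManifold n B Y) {p : B} (hp : p ∈ M.collar.target) :
    M.radial p = (M.collar.symm p).1 := by
  rw [radial, if_pos hp]

lemma radial_of_notMem (M : ConicManifold n B Y) {p : B} (hp : p ∉ M.collar.target) :
    M.radial p = 1 := by
  rw [radial, if_neg hp]

lemma radial_collar (M : ConicManifold n B Y) {q : ℝ × Y} (hq : q ∈ M.collar.source) :
    M.radial (M.collar q) = q.1 := by
  rw [M.radial_of_mem (M.collar.map_source hq), M.collar.left_inv hq]

lemma collar_symm_mem (M : ConicManifold n B Y) {p : B} (hp : p ∈ M.collar.target) :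
    (M.collar.symm p).1 ∈ Ico (0 : ℝ) 1 := by
  have := M.collar.map_target hp
  rw [M.collar_source] at this
  exact this.1

lemma radial_nonneg (M : ConicManifold n B Y) (p : B) : 0 ≤ M.radial p := by
  by_cases hp : p ∈ M.collar.target
  · rw [M.radial_of_mem hp]
    exact (M.collar_symm_mem hp).1
  · rw [M.radial_of_notMem hp]
    exact zero_le_one

lemma radial_le_one (M : ConicManifold n B Y) (p : B) : M.radial p ≤ 1 := by
  by_cases hp : p ∈ M.collar.target
  · rw [M.radial_of_mem hp]
    exact (M.collar_symm_mem hp).2.le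
  · rw [M.radial_of_notMem hp]

lemma mem_target_of_radial_lt (M : ConicManifold n B Y) {p : B} (hp : M.radial p < 1) :
    p ∈ M.collar.target := by
  by_contra h
  exact hp.ne (M.radial_of_notMem h)

/-- Turns statements about the interior into statements about a continuous function; supports
compact in the interior then stay at positive distance from `x = 0`. -/
lemma radial_pos_iff (M : ConicManifold n B Y) (p : B) :
    0 < M.radial p ↔ p ∈ (𝓡∂ (n + 1)).interior B := by
  rw [← (𝓡∂ (n + 1)).compl_boundary, M.boundary_eq, mem_compl_iff, ← not_iff_not, not_not, not_lt]
  constructor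
  · intro h
    have hp := M.mem_target_of_radial_lt (h.trans_lt one_pos)
    have h0 := le_antisymm h (M.radial_nonneg p)
    rw [M.radial_of_mem hp] at h0
    exact ⟨M.collar.symm p, ⟨h0, mem_univ _⟩, M.collar.right_inv hp⟩
  · rintro ⟨q, hq, rfl⟩
    have hqs : q ∈ M.collar.source := by
      rw [M.collar_source]
      exact ⟨by rw [hq.1]; simp, mem_univ _⟩
    rw [M.radial_collar hqs, hq.1]

lemma radial_le_eq_image (M : ConicManifold n B Y) {s : ℝ} (hs : s < 1) :
    {p | M.radial p ≤ s} = M.collar '' (Icc 0 s ×ˢ univ) := by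
  ext p
  constructor
  · intro h
    have hp := M.mem_target_of_radial_lt (lt_of_le_of_lt h hs)
    refine ⟨M.collar.symm p, ⟨⟨(M.collar_symm_mem hp).1, ?_⟩, mem_univ _⟩, M.collar.right_inv hp⟩
    rw [← M.radial_of_mem hp]
    exact h
  · rintro ⟨q, hq, rfl⟩
    have hqs : q ∈ M.collar.source := by
      rw [M.collar_source]
      exact ⟨⟨hq.1.1, lt_of_le_of_lt hq.1.2 hs⟩, mem_univ _⟩
    rw [mem_ofPred_eq, M.radial_collar hqs]
    exact hq.1.2

/-- The point is the passage to the constant `1` at the outer end of the collar. For `s < 1` the set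
`{x ≤ s}` is the image of the compact `[0,s] × Y`, hence closed in the Hausdorff space `B`; the set
`{x < s}` is open because the inverse collar map is continuous on an open set. -/
lemma continuous_radial [T2Space B] [CompactSpace Y] (M : ConicManifold n B Y) :
    Continuous M.radial := by
  rw [continuous_iff_lower_upperSemicontinuous]
  constructor
  · rw [lowerSemicontinuous_iff_isClosed_preimage]
    intro s
    rcases lt_or_ge s 1 with hs | hs
    · change IsClosed {p | M.radial p ≤ s}
      rw [M.radial_le_eq_image hs]
      refine ((isCompact_Icc.prod isCompact_univ).image_of_continuousOn
        (M.contMDiffOn_collar.continuousOn.mono ?_)).isClosed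
      rw [M.collar_source]
      exact prod_mono (fun x hx => ⟨hx.1, lt_of_le_of_lt hx.2 hs⟩) subset_rfl
    · have : M.radial ⁻¹' Iic s = univ := eq_univ_of_forall fun p => (M.radial_le_one p).trans hs
      rw [this]
      exact isClosed_univ
  · rw [upperSemicontinuous_iff_isOpen_preimage]
    intro s
    rcases le_or_gt s 1 with hs | hs
    · have : M.radial ⁻¹' Iio s = M.collar.target ∩ M.collar.symm ⁻¹' (Iio s ×ˢ univ) := by
        ext p
        constructor
        · intro h
          have hp := M.mem_target_of_radial_lt (lt_of_lt_of_le h hs)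
          refine ⟨hp, ?_, mem_univ _⟩
          rw [← M.radial_of_mem hp]
          exact h
        · rintro ⟨hp, h⟩
          rw [mem_preimage, M.radial_of_mem hp]
          exact h.1
      rw [this]
      exact M.contMDiffOn_collar_symm.continuousOn.isOpen_inter_preimage M.isOpen_collar_target
        (isOpen_Iio.prod isOpen_univ)
    · have : M.radial ⁻¹' Iio s = univ :=
        eq_univ_of_forall fun p => (M.radial_le_one p).trans_lt hs
      rw [this]
      exact isOpen_univ

/-- `radial` need not be smooth where the collar ends, but `F` is already constant there. The collar
and the open set `{x > a}` cover `B`. -/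
lemma contMDiff_comp_radial [T2Space B] [CompactSpace Y] (M : ConicManifold n B Y) {F : ℝ → ℂ}
    (hF : ContDiff ℝ ∞ F) {a : ℝ} (ha : a < 1) (hFa : ∀ x, a < x → F x = 1) :
    ContMDiff (𝓡∂ (n + 1)) 𝓘(ℝ, ℂ) ∞ (fun p => F (M.radial p)) := by
  have h1 : ContMDiffOn (𝓡∂ (n + 1)) 𝓘(ℝ, ℂ) ∞ (fun p => F (M.radial p)) M.collar.target := by
    refine (hF.contMDiff.comp_contMDiffOn
      (contMDiff_fst.comp_contMDiffOn M.contMDiffOn_collar_symm)).congr fun p hp => ?_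
    simp [M.radial_of_mem hp]
  have h2 : ContMDiffOn (𝓡∂ (n + 1)) 𝓘(ℝ, ℂ) ∞ (fun p => F (M.radial p))
      (M.radial ⁻¹' Ioi a) :=
    (contMDiffOn_const (c := (1 : ℂ))).congr fun p hp => hFa _ hp
  refine contMDiff_of_contMDiffOn_union_of_isOpen h1 h2 ?_ M.isOpen_collar_target
    (isOpen_Ioi.preimage M.continuous_radial)
  refine eq_univ_of_forall fun p => ?_
  by_cases hp : p ∈ M.collar.target
  · exact Or.inl hp
  · right
    rw [mem_preimage, M.radial_of_notMem hp]
    exact ha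

end Radial

/-! ### Volume of the tip and finiteness of the measure -/

section Finite

variable [MeasurableSpace B] [BorelSpace B] [T2Space B] [CompactSpace B]
  {Φ : EuclideanSpace ℝ (Fin (n + 1)) → B} {S : Set (EuclideanSpace ℝ (Fin (n + 1)))}

lemma IsParam.riemMeasure_image (M : ConicManifold n B Y) (h : IsParam Φ S)
    {T : Set (EuclideanSpace ℝ (Fin (n + 1)))} (hT : MeasurableSet T) (hTS : T ⊆ S) :
    M.riemMeasure (Φ '' T) = ∫⁻ z in T, ENNReal.ofReal √(M.pullGram Φ z).det := by
  have hm : MeasurableSet (Φ '' T) :=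
    hT.image_of_continuousOn_injOn (h.continuousOn.mono hTS) (h.injOn.mono hTS)
  rw [M.riemMeasure_glue.2 Φ S h _ hm (image_mono hTS), h.paramMeasure_apply M hm,
    inter_comm, h.injOn.preimage_image_inter hTS]

/-- The half balls cover `Y`, while the full closed balls are compact in the chart targets. The gap
between the radii `r / 2` and `r` leaves room for a cutoff, and compactness gives the density
bounds. -/
lemma exists_collar_cover [CompactSpace Y] (n : ℕ) [ChartedSpace (EuclideanSpace ℝ (Fin n)) Y] :
    ∃ (t : Finset Y) (r : Y → ℝ), (∀ y, 0 < r y ∧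
      Metric.closedBall (extChartAt (𝓡 n) y y) (r y) ⊆ (extChartAt (𝓡 n) y).target) ∧
      ∀ y, ∃ y₀ ∈ t, y ∈ (extChartAt (𝓡 n) y₀).source ∧
        extChartAt (𝓡 n) y₀ y ∈ Metric.ball (extChartAt (𝓡 n) y₀ y₀) (r y₀ / 2) := by
  have h1 : ∀ y : Y, ∃ r : ℝ, 0 < r ∧
      Metric.closedBall (extChartAt (𝓡 n) y y) r ⊆ (extChartAt (𝓡 n) y).target := fun y =>
    Metric.nhds_basis_closedBall.mem_iff.1
      ((isOpen_extChartAt_target (I := 𝓡 n) y).mem_nhds (mem_extChartAt_target y))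
  choose r hr using h1
  obtain ⟨t, ht⟩ := isCompact_univ.elim_finite_subcover
    (fun y : Y => (extChartAt (𝓡 n) y).source ∩
      extChartAt (𝓡 n) y ⁻¹' Metric.ball (extChartAt (𝓡 n) y y) (r y / 2))
    (fun y => isOpen_extChartAt_preimage y Metric.isOpen_ball |> fun h => by
      rwa [← extChartAt_source (𝓡 n)] at h)
    (fun y _ => mem_iUnion.2 ⟨y, mem_extChartAt_source y,
      Metric.mem_ball_self (half_pos (hr y).1)⟩)
  refine ⟨t, r, hr, fun y => ?_⟩
  obtain ⟨y₀, h0, h1⟩ := mem_iUnion₂.1 (ht (mem_univ y))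
  exact ⟨y₀, h0, h1⟩

/-- The part of `collarDomain` with first coordinate at most `s` and the others in `K`. -/
def slab (s : ℝ) (K : Set (EuclideanSpace ℝ (Fin n))) : Set (EuclideanSpace ℝ (Fin (n + 1))) :=
  {z | z 0 ∈ Ioc 0 s ∧ tail z ∈ K}

lemma measurableSet_slab (s : ℝ) {K : Set (EuclideanSpace ℝ (Fin n))} (hK : MeasurableSet K) :
    MeasurableSet (slab s K) := by
  have h1 : Measurable fun z : EuclideanSpace ℝ (Fin (n + 1)) => z 0 := by fun_prop
  exact (h1 measurableSet_Ioc).inter (continuous_tail.measurable hK)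

lemma slab_subset_collarDomain {y₀ : Y} {s : ℝ} (hs : s < 1)
    {K : Set (EuclideanSpace ℝ (Fin n))} (hK : K ⊆ (extChartAt (𝓡 n) y₀).target) :
    slab s K ⊆ collarDomain y₀ := fun _ hz =>
  ⟨⟨hz.1.1, lt_of_le_of_lt hz.1.2 hs⟩, hK hz.2⟩

/-- The slab sits in a box; only the linear dependence on `s` matters. -/
lemma volume_slab_le (a : EuclideanSpace ℝ (Fin n)) {s r : ℝ} :
    volume (slab s (Metric.closedBall a r)) ≤ ENNReal.ofReal s * ENNReal.ofReal (2 * r) ^ n := by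
  have hsub : slab s (Metric.closedBall a r) ⊆
      (WithLp.ofLp : EuclideanSpace ℝ (Fin (n + 1)) → _) ⁻¹'
        Icc (Fin.cons 0 fun j => a j - r) (Fin.cons s fun j => a j + r) := by
    intro z hz
    have hj (j : Fin n) : |z j.succ - a j| ≤ r := by
      have h1 := PiLp.norm_apply_le (tail z - a) j
      have h2 := hz.2
      rw [Metric.mem_closedBall, dist_eq_norm] at h2
      exact h1.trans h2
    refine ⟨fun i => ?_, fun i => ?_⟩
    · refine Fin.cases ?_ (fun j => ?_) i
      · exact hz.1.1.le
      · have := abs_le.1 (hj j)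
        simp only [Fin.cons_succ]
        linarith
    · refine Fin.cases ?_ (fun j => ?_) i
      · exact hz.1.2
      · have := abs_le.1 (hj j)
        simp only [Fin.cons_succ]
        linarith
  refine (measure_mono hsub).trans (le_of_eq ?_)
  rw [(PiLp.volume_preserving_ofLp (Fin (n + 1))).measure_preimage
    measurableSet_Icc.nullMeasurableSet, Real.volume_Icc_pi, Fin.prod_univ_succ]
  simp only [Fin.cons_zero, Fin.cons_succ, sub_zero]
  congr 1
  rw [Finset.prod_congr rfl (fun j _ => by rw [show a j + r - (a j - r) = 2 * r by ring])]
  simp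

/-- Points near the boundary are covered by finitely many slabs. -/
lemma exists_mem_image_slab (M : ConicManifold n B Y) {t : Finset Y} {r : Y → ℝ}
    (ht : ∀ y, ∃ y₀ ∈ t, y ∈ (extChartAt (𝓡 n) y₀).source ∧
        extChartAt (𝓡 n) y₀ y ∈ Metric.ball (extChartAt (𝓡 n) y₀ y₀) (r y₀ / 2))
    {s : ℝ} (hs : s < 1) {p : B} (hp : p ∈ (𝓡∂ (n + 1)).interior B) (hps : M.radial p ≤ s) :
    ∃ y₀ ∈ t, p ∈ M.collarParam y₀ ''
      slab s (Metric.ball (extChartAt (𝓡 n) y₀ y₀) (r y₀ / 2)) := by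
  have hpt := M.mem_target_of_radial_lt (lt_of_le_of_lt hps hs)
  obtain ⟨y₀, h0, h1, h2⟩ := ht (M.collar.symm p).2
  rw [← M.radial_pos_iff] at hp
  rw [M.radial_of_mem hpt] at hps hp
  refine ⟨y₀, h0, consEquiv n ((M.collar.symm p).1, extChartAt (𝓡 n) y₀ (M.collar.symm p).2),
    ⟨⟨hp, hps⟩, h2⟩, ?_⟩
  have hq : collarCoord y₀ (consEquiv n ((M.collar.symm p).1,
      extChartAt (𝓡 n) y₀ (M.collar.symm p).2)) = M.collar.symm p :=
    Prod.ext rfl ((extChartAt (𝓡 n) y₀).left_inv h1)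
  rw [collarParam, hq, M.collar.right_inv hpt]

/-- The slabs over finitely many balls have volume `O(s)` and density `O(xⁿ)`, which is `O(s)` as `n
≥ 1`. The exact order is `s^{n+1}`; the power `s²`, sharp only for `n = 1`, is all that the capacity
estimate needs. -/
lemma exists_measure_radial_le [CompactSpace Y] (M : ConicManifold n B Y) (hn : 1 ≤ n) :
    ∃ C : ℝ, 0 ≤ C ∧ ∀ s ∈ Ioc (0 : ℝ) (1 / 2),
      M.riemMeasure {p | M.radial p ≤ s} ≤ ENNReal.ofReal (C * s ^ 2) := by
  obtain ⟨t, r, hr, ht⟩ := exists_collar_cover (Y := Y) n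
  choose c C hc hC hbd using fun y => M.exists_density_bounds y
    (isCompact_closedBall (extChartAt (𝓡 n) y y) (r y)) (hr y).2
  refine ⟨∑ y ∈ t, C y * (2 * r y) ^ n, Finset.sum_nonneg fun y _ =>
    mul_nonneg (hC y).le (pow_nonneg (by linarith [(hr y).1]) _), fun s hs => ?_⟩
  have hs1 : s < 1 := lt_of_le_of_lt hs.2 (by norm_num)
  -- The inclusion is only almost everywhere: slabs omit `x = 0`, that is, the boundary, which is a
  -- null set.
  have hsub : {p | M.radial p ≤ s} ≤ᵐ[M.riemMeasure] ⋃ y ∈ t, M.collarParam y ''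
      slab s (Metric.closedBall (extChartAt (𝓡 n) y y) (r y)) := by
    filter_upwards [M.ae_mem_interior] with p hp hps
    obtain ⟨y₀, h0, h1⟩ := M.exists_mem_image_slab ht hs1 hp hps
    refine mem_iUnion₂.2 ⟨y₀, h0, image_mono (fun z hz => ?_) h1⟩
    refine ⟨hz.1, ?_⟩
    exact Metric.ball_subset_closedBall (Metric.ball_subset_ball (by linarith [(hr y₀).1]) hz.2)
  refine (measure_mono_ae hsub).trans ((measure_biUnion_finset_le _ _).trans ?_)
  rw [Finset.sum_mul, ENNReal.ofReal_sum_of_nonneg fun y _ => mul_nonneg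
    (mul_nonneg (hC y).le (pow_nonneg (by linarith [(hr y).1]) _)) (sq_nonneg _)]
  refine Finset.sum_le_sum fun y _ => ?_
  have hmeas := measurableSet_slab (n := n) s
    (Metric.isClosed_closedBall (x := extChartAt (𝓡 n) y y) (ε := r y)).measurableSet
  rw [(M.isParam_collar y).riemMeasure_image M hmeas (slab_subset_collarDomain hs1 (hr y).2)]
  have hle : ∀ z ∈ slab s (Metric.closedBall (extChartAt (𝓡 n) y y) (r y)),
      ENNReal.ofReal √(M.pullGram (M.collarParam y) z).det ≤ ENNReal.ofReal (C y * s) := by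
    intro z hz
    refine ENNReal.ofReal_le_ofReal ?_
    refine (hbd y z ⟨hz.1.1, hz.1.2.trans hs.2⟩ hz.2).2.trans ?_
    refine mul_le_mul_of_nonneg_left ?_ (hC y).le
    calc z 0 ^ n ≤ s ^ n := pow_le_pow_left₀ hz.1.1.le hz.1.2 n
      _ ≤ s ^ 1 := pow_le_pow_of_le_one hs.1.le hs1.le hn
      _ = s := pow_one s
  refine (setLIntegral_mono measurable_const hle).trans ?_
  rw [setLIntegral_const]
  refine (mul_le_mul_right (volume_slab_le _) _).trans (le_of_eq ?_)
  have hr0 : 0 ≤ 2 * r y := by linarith [(hr y).1]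
  rw [← ENNReal.ofReal_pow hr0, ← ENNReal.ofReal_mul hs.1.le,
    ← ENNReal.ofReal_mul (mul_nonneg (hC y).le hs.1.le)]
  congr 1
  ring

lemma finiteAtFilter_nhds (M : ConicManifold n B Y) {p : B}
    (hp : p ∈ (𝓡∂ (n + 1)).interior B) : M.riemMeasure.FiniteAtFilter (𝓝 p) := by
  have hP := isParam_chart (n := n) p
  have hz := (mem_interior_iff (mem_extChartAt_source (I := 𝓡∂ (n + 1)) p)).1 hp
  obtain ⟨r, hr, hsub⟩ := Metric.nhds_basis_closedBall.mem_iff.1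
    (_root_.isOpen_interior.mem_nhds hz)
  refine ⟨(extChartAt (𝓡∂ (n + 1)) p).symm ''
    Metric.closedBall (extChartAt (𝓡∂ (n + 1)) p p) r, ?_, ?_⟩
  · have h1 : (extChartAt (𝓡∂ (n + 1)) p).source ∩ extChartAt (𝓡∂ (n + 1)) p ⁻¹'
        Metric.closedBall (extChartAt (𝓡∂ (n + 1)) p p) r ∈ 𝓝 p :=
      inter_mem (extChartAt_source_mem_nhds p)
        ((continuousAt_extChartAt p).preimage_mem_nhds (Metric.closedBall_mem_nhds _ hr))
    filter_upwards [h1] with q hq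
    exact ⟨_, hq.2, (extChartAt (𝓡∂ (n + 1)) p).left_inv hq.1⟩
  · rw [hP.riemMeasure_image M Metric.isClosed_closedBall.measurableSet hsub]
    have := ((hP.contDiffOn_sqrt_det M).continuousOn.mono hsub).integrableOn_compact
      (isCompact_closedBall _ _) (μ := volume)
    exact this.lintegral_lt_top

/-- The tip `{x ≤ 1/2}` has finite volume by the previous estimate, and `{x ≥ 1/2}` is a compact
subset of the interior, where the measure is locally finite. -/
lemma isFiniteMeasure_riemMeasure [CompactSpace Y] (M : ConicManifold n B Y) (hn : 1 ≤ n) :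
    IsFiniteMeasure M.riemMeasure := by
  obtain ⟨C, -, hC⟩ := M.exists_measure_radial_le hn
  have hcpt : IsCompact (M.radial ⁻¹' Ici (1 / 2)) :=
    (isClosed_Ici.preimage M.continuous_radial).isCompact
  refine ⟨?_⟩
  have huniv : (univ : Set B) ⊆ {p | M.radial p ≤ 1 / 2} ∪ M.radial ⁻¹' Ici (1 / 2) :=
    fun p _ => le_total (M.radial p) (1 / 2)
  refine (measure_mono huniv).trans_lt ((measure_union_le _ _).trans_lt (ENNReal.add_lt_top.2
    ⟨(hC (1 / 2) ⟨by norm_num, le_rfl⟩).trans_lt ENNReal.ofReal_lt_top, ?_⟩))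
  refine hcpt.measure_lt_top_of_nhdsWithin fun p hp => ?_
  refine (M.finiteAtFilter_nhds ((M.radial_pos_iff p).1 ?_)).filter_mono nhdsWithin_le_nhds
  exact lt_of_lt_of_le (by norm_num) hp

end Finite

/-! ### Extension by zero and integration by parts in Euclidean space -/

section Extension

lemma _root_.continuous_of_continuousOn_of_eq_zero {V F : Type*} [TopologicalSpace V]
    [TopologicalSpace F] [Zero F] {f : V → F} {U T : Set V} (hU : IsOpen U) (hT : IsClosed T)
    (hTU : T ⊆ U) (hf : ContinuousOn f U) (h0 : ∀ z, z ∉ T → f z = 0) : Continuous f := by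
  rw [continuous_iff_continuousAt]
  intro z
  by_cases hz : z ∈ T
  · exact hf.continuousAt (hU.mem_nhds (hTU hz))
  · refine ContinuousAt.congr (f := fun _ => 0) continuousAt_const ?_
    filter_upwards [hT.isOpen_compl.mem_nhds hz] with w hw
    exact (h0 w hw).symm

lemma _root_.contDiff_of_contDiffOn_of_eq_zero {V F : Type*} [NormedAddCommGroup V]
    [NormedSpace ℝ V] [NormedAddCommGroup F] [NormedSpace ℝ F] {f : V → F} {U T : Set V}
    (hU : IsOpen U) (hT : IsClosed T) (hTU : T ⊆ U) (hf : ContDiffOn ℝ ∞ f U)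
    (h0 : ∀ z, z ∉ T → f z = 0) : ContDiff ℝ ∞ f := by
  rw [contDiff_iff_contDiffAt]
  intro z
  by_cases hz : z ∈ T
  · exact hf.contDiffAt (hU.mem_nhds (hTU hz))
  · refine ContDiffAt.congr_of_eventuallyEq (f := fun _ => 0) contDiffAt_const ?_
    filter_upwards [hT.isOpen_compl.mem_nhds hz] with w hw
    exact h0 w hw

/-- The integral of a directional derivative of a compactly supported function vanishes. -/
lemma _root_.integral_fderiv_eq_zero_of_hasCompactSupport {m : ℕ} {F : Type*}
    [NormedAddCommGroup F] [NormedSpace ℝ F] {f : EuclideanSpace ℝ (Fin m) → F} (hf : ContDiff ℝ ∞ f) (hc : HasCompactSupport f)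
    (v : EuclideanSpace ℝ (Fin m)) : ∫ z, fderiv ℝ f z v = 0 := by
  have h1 : Integrable fun z => fderiv ℝ f z v :=
    ((hf.continuous_fderiv (by simp)).clm_apply continuous_const).integrable_of_hasCompactSupport
      (hc.fderiv_apply (𝕜 := ℝ) v)
  have h2 := integral_smul_fderiv_eq_neg_fderiv_smul_of_integrable (𝕜 := ℝ) (μ := volume)
    (f := fun _ => (1 : ℝ)) (g := f) (v := v) (by simp) (by simpa using h1)
    (by simpa using hf.continuous.integrable_of_hasCompactSupport hc)
    (fun _ _ => differentiableAt_const _) (fun _ _ => (hf.differentiable (by simp)) _)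
  simpa using h2

/-- Integration by parts for functions on an open set, one of which is supported in a compact
subset. -/
lemma _root_.setIntegral_mul_fderiv_eq_neg {m : ℕ} {S T : Set (EuclideanSpace ℝ (Fin m))}
    (hS : IsOpen S) (hT : IsCompact T) (hTS : T ⊆ S) {a b : EuclideanSpace ℝ (Fin m) → ℂ}
    (ha : ContDiffOn ℝ ∞ a S) (hb : ContDiffOn ℝ ∞ b S) (hbT : ∀ z ∈ S, z ∉ T → b z = 0)
    (v : EuclideanSpace ℝ (Fin m)) :
    IntegrableOn (fun z => a z * fderiv ℝ b z v) S ∧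
    IntegrableOn (fun z => fderiv ℝ a z v * b z) S ∧
    ∫ z in S, a z * fderiv ℝ b z v = -∫ z in S, fderiv ℝ a z v * b z := by
  have hda : ContinuousOn (fun z => fderiv ℝ a z v) S :=
    (ha.continuousOn_fderiv_of_isOpen hS (by simp)).clm_apply continuousOn_const
  have hdb : ContinuousOn (fun z => fderiv ℝ b z v) S :=
    (hb.continuousOn_fderiv_of_isOpen hS (by simp)).clm_apply continuousOn_const
  have hdb0 : ∀ z ∈ S, z ∉ T → fderiv ℝ b z v = 0 := by
    intro z hz hzT
    have : b =ᶠ[𝓝 z] fun _ => 0 := by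
      filter_upwards [(hS.inter hT.isClosed.isOpen_compl).mem_nhds ⟨hz, hzT⟩] with w hw
      exact hbT w hw.1 hw.2
    rw [this.fderiv_eq]
    simp
  have hi1 : IntegrableOn (fun z => a z * fderiv ℝ b z v) S :=
    (((ha.continuousOn.mul hdb).mono hTS).integrableOn_compact hT).of_forall_sdiff_eq_zero
      hS.measurableSet fun z hz => by simp [hdb0 z hz.1 hz.2]
  have hi2 : IntegrableOn (fun z => fderiv ℝ a z v * b z) S :=
    (((hda.mul hb.continuousOn).mono hTS).integrableOn_compact hT).of_forall_sdiff_eq_zero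
      hS.measurableSet fun z hz => by simp [hbT z hz.1 hz.2]
  refine ⟨hi1, hi2, ?_⟩
  classical
  -- Only the product needs to extend smoothly by zero; `a` may be arbitrary off `S`. The integral
  -- of a derivative of the extension vanishes, which is the formula by the Leibniz rule.
  set w : EuclideanSpace ℝ (Fin m) → ℂ := S.indicator fun z => a z * b z with hw
  have hw0 : ∀ z, z ∉ T → w z = 0 := fun z hz => by
    by_cases hzS : z ∈ S
    · rw [hw, indicator_of_mem hzS, hbT z hzS hz, mul_zero]
    · rw [hw, indicator_of_notMem hzS]
  have hws : ContDiff ℝ ∞ w := contDiff_of_contDiffOn_of_eq_zero hS hT.isClosed hTS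
    ((ha.mul hb).congr fun z hz => indicator_of_mem hz _) hw0
  have hwc : HasCompactSupport w := HasCompactSupport.intro hT hw0
  have h1 := integral_fderiv_eq_zero_of_hasCompactSupport hws hwc v
  have h2 : ∫ z in S, fderiv ℝ w z v = ∫ z, fderiv ℝ w z v := by
    refine setIntegral_eq_integral_of_forall_compl_eq_zero fun z hz => ?_
    have : w =ᶠ[𝓝 z] fun _ => 0 := by
      filter_upwards [hT.isClosed.isOpen_compl.mem_nhds fun h => hz (hTS h)] with y hy
      exact hw0 y hy
    rw [this.fderiv_eq]
    simp
  have h3 : ∫ z in S, fderiv ℝ w z v = ∫ z in S, (a z * fderiv ℝ b z v + fderiv ℝ a z v * b z) := by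
    refine setIntegral_congr_fun hS.measurableSet fun z hz => ?_
    have hzn := hS.mem_nhds hz
    have : w =ᶠ[𝓝 z] fun z => a z * b z := by
      filter_upwards [hzn] with y hy
      exact indicator_of_mem hy _
    change fderiv ℝ w z v = _
    rw [this.fderiv_eq, fderiv_fun_mul ((ha.contDiffAt hzn).differentiableAt (by simp))
      ((hb.contDiffAt hzn).differentiableAt (by simp))]
    simp [mul_comm]
  rw [integral_add hi1 hi2] at h3
  exact eq_neg_of_add_eq_zero_left (h3.symm.trans (h2.trans h1))

end Extension

/-! ### Gradients of smooth functions; null sets and open sets -/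

section Gradients

lemma contMDiff_mul_complex {φ ψ : B → ℂ} (hφ : ContMDiff (𝓡∂ (n + 1)) 𝓘(ℝ, ℂ) ∞ φ)
    (hψ : ContMDiff (𝓡∂ (n + 1)) 𝓘(ℝ, ℂ) ∞ ψ) :
    ContMDiff (𝓡∂ (n + 1)) 𝓘(ℝ, ℂ) ∞ fun p => φ p * ψ p :=
  contDiff_mul.contMDiff.comp (hφ.prodMk_space hψ)

variable {Φ : EuclideanSpace ℝ (Fin (n + 1)) → B} {S : Set (EuclideanSpace ℝ (Fin (n + 1)))}

lemma differential_of_notMem_tsupport {φ : B → ℂ} {p : B} (hp : p ∉ tsupport φ) :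
    differential (n := n) φ p = 0 := by
  have : φ =ᶠ[𝓝 p] fun _ => 0 := notMem_tsupport_iff_eventuallyEq.1 hp
  ext j
  rw [differential, this.mfderiv_eq, mfderiv_const]
  rfl

lemma grad_of_notMem_tsupport (M : ConicManifold n B Y) {φ : B → ℂ} {p : B}
    (hp : p ∉ tsupport φ) : M.grad φ p = 0 := by
  rw [grad_eq_mulVec, differential_of_notMem_tsupport hp, Matrix.mulVec_zero]

lemma differential_add {φ ψ : B → ℂ} {p : B}
    (hφ : MDifferentiableAt (𝓡∂ (n + 1)) 𝓘(ℝ, ℂ) φ p)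
    (hψ : MDifferentiableAt (𝓡∂ (n + 1)) 𝓘(ℝ, ℂ) ψ p) :
    differential (n := n) (φ + ψ) p = differential φ p + differential ψ p := by
  ext j
  simp only [differential, Pi.add_apply]
  exact congrArg (fun L : EuclideanSpace ℝ (Fin (n + 1)) →L[ℝ] ℂ => L (EuclideanSpace.single j 1))
    (hφ.hasMFDerivAt.add hψ.hasMFDerivAt).mfderiv

lemma differential_sum {ι : Type*} (s : Finset ι) {φ : ι → B → ℂ} {p : B}
    (hφ : ∀ i, MDifferentiable (𝓡∂ (n + 1)) 𝓘(ℝ, ℂ) (φ i)) :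
    differential (n := n) (∑ i ∈ s, φ i) p = ∑ i ∈ s, differential (φ i) p ∧
      MDifferentiable (𝓡∂ (n + 1)) 𝓘(ℝ, ℂ) (∑ i ∈ s, φ i) := by
  classical
  induction s using Finset.induction_on with
  | empty =>
    simp only [Finset.sum_empty]
    exact ⟨differential_of_notMem_tsupport (by simp), mdifferentiable_const⟩
  | insert i s hi ih =>
    rw [Finset.sum_insert hi, Finset.sum_insert hi, differential_add (hφ i p) (ih.2 p), ih.1]
    exact ⟨rfl, (hφ i).add ih.2⟩

lemma _root_.ContMDiff.contDiffOn_comp_param (h : IsParam Φ S) {φ : B → ℂ}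
    (hφ : ContMDiff (𝓡∂ (n + 1)) 𝓘(ℝ, ℂ) ∞ φ) : ContDiffOn ℝ ∞ (φ ∘ Φ) S := by
  rw [← contMDiffOn_iff_contDiffOn]
  exact hφ.comp_contMDiffOn h.contMDiffOn

lemma _root_.ContDiffOn.fderiv_apply_of_isOpen {V F : Type*} [NormedAddCommGroup V]
    [NormedSpace ℝ V] [NormedAddCommGroup F] [NormedSpace ℝ F] {f : V → F} {U : Set V}
    (hf : ContDiffOn ℝ ∞ f U) (hU : IsOpen U) (v : V) :
    ContDiffOn ℝ ∞ (fun z => fderiv ℝ f z v) U :=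
  (hf.fderiv_of_isOpen hU (by simp)).clm_apply contDiffOn_const

/-- The inner product of two gradients is continuous in the interior. -/
lemma continuousOn_inner_grad (M : ConicManifold n B Y) {φ ψ : B → ℂ}
    (hφ : ContMDiff (𝓡∂ (n + 1)) 𝓘(ℝ, ℂ) ∞ φ) (hψ : ContMDiff (𝓡∂ (n + 1)) 𝓘(ℝ, ℂ) ∞ ψ) :
    ContinuousOn (fun p => M.inner p (M.grad φ p) (M.grad ψ p)) ((𝓡∂ (n + 1)).interior B) := by
  intro p hp
  refine ContinuousAt.continuousWithinAt ?_
  have hP := isParam_chart (n := n) p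
  have hz := (mem_interior_iff (mem_extChartAt_source (I := 𝓡∂ (n + 1)) p)).1 hp
  set κ := extChartAt (𝓡∂ (n + 1)) p with hκ
  have hcont : ContinuousOn (fun z => ∑ i, (∑ j, (((M.pullGram κ.symm z)⁻¹ i j : ℝ) : ℂ) *
        fderiv ℝ (φ ∘ κ.symm) z (EuclideanSpace.single j 1)) *
          fderiv ℝ (ψ ∘ κ.symm) z (EuclideanSpace.single i 1)) (interior κ.target) := by
    refine continuousOn_finsetSum _ fun i _ => ContinuousOn.mul
      (continuousOn_finsetSum _ fun j _ => ContinuousOn.mul ?_ ?_) ?_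
    · exact Complex.continuous_ofReal.comp_continuousOn
        (hP.contDiffOn_inv_pullGram M i j).continuousOn
    · exact ((hφ.contDiffOn_comp_param hP).fderiv_apply_of_isOpen hP.isOpen _).continuousOn
    · exact ((hψ.contDiffOn_comp_param hP).fderiv_apply_of_isOpen hP.isOpen _).continuousOn
  have h1 := (hcont.continuousAt (hP.isOpen.mem_nhds hz)).comp (continuousAt_extChartAt p)
  refine h1.congr ?_
  filter_upwards [(isOpen_extChartAt_source (I := 𝓡∂ (n + 1)) p).mem_nhds
    (mem_extChartAt_source p), (isOpen_interior n B).mem_nhds hp] with q hq hq'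
  have := hP.inner_grad_grad M ((mem_interior_iff hq).1 hq') (φ := φ) (ψ := ψ)
    (hφ.mdifferentiable (by simp) _) (hψ.mdifferentiable (by simp) _)
  rw [κ.left_inv hq] at this
  exact this.symm

variable [MeasurableSpace B] [BorelSpace B] [CompactSpace B]

/-- The boundary is a null set, so the degeneracy of `g` there does no harm. -/
lemma aestronglyMeasurable_of_continuousOn (M : ConicManifold n B Y) {F : Type*}
    [TopologicalSpace F] [SecondCountableTopology F] [TopologicalSpace.PseudoMetrizableSpace F]
    {f : B → F} (hf : ContinuousOn f ((𝓡∂ (n + 1)).interior B)) :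
    AEStronglyMeasurable f M.riemMeasure := by
  have h := hf.aestronglyMeasurable (μ := M.riemMeasure) (isOpen_interior n B).measurableSet
  rwa [Measure.restrict_eq_self_of_ae_mem M.ae_mem_interior] at h

/-- The density is positive in a chart. This upgrades almost everywhere equalities between
continuous functions to equalities. -/
lemma riemMeasure_pos (M : ConicManifold n B Y) {O : Set B} (hO : IsOpen O)
    (hO' : O ⊆ (𝓡∂ (n + 1)).interior B) (hne : O.Nonempty) : M.riemMeasure O ≠ 0 := by
  obtain ⟨p, hp⟩ := hne
  intro h0
  have hP := isParam_chart (n := n) p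
  have hs := mem_extChartAt_source (I := 𝓡∂ (n + 1)) p
  have hz := (mem_interior_iff hs).1 (hO' hp)
  have hopen : IsOpen (interior (extChartAt (𝓡∂ (n + 1)) p).target ∩
      (extChartAt (𝓡∂ (n + 1)) p).symm ⁻¹' O) := hP.continuousOn.isOpen_inter_preimage hP.isOpen hO
  have h1 : M.paramMeasure (extChartAt (𝓡∂ (n + 1)) p).symm
      (interior (extChartAt (𝓡∂ (n + 1)) p).target) O = 0 := by
    rw [← hP.paramMeasure_inter M hO.measurableSet, ← M.riemMeasure_glue.2 _ _ hP _
      (hO.inter hP.isOpen_image).measurableSet inter_subset_right]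
    exact measure_mono_null inter_subset_left h0
  rw [hP.paramMeasure_apply M hO.measurableSet] at h1
  rw [lintegral_eq_zero_iff' ((hP.aemeasurable_density M).mono_measure
    (Measure.restrict_mono inter_subset_left le_rfl))] at h1
  have h2 : volume (interior (extChartAt (𝓡∂ (n + 1)) p).target ∩
      (extChartAt (𝓡∂ (n + 1)) p).symm ⁻¹' O) = 0 := by
    rw [Filter.EventuallyEq, ae_restrict_iff' hopen.measurableSet, ae_iff] at h1
    refine measure_mono_null ?_ h1
    intro z hz h3
    have h4 := h3 hz
    have h5 := hP.sqrt_det_pullGram_pos M hz.1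
    rw [Pi.zero_apply, ENNReal.ofReal_eq_zero] at h4
    exact absurd h5 (not_lt.2 h4)
  refine (hopen.measure_pos volume ⟨_, hz, ?_⟩).ne' h2
  rw [mem_preimage, (extChartAt (𝓡∂ (n + 1)) p).left_inv hs]
  exact hp

end Gradients

/-! ### Green's formula for smooth functions -/

section Green

variable {Φ : EuclideanSpace ℝ (Fin (n + 1)) → B} {S : Set (EuclideanSpace ℝ (Fin (n + 1)))}

/-- The components `(det g)^{1/2} ∑ j, g^{ij} ∂_j φ` in the coordinates given by `Φ`. -/
noncomputable def paramFlux (M : ConicManifold n B Y)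
    (Φ : EuclideanSpace ℝ (Fin (n + 1)) → B) (φ : B → ℂ) (i : Fin (n + 1))
    (z : EuclideanSpace ℝ (Fin (n + 1))) : ℂ :=
  (√(M.pullGram Φ z).det : ℂ) * ∑ j, (((M.pullGram Φ z)⁻¹ i j : ℝ) : ℂ) *
    fderiv ℝ (φ ∘ Φ) z (EuclideanSpace.single j 1)

/-- The Laplace-Beltrami operator in the coordinates given by `Φ`. -/
noncomputable def paramLaplacian (M : ConicManifold n B Y)
    (Φ : EuclideanSpace ℝ (Fin (n + 1)) → B) (φ : B → ℂ)
    (z : EuclideanSpace ℝ (Fin (n + 1))) : ℂ :=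
  ((√(M.pullGram Φ z).det : ℝ) : ℂ)⁻¹ *
    ∑ i, fderiv ℝ (M.paramFlux Φ φ i) z (EuclideanSpace.single i 1)

lemma laplacian_eq (M : ConicManifold n B Y) (φ : B → ℂ) {p : B}
    (hp : p ∈ (𝓡∂ (n + 1)).interior B) :
    M.laplacian φ p = M.paramLaplacian (extChartAt (𝓡∂ (n + 1)) p).symm φ
      (extChartAt (𝓡∂ (n + 1)) p p) := by
  have hz := (mem_interior_iff (mem_extChartAt_source (I := 𝓡∂ (n + 1)) p)).1 hp
  rw [laplacian, paramLaplacian, chartDensity, chartMetric_eq M hz]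
  congr 1
  refine Finset.sum_congr rfl fun i _ => ?_
  congr 1
  refine Filter.EventuallyEq.fderiv_eq ?_
  filter_upwards [_root_.isOpen_interior.mem_nhds hz] with z hz'
  rw [chartDensity, chartMetric_eq M hz', paramFlux]
  rfl

lemma IsParam.contDiffOn_paramFlux (M : ConicManifold n B Y) (h : IsParam Φ S) {φ : B → ℂ}
    (hφ : ContMDiff (𝓡∂ (n + 1)) 𝓘(ℝ, ℂ) ∞ φ) (i : Fin (n + 1)) :
    ContDiffOn ℝ ∞ (M.paramFlux Φ φ i) S := by
  refine ContDiffOn.mul (Complex.ofRealCLM.contDiff.comp_contDiffOn (h.contDiffOn_sqrt_det M))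
    (ContDiffOn.sum fun j _ => ContDiffOn.mul
      (Complex.ofRealCLM.contDiff.comp_contDiffOn (h.contDiffOn_inv_pullGram M i j)) ?_)
  exact (hφ.contDiffOn_comp_param h).fderiv_apply_of_isOpen h.isOpen _

lemma IsParam.continuousOn_paramLaplacian (M : ConicManifold n B Y) (h : IsParam Φ S)
    {φ : B → ℂ} (hφ : ContMDiff (𝓡∂ (n + 1)) 𝓘(ℝ, ℂ) ∞ φ) :
    ContinuousOn (M.paramLaplacian Φ φ) S := by
  refine ContinuousOn.mul (ContinuousOn.inv₀ ?_ ?_) (continuousOn_finsetSum _ fun i _ => ?_)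
  · exact Complex.continuous_ofReal.comp_continuousOn (h.contDiffOn_sqrt_det M).continuousOn
  · intro z hz
    exact_mod_cast (h.sqrt_det_pullGram_pos M hz).ne'
  · exact ((h.contDiffOn_paramFlux M hφ i).fderiv_apply_of_isOpen h.isOpen _).continuousOn

/-- The Laplace-Beltrami operator in the chart around `c`, as a function on `B`. -/
noncomputable def chartLaplacian (M : ConicManifold n B Y) (c : B) (φ : B → ℂ) (p : B) : ℂ :=
  M.paramLaplacian (extChartAt (𝓡∂ (n + 1)) c).symm φ (extChartAt (𝓡∂ (n + 1)) c p)

/-- The interior points in the domain of the chart around `c`. -/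
def chartInterior (c : B) : Set B :=
  (extChartAt (𝓡∂ (n + 1)) c).source ∩ (𝓡∂ (n + 1)).interior B

lemma isOpen_chartInterior (c : B) : IsOpen (chartInterior (n := n) c) :=
  (isOpen_extChartAt_source c).inter (isOpen_interior n B)

lemma continuousOn_chartLaplacian (M : ConicManifold n B Y) (c : B) {φ : B → ℂ}
    (hφ : ContMDiff (𝓡∂ (n + 1)) 𝓘(ℝ, ℂ) ∞ φ) :
    ContinuousOn (M.chartLaplacian c φ) (chartInterior (n := n) c) :=
  ((isParam_chart c).continuousOn_paramLaplacian M hφ).comp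
    ((continuousOn_extChartAt c).mono inter_subset_left)
    fun _ hp => (mem_interior_iff hp.1).1 hp.2

variable [MeasurableSpace B] [BorelSpace B] [CompactSpace B] [T2Space B]

/-- In coordinates the left side integrates the flux `√det g · g^{ij} ∂_jφ` against `∂_iψ`. The
divergence of the flux is `√det g` times the Laplacian, so one integration by parts in each
coordinate suffices. -/
lemma integral_inner_grad_chart (M : ConicManifold n B Y) (c : B) {φ ψ : B → ℂ}
    (hφ : ContMDiff (𝓡∂ (n + 1)) 𝓘(ℝ, ℂ) ∞ φ) (hψ : ContMDiff (𝓡∂ (n + 1)) 𝓘(ℝ, ℂ) ∞ ψ)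
    (hc : tsupport ψ ⊆ chartInterior (n := n) c) :
    ∫ p, M.inner p (M.grad φ p) (M.grad ψ p) ∂M.riemMeasure =
      -∫ p, ψ p * M.chartLaplacian c φ p ∂M.riemMeasure := by
  have hP := isParam_chart (n := n) c
  set κ := extChartAt (𝓡∂ (n + 1)) c with hκ
  have himage : κ.symm '' interior κ.target = chartInterior (n := n) c := image_symm_interior c
  have hcont : Continuous fun p => ψ p * M.chartLaplacian c φ p :=
    continuous_of_continuousOn_of_eq_zero (isOpen_chartInterior c) (isClosed_tsupport ψ) hc
      (hψ.continuous.continuousOn.mul (M.continuousOn_chartLaplacian c hφ))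
      fun p hp => by rw [image_eq_zero_of_notMem_tsupport hp, zero_mul]
  have h1 : ∫ p in κ.symm '' interior κ.target, M.inner p (M.grad φ p) (M.grad ψ p)
      ∂M.riemMeasure = ∫ p, M.inner p (M.grad φ p) (M.grad ψ p) ∂M.riemMeasure := by
    refine setIntegral_eq_integral_of_forall_compl_eq_zero fun p hp => ?_
    rw [M.grad_of_notMem_tsupport (φ := ψ) (fun h => hp (himage ▸ hc h)), inner_zero_right]
  have h2 : ∫ p in κ.symm '' interior κ.target, ψ p * M.chartLaplacian c φ p
      ∂M.riemMeasure = ∫ p, ψ p * M.chartLaplacian c φ p ∂M.riemMeasure := by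
    refine setIntegral_eq_integral_of_forall_compl_eq_zero fun p hp => ?_
    rw [image_eq_zero_of_notMem_tsupport fun h => hp (himage ▸ hc h), zero_mul]
  rw [← h1, ← h2, hP.setIntegral_eq M (M.aestronglyMeasurable_of_continuousOn
    (M.continuousOn_inner_grad hφ hψ)), hP.setIntegral_eq M hcont.aestronglyMeasurable]
  have hT : IsCompact (κ '' tsupport ψ) :=
    (isClosed_tsupport ψ).isCompact.image_of_continuousOn
      ((continuousOn_extChartAt c).mono (hc.trans inter_subset_left))
  have hTS : κ '' tsupport ψ ⊆ interior κ.target := by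
    rintro _ ⟨p, hp, rfl⟩
    exact (mem_interior_iff (hc hp).1).1 (hc hp).2
  have hb0 : ∀ z ∈ interior κ.target, z ∉ κ '' tsupport ψ → (ψ ∘ κ.symm) z = 0 := by
    intro z hz hz'
    refine image_eq_zero_of_notMem_tsupport (f := ψ) fun h => hz' ⟨_, h, ?_⟩
    exact κ.right_inv (interior_subset hz)
  have hibp (i : Fin (n + 1)) := setIntegral_mul_fderiv_eq_neg hP.isOpen hT hTS
    (hP.contDiffOn_paramFlux M hφ i) (hψ.contDiffOn_comp_param hP) hb0
    (EuclideanSpace.single i 1)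
  have h3 : ∫ z in interior κ.target, (√(M.pullGram κ.symm z).det : ℂ) *
      M.inner (κ.symm z) (M.grad φ (κ.symm z)) (M.grad ψ (κ.symm z)) =
      ∑ i, ∫ z in interior κ.target, M.paramFlux κ.symm φ i z *
        fderiv ℝ (ψ ∘ κ.symm) z (EuclideanSpace.single i 1) := by
    rw [← integral_finsetSum _ fun i _ => (hibp i).1]
    refine setIntegral_congr_fun hP.isOpen.measurableSet fun z hz => ?_
    rw [hP.inner_grad_grad M hz (hφ.mdifferentiable (by simp) _)
      (hψ.mdifferentiable (by simp) _), Finset.mul_sum]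
    refine Finset.sum_congr rfl fun i _ => ?_
    rw [paramFlux, mul_assoc]
  have h4 : ∫ z in interior κ.target, (√(M.pullGram κ.symm z).det : ℂ) *
      (ψ (κ.symm z) * M.chartLaplacian c φ (κ.symm z)) =
      ∑ i, ∫ z in interior κ.target,
        fderiv ℝ (M.paramFlux κ.symm φ i) z (EuclideanSpace.single i 1) * (ψ ∘ κ.symm) z := by
    rw [← integral_finsetSum _ fun i _ => (hibp i).2.1]
    refine setIntegral_congr_fun hP.isOpen.measurableSet fun z hz => ?_
    have hd : ((√(M.pullGram κ.symm z).det : ℝ) : ℂ) ≠ 0 := by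
      exact_mod_cast (hP.sqrt_det_pullGram_pos M hz).ne'
    rw [chartLaplacian, ← hκ, κ.right_inv (interior_subset hz), paramLaplacian,
      ← Finset.sum_mul, Function.comp_apply]
    field_simp
  rw [h3, h4, ← Finset.sum_neg_distrib]
  exact Finset.sum_congr rfl fun i _ => (hibp i).2.2

variable [CompactSpace Y]

/-- The chart invariance of the Laplacian is obtained weakly. For `g` supported in the overlap,
Green's formula in either chart equates `-∫ g Δφ` with the same invariant integral of gradients, so
the two expressions agree almost everywhere. Being continuous, they agree everywhere, since nonempty
open sets in the interior have positive measure. -/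
lemma chartLaplacian_eq_laplacian (M : ConicManifold n B Y) (hn : 1 ≤ n) {c p : B} {φ : B → ℂ}
    (hφ : ContMDiff (𝓡∂ (n + 1)) 𝓘(ℝ, ℂ) ∞ φ) (hp : p ∈ chartInterior (n := n) c) :
    M.chartLaplacian c φ p = M.laplacian φ p := by
  have := M.isFiniteMeasure_riemMeasure hn
  rw [M.laplacian_eq φ hp.2]
  change _ = M.chartLaplacian p φ p
  by_contra hne
  set U : Set B := chartInterior (n := n) c ∩ chartInterior (n := n) p with hU
  have hUo : IsOpen U := (isOpen_chartInterior c).inter (isOpen_chartInterior p)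
  have hcont : ContinuousOn (fun q => M.chartLaplacian c φ q - M.chartLaplacian p φ q) U :=
    ((M.continuousOn_chartLaplacian c hφ).mono inter_subset_left).sub
      ((M.continuousOn_chartLaplacian p hφ).mono inter_subset_right)
  have hae := hUo.ae_eq_zero_of_integral_contMDiff_smul_eq_zero (μ := M.riemMeasure) (𝓡∂ (n + 1))
    (f := fun q => M.chartLaplacian c φ q - M.chartLaplacian p φ q)
    (hcont.locallyIntegrableOn hUo.measurableSet) (fun g hg _ hgU => by
      have hg' : ContMDiff (𝓡∂ (n + 1)) 𝓘(ℝ, ℂ) ∞ fun q => (g q : ℂ) :=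
        Complex.ofRealCLM.contDiff.contMDiff.comp hg
      have hs : tsupport (fun q => (g q : ℂ)) ⊆ tsupport g :=
        closure_mono fun q hq => by simpa using hq
      have hc (d : B) (hd : U ⊆ chartInterior (n := n) d) :
          Continuous fun q => (g q : ℂ) * M.chartLaplacian d φ q :=
        continuous_of_continuousOn_of_eq_zero (isOpen_chartInterior d)
          (isClosed_tsupport fun q => (g q : ℂ)) (hs.trans (hgU.trans hd))
          (hg'.continuous.continuousOn.mul (M.continuousOn_chartLaplacian d hφ))
          fun q hq => by
            have : (g q : ℂ) = 0 :=
              image_eq_zero_of_notMem_tsupport (f := fun q => (g q : ℂ)) hq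
            rw [this, zero_mul]
      have hi (d : B) (hd : U ⊆ chartInterior (n := n) d) :
          Integrable (fun q => (g q : ℂ) * M.chartLaplacian d φ q) M.riemMeasure :=
        (hc d hd).integrable_of_hasCompactSupport (HasCompactSupport.of_compactSpace _)
      have e1 := M.integral_inner_grad_chart c hφ hg'
        (hs.trans (hgU.trans inter_subset_left))
      have e2 := M.integral_inner_grad_chart p hφ hg'
        (hs.trans (hgU.trans inter_subset_right))
      have e3 : ∀ q, g q • (M.chartLaplacian c φ q - M.chartLaplacian p φ q) =
          (g q : ℂ) * M.chartLaplacian c φ q - (g q : ℂ) * M.chartLaplacian p φ q := fun q => by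
        rw [Complex.real_smul, mul_sub]
      simp only [e3]
      rw [integral_sub (hi c inter_subset_left) (hi p inter_subset_right), sub_eq_zero]
      exact neg_injective (e1.symm.trans e2))
  have hO : IsOpen (U ∩ (fun q => M.chartLaplacian c φ q - M.chartLaplacian p φ q) ⁻¹' {0}ᶜ) :=
    hcont.isOpen_inter_preimage hUo isClosed_singleton.isOpen_compl
  refine M.riemMeasure_pos hO (fun q hq => hq.1.1.2)
    ⟨p, ⟨hp, mem_extChartAt_source p, hp.2⟩, sub_ne_zero.2 hne⟩ ?_
  rw [ae_iff] at hae
  refine measure_mono_null ?_ hae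
  intro q hq h
  exact hq.2 (h hq.1)

/-- By definition the chart moves with the point; near `p` it can be frozen to the chart around `p`.
-/
lemma continuousOn_laplacian (M : ConicManifold n B Y) (hn : 1 ≤ n) {φ : B → ℂ}
    (hφ : ContMDiff (𝓡∂ (n + 1)) 𝓘(ℝ, ℂ) ∞ φ) :
    ContinuousOn (M.laplacian φ) ((𝓡∂ (n + 1)).interior B) := by
  intro p hp
  have hpc : p ∈ chartInterior (n := n) p := ⟨mem_extChartAt_source p, hp⟩
  refine ContinuousAt.continuousWithinAt ?_
  refine ((M.continuousOn_chartLaplacian p hφ).continuousAt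
    ((isOpen_chartInterior p).mem_nhds hpc)).congr ?_
  filter_upwards [(isOpen_chartInterior p).mem_nhds hpc] with q hq
  exact M.chartLaplacian_eq_laplacian hn hφ hq

/-- Green's formula for smooth functions, one of which has compact support in the interior. -/
lemma integral_inner_grad_eq_neg (M : ConicManifold n B Y) (hn : 1 ≤ n) {φ ψ : B → ℂ}
    (hφ : ContMDiff (𝓡∂ (n + 1)) 𝓘(ℝ, ℂ) ∞ φ) (hψ : M.IsTest ψ) :
    ∫ p, M.inner p (M.grad φ p) (M.grad ψ p) ∂M.riemMeasure =
      -∫ p, ψ p * M.laplacian φ p ∂M.riemMeasure := by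
  have := M.isFiniteMeasure_riemMeasure hn
  obtain ⟨t, ht⟩ := (isClosed_tsupport ψ).isCompact.elim_finite_subcover
    (fun c : B => chartInterior (n := n) c) (fun c => isOpen_chartInterior c)
    (fun p hp => mem_iUnion.2 ⟨p, mem_extChartAt_source p, hψ.2.2 hp⟩)
  -- Only `ψ` is decomposed, into pieces supported in single charts. Both sides of Green's formula
  -- are linear in `ψ`, so `φ` needs no localization.
  obtain ⟨ρ, hρ⟩ := SmoothPartitionOfUnity.exists_isSubordinate (𝓡∂ (n + 1))
    (isClosed_tsupport ψ) (fun c : t => chartInterior (n := n) (c : B))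
    (fun c => isOpen_chartInterior _) (fun p hp => by
      obtain ⟨c, hc, hpc⟩ := mem_iUnion₂.1 (ht hp)
      exact mem_iUnion.2 ⟨⟨c, hc⟩, hpc⟩)
  set f : t → B → ℂ := fun c p => (ρ c p : ℂ) * ψ p with hf
  have hfs (c : t) : ContMDiff (𝓡∂ (n + 1)) 𝓘(ℝ, ℂ) ∞ (f c) :=
    contMDiff_mul_complex (Complex.ofRealCLM.contDiff.contMDiff.comp (ρ c).contMDiff) hψ.1
  have hft (c : t) : tsupport (f c) ⊆ chartInterior (n := n) (c : B) := by
    refine (closure_mono fun p hp => ?_).trans (hρ c)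
    intro h0
    exact hp (by simp [hf, h0])
  have hsum : ψ = ∑ c, f c := by
    ext p
    rw [Finset.sum_apply]
    by_cases hp : p ∈ tsupport ψ
    · have h1 := ρ.sum_eq_one hp
      rw [finsum_eq_sum_of_fintype] at h1
      rw [hf, ← Finset.sum_mul, ← Complex.ofReal_sum, h1, Complex.ofReal_one, one_mul]
    · simp [hf, image_eq_zero_of_notMem_tsupport hp]
  have hgrad (p : B) : M.grad ψ p = ∑ c, M.grad (f c) p := by
    have := (differential_sum (n := n) Finset.univ (p := p)
      fun c => (hfs c).mdifferentiable (by simp)).1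
    rw [← hsum] at this
    simp only [grad_eq_mulVec]
    rw [this, Matrix.mulVec_sum]
  have hinner (p : B) : M.inner p (M.grad φ p) (M.grad ψ p) =
      ∑ c, M.inner p (M.grad φ p) (M.grad (f c) p) := by
    rw [hgrad]
    simp only [inner_eq_dotProduct]
    rw [Matrix.mulVec_sum, dotProduct_sum]
  have hc1 (c : t) : Continuous fun p => f c p * M.laplacian φ p :=
    continuous_of_continuousOn_of_eq_zero (isOpen_interior n B) (isClosed_tsupport (f c))
      ((hft c).trans inter_subset_right)
      ((hfs c).continuous.continuousOn.mul (M.continuousOn_laplacian hn hφ))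
      fun p hp => by rw [image_eq_zero_of_notMem_tsupport hp, zero_mul]
  have hc2 (c : t) : Continuous fun p => M.inner p (M.grad φ p) (M.grad (f c) p) :=
    continuous_of_continuousOn_of_eq_zero (isOpen_interior n B) (isClosed_tsupport (f c))
      ((hft c).trans inter_subset_right) (M.continuousOn_inner_grad hφ (hfs c))
      fun p hp => by rw [M.grad_of_notMem_tsupport hp, inner_zero_right]
  have hlap (p : B) : ψ p * M.laplacian φ p = ∑ c, f c p * M.laplacian φ p := by
    rw [← Finset.sum_mul, ← Finset.sum_apply, ← hsum]
  simp only [hinner, hlap]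
  rw [integral_finsetSum _ fun c _ => (hc2 c).integrable_of_hasCompactSupport
      (HasCompactSupport.of_compactSpace _),
    integral_finsetSum _ fun c _ => (hc1 c).integrable_of_hasCompactSupport
      (HasCompactSupport.of_compactSpace _), ← Finset.sum_neg_distrib]
  refine Finset.sum_congr rfl fun c _ => ?_
  rw [M.integral_inner_grad_chart c hφ (hfs c) (hft c)]
  congr 1
  refine integral_congr_ae (ae_of_all _ fun p => ?_)
  by_cases hp : p ∈ tsupport (f c)
  · simp only [M.chartLaplacian_eq_laplacian hn hφ (hft c hp)]
  · simp [image_eq_zero_of_notMem_tsupport hp]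

end Green

/-! ### The weighted Hardy inequality -/

section EuclideanHardy

/-- Hardy's inequality in the direction of the first coordinate. -/
lemma lintegral_hardy {W : EuclideanSpace ℝ (Fin (n + 1)) → ℂ} (hW : ContDiff ℝ ∞ W)
    (hc : HasCompactSupport W) (hpos : ∀ z ∈ tsupport W, 0 < z 0) {a : ℝ} (ha : -1 < a) :
    ∫⁻ z, ENNReal.ofReal (z 0 ^ a * ‖W z‖ ^ 2) ≤ ENNReal.ofReal (4 / (a + 1) ^ 2) *
      ∫⁻ z, ENNReal.ofReal (z 0 ^ (a + 2) * ‖fderiv ℝ W z (EuclideanSpace.single 0 1)‖ ^ 2) := by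
  set e : EuclideanSpace ℝ (Fin (n + 1)) := EuclideanSpace.single 0 1 with he
  have hUo : IsOpen {z : EuclideanSpace ℝ (Fin (n + 1)) | 0 < z 0} :=
    isOpen_lt continuous_const (by fun_prop)
  have hz0 : ContDiff ℝ ∞ fun z : EuclideanSpace ℝ (Fin (n + 1)) => z 0 := by fun_prop
  have hrpow (s : ℝ) : ContDiffOn ℝ ∞ (fun z : EuclideanSpace ℝ (Fin (n + 1)) => z 0 ^ s)
      {z | 0 < z 0} := hz0.contDiffOn.rpow_const_of_ne fun z hz => ne_of_gt hz
  have hsmooth (s : ℝ) : ContDiff ℝ ∞ fun z => z 0 ^ s * ‖W z‖ ^ 2 :=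
    contDiff_of_contDiffOn_of_eq_zero hUo (isClosed_tsupport W) hpos
      ((hrpow s).mul (hW.norm_sq ℝ).contDiffOn)
      fun z hz => by simp [image_eq_zero_of_notMem_tsupport hz]
  have hsupp (s : ℝ) : HasCompactSupport fun z => z 0 ^ s * ‖W z‖ ^ 2 :=
    HasCompactSupport.intro hc fun z hz => by simp [image_eq_zero_of_notMem_tsupport hz]
  have hfd0 : ∀ z, z ∉ tsupport W → fderiv ℝ W z e = 0 := by
    intro z hz
    rw [(notMem_tsupport_iff_eventuallyEq.1 hz).fderiv_eq]
    simp
  have hD : Continuous fun z => z 0 ^ (a + 2) * ‖fderiv ℝ W z e‖ ^ 2 :=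
    continuous_of_continuousOn_of_eq_zero hUo (isClosed_tsupport W) hpos
      ((hrpow _).continuousOn.mul
        (((hW.continuous_fderiv (by simp)).clm_apply continuous_const).norm.pow 2).continuousOn)
      fun z hz => by simp [hfd0 z hz]
  have hDi : Integrable fun z => z 0 ^ (a + 2) * ‖fderiv ℝ W z e‖ ^ 2 :=
    hD.integrable_of_hasCompactSupport (HasCompactSupport.intro hc fun z hz => by simp [hfd0 z hz])
  have hLi : Integrable fun z => z 0 ^ a * ‖W z‖ ^ 2 :=
    (hsmooth a).continuous.integrable_of_hasCompactSupport (hsupp a)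
  set f : EuclideanSpace ℝ (Fin (n + 1)) → ℝ := fun z => z 0 ^ (a + 1) * ‖W z‖ ^ 2 with hf
  have hfi : Integrable fun z => fderiv ℝ f z e :=
    (((hsmooth (a + 1)).continuous_fderiv (by simp)).clm_apply
      continuous_const).integrable_of_hasCompactSupport ((hsupp (a + 1)).fderiv_apply (𝕜 := ℝ) e)
  have hf0 : ∫ z, fderiv ℝ f z e = 0 :=
    integral_fderiv_eq_zero_of_hasCompactSupport (hsmooth (a + 1)) (hsupp (a + 1)) e
  -- Off the support `z 0` may be negative and its real power may have any sign, so nonnegativity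
  -- has to come from the vanishing of the other factor.
  have hnn : ∀ (s : ℝ) (z : EuclideanSpace ℝ (Fin (n + 1))) (c : EuclideanSpace ℝ (Fin (n + 1)) → ℂ),
      (z ∉ tsupport W → c z = 0) → 0 ≤ z 0 ^ s * ‖c z‖ ^ 2 := by
    intro s z c hcz
    by_cases hz : z ∈ tsupport W
    · exact mul_nonneg (Real.rpow_nonneg (hpos z hz).le _) (sq_nonneg _)
    · simp [hcz hz]
  -- The derivative of `f = x^{a+1}|W|²` is `(a+1) x^a |W|²` plus a cross term. Young's inequality
  -- absorbs the cross term into half of the first term and `2/(a+1) · x^{a+2}|∂W|²`. After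
  -- integration the total derivative disappears.
  have hpt : ∀ z, (a + 1) / 2 * (z 0 ^ a * ‖W z‖ ^ 2) ≤
      fderiv ℝ f z e + 2 / (a + 1) * (z 0 ^ (a + 2) * ‖fderiv ℝ W z e‖ ^ 2) := by
    intro z
    by_cases hz : z ∈ tsupport W
    · have hx := hpos z hz
      have hW1 := (hW.differentiable (by simp) z).hasFDerivAt
      have h1 := ((hz0.differentiable (by simp) z).hasFDerivAt.rpow_const (p := a + 1)
        (Or.inl hx.ne')).mul hW1.norm_sq
      have h0e : fderiv ℝ (fun z : EuclideanSpace ℝ (Fin (n + 1)) => z 0) z e = 1 := by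
        have : HasFDerivAt (fun z : EuclideanSpace ℝ (Fin (n + 1)) => z 0)
          (EuclideanSpace.proj 0 : EuclideanSpace ℝ (Fin (n + 1)) →L[ℝ] ℝ) z :=
            (EuclideanSpace.proj 0 : EuclideanSpace ℝ (Fin (n + 1)) →L[ℝ] ℝ).hasFDerivAt
        rw [this.fderiv]
        simp [he]
      have h2 : fderiv ℝ f z e = z 0 ^ (a + 1) * (2 * Inner.inner ℝ (W z) (fderiv ℝ W z e)) +
          ‖W z‖ ^ 2 * ((a + 1) * z 0 ^ a) := by
        have h1' : HasFDerivAt f _ z := h1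
        rw [h1'.fderiv]
        simp [h0e]
        exact Or.inl (by ring)
      have h3 : -(‖W z‖ * ‖fderiv ℝ W z e‖) ≤ Inner.inner ℝ (W z) (fderiv ℝ W z e) :=
        neg_le_of_abs_le (abs_real_inner_le_norm _ _)
      have e1 : z 0 ^ (a + 1) = z 0 ^ a * z 0 := by
        rw [Real.rpow_add hx, Real.rpow_one]
      have e2 : z 0 ^ (a + 2) = z 0 ^ a * z 0 ^ 2 := by
        rw [Real.rpow_add hx, Real.rpow_two]
      have hxa : 0 ≤ z 0 ^ a := (Real.rpow_pos_of_pos hx a).le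
      rw [h2, e1, e2]
      have ha1 : 0 < a + 1 := by linarith
      set w := ‖W z‖
      set d := ‖fderiv ℝ W z e‖
      set q := Inner.inner ℝ (W z) (fderiv ℝ W z e)
      have key : 0 ≤ (a + 1) / 2 * w ^ 2 + 2 * z 0 * q + 2 / (a + 1) * (z 0 ^ 2 * d ^ 2) := by
        have h4 : 0 ≤ 2 / (a + 1) * ((a + 1) / 2 * w - z 0 * d) ^ 2 := by positivity
        have h5 : 2 / (a + 1) * ((a + 1) / 2 * w - z 0 * d) ^ 2 =
            (a + 1) / 2 * w ^ 2 - 2 * z 0 * (w * d) + 2 / (a + 1) * (z 0 ^ 2 * d ^ 2) := by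
          field_simp
          ring
        nlinarith [mul_le_mul_of_nonneg_left h3 (by positivity : 0 ≤ 2 * z 0)]
      have := mul_nonneg hxa key
      linarith
    · have : fderiv ℝ f z e = 0 := by
        have hev : f =ᶠ[𝓝 z] fun _ => 0 := by
          filter_upwards [notMem_tsupport_iff_eventuallyEq.1 hz] with y hy
          simp [hf, hy]
        rw [hev.fderiv_eq]
        simp
      simp [this, hfd0 z hz, image_eq_zero_of_notMem_tsupport hz]
  have ha1 : 0 < a + 1 := by linarith
  have hint := integral_mono (hLi.const_mul ((a + 1) / 2)) (hfi.add (hDi.const_mul (2 / (a + 1)))) hpt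
  simp only [Pi.add_apply] at hint
  rw [integral_add hfi (hDi.const_mul _), hf0, zero_add, integral_const_mul, integral_const_mul]
    at hint
  rw [← ofReal_integral_eq_lintegral_ofReal hLi (ae_of_all _ fun z => hnn a z W
      fun hz => image_eq_zero_of_notMem_tsupport hz),
    ← ofReal_integral_eq_lintegral_ofReal hDi (ae_of_all _ fun z => hnn (a + 2) z
      (fun z => fderiv ℝ W z e) fun hz => hfd0 z hz), ← ENNReal.ofReal_mul (by positivity)]
  refine ENNReal.ofReal_le_ofReal ?_
  -- Dividing by `(a+1)/2` produces the constant `4/(a+1)²`.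
  have h6 := mul_le_mul_of_nonneg_left hint (by positivity : 0 ≤ 2 / (a + 1))
  have h7 : 2 / (a + 1) * ((a + 1) / 2 * ∫ z : EuclideanSpace ℝ (Fin (n + 1)),
      z 0 ^ a * ‖W z‖ ^ 2) = ∫ z, z 0 ^ a * ‖W z‖ ^ 2 := by
    field_simp
  have h8 (t : ℝ) : 2 / (a + 1) * (2 / (a + 1) * t) = 4 / (a + 1) ^ 2 * t := by
    field_simp
    ring
  rwa [h7, h8] at h6

end EuclideanHardy

/-! ### Complex conjugation and lengths of gradients -/

section Conj

lemma differential_star (φ : B → ℂ) {p : B}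
    (hφ : MDifferentiableAt (𝓡∂ (n + 1)) 𝓘(ℝ, ℂ) φ p) :
    differential (n := n) (fun q => star (φ q)) p = star (differential φ p) := by
  have h1 := (Complex.conjCLE.toContinuousLinearMap.hasFDerivAt (x := φ p)).hasMFDerivAt.comp p
    hφ.hasMFDerivAt
  ext j
  exact congrArg (fun L : EuclideanSpace ℝ (Fin (n + 1)) →L[ℝ] ℂ => L (EuclideanSpace.single j 1))
    h1.mfderiv

lemma grad_star (M : ConicManifold n B Y) (φ : B → ℂ) {p : B}
    (hφ : MDifferentiableAt (𝓡∂ (n + 1)) 𝓘(ℝ, ℂ) φ p) :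
    M.grad (fun q => star (φ q)) p = star (M.grad φ p) := by
  rw [grad_eq_mulVec, grad_eq_mulVec, differential_star φ hφ]
  ext i
  simp [Matrix.mulVec, dotProduct, star_sum]

lemma contMDiff_star {φ : B → ℂ} (hφ : ContMDiff (𝓡∂ (n + 1)) 𝓘(ℝ, ℂ) ∞ φ) :
    ContMDiff (𝓡∂ (n + 1)) 𝓘(ℝ, ℂ) ∞ fun p => star (φ p) :=
  Complex.conjCLE.contDiff.contMDiff.comp hφ

lemma isTest_star {M : ConicManifold n B Y} {φ : B → ℂ} (h : M.IsTest φ) :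
    M.IsTest fun p => star (φ p) := by
  have : tsupport (fun p => star (φ p)) ⊆ tsupport φ := closure_mono fun p hp h0 => hp (by simp [h0])
  exact ⟨contMDiff_star h.1, h.2.1.mono fun p hp h0 => hp (by simp [h0]), this.trans h.2.2⟩

/-- Expresses the Hermitian length through the bilinear pairing with `∇φ̄`, to which the continuity
and coordinate formulas for two gradients apply. -/
lemma normSq_grad_eq (M : ConicManifold n B Y) {φ : B → ℂ}
    (hφ : ContMDiff (𝓡∂ (n + 1)) 𝓘(ℝ, ℂ) ∞ φ) (p : B) :
    M.normSq p (M.grad φ p) = (M.inner p (M.grad φ p) (M.grad (fun q => star (φ q)) p)).re := by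
  rw [normSq, M.grad_star φ (hφ.mdifferentiable (by simp) p)]

lemma continuousOn_normSq_grad (M : ConicManifold n B Y) {φ : B → ℂ}
    (hφ : ContMDiff (𝓡∂ (n + 1)) 𝓘(ℝ, ℂ) ∞ φ) :
    ContinuousOn (fun p => M.normSq p (M.grad φ p)) ((𝓡∂ (n + 1)).interior B) := by
  simp only [M.normSq_grad_eq hφ]
  exact Complex.continuous_re.comp_continuousOn (M.continuousOn_inner_grad hφ (contMDiff_star hφ))

variable {Φ : EuclideanSpace ℝ (Fin (n + 1)) → B} {S : Set (EuclideanSpace ℝ (Fin (n + 1)))}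

/-- Cauchy–Schwarz for `∇φ` and the `i`-th coordinate vector, whose squared length is `g_ii`. On the
collar `g_00 = 1`, so `|∂_xφ| ≤ |∇φ|`. -/
lemma norm_fderiv_comp_param_sq_le (M : ConicManifold n B Y) (h : IsParam Φ S)
    {z : EuclideanSpace ℝ (Fin (n + 1))} (hz : z ∈ S) {φ : B → ℂ}
    (hφ : MDifferentiableAt (𝓡∂ (n + 1)) 𝓘(ℝ, ℂ) φ (Φ z)) (i : Fin (n + 1)) :
    ‖fderiv ℝ (φ ∘ Φ) z (EuclideanSpace.single i 1)‖ ^ 2 ≤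
      M.normSq (Φ z) (M.grad φ (Φ z)) * M.pullGram Φ z i i := by
  have hint := h.mapsTo hz
  rw [fderiv_comp_param (h.mdifferentiableAt hz) hφ, ← M.inner_grad_left hint]
  set X : Fin (n + 1) → ℂ := fun k =>
    ((jacobian Φ z *ᵥ (EuclideanSpace.single i (1 : ℝ)).ofLp) k : ℂ) with hX
  have hJ : jacobian Φ z *ᵥ (EuclideanSpace.single i (1 : ℝ)).ofLp = fun k => jacobian Φ z k i := by
    ext k
    simp [Matrix.mulVec, dotProduct]
  have hN : M.normSq (Φ z) X = M.pullGram Φ z i i := by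
    rw [pullGram_eq, normSq, inner, Matrix.mul_assoc, Matrix.mul_apply]
    simp only [hX, hJ, Matrix.mul_apply, Finset.mul_sum, Matrix.transpose_apply, Pi.star_apply,
      RCLike.star_def, Complex.conj_ofReal, Complex.re_sum]
    refine Finset.sum_congr rfl fun k _ => Finset.sum_congr rfl fun l _ => ?_
    rw [← Complex.ofReal_mul, ← Complex.ofReal_mul, Complex.ofReal_re]
    ring
  have h1 := M.norm_inner_le hint (M.grad φ (Φ z)) X
  calc ‖M.inner (Φ z) (M.grad φ (Φ z)) X‖ ^ 2
      ≤ (√(M.normSq (Φ z) (M.grad φ (Φ z))) * √(M.normSq (Φ z) X)) ^ 2 :=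
        pow_le_pow_left₀ (norm_nonneg _) h1 2
    _ = _ := by
        rw [mul_pow, Real.sq_sqrt (M.normSq_nonneg hint _), Real.sq_sqrt (M.normSq_nonneg hint _),
          hN]

variable [MeasurableSpace B] [BorelSpace B] [CompactSpace B]

lemma aemeasurable_normSq_grad (M : ConicManifold n B Y) {φ : B → ℂ}
    (hφ : ContMDiff (𝓡∂ (n + 1)) 𝓘(ℝ, ℂ) ∞ φ) :
    AEMeasurable (fun p => M.normSq p (M.grad φ p)) M.riemMeasure :=
  (M.aestronglyMeasurable_of_continuousOn (M.continuousOn_normSq_grad hφ)).aemeasurable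

lemma IsParam.setLIntegral_image [T2Space B] (M : ConicManifold n B Y) (h : IsParam Φ S)
    {T : Set (EuclideanSpace ℝ (Fin (n + 1)))} (hT : MeasurableSet T) (hTS : T ⊆ S)
    {f : B → ℝ≥0∞} (hf : AEMeasurable f M.riemMeasure) :
    ∫⁻ p in Φ '' T, f p ∂M.riemMeasure =
      ∫⁻ z in T, ENNReal.ofReal √(M.pullGram Φ z).det * f (Φ z) := by
  have hm : MeasurableSet (Φ '' T) :=
    hT.image_of_continuousOn_injOn (h.continuousOn.mono hTS) (h.injOn.mono hTS)
  have h1 := h.setLIntegral_eq M (hf.indicator hm)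
  rw [lintegral_indicator hm, Measure.restrict_restrict hm,
    inter_eq_left.2 (image_mono hTS)] at h1
  have e : (volume : Measure (EuclideanSpace ℝ (Fin (n + 1)))).restrict T =
      (volume.restrict S).restrict T := by
    rw [Measure.restrict_restrict hT, inter_eq_left.2 hTS]
  rw [h1, e, ← lintegral_indicator hT]
  refine setLIntegral_congr_fun h.isOpen.measurableSet fun z hz => ?_
  by_cases hzT : z ∈ T
  · rw [indicator_of_mem (mem_image_of_mem Φ hzT), indicator_of_mem hzT]
  · rw [indicator_of_notMem hzT, indicator_of_notMem, mul_zero]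
    rintro ⟨w, hw, hwz⟩
    exact hzT (h.injOn (hTS hw) hz hwz ▸ hw)

end Conj

/-! ### Hardy's inequality on the manifold -/

section Hardy

variable [MeasurableSpace B] [BorelSpace B] [CompactSpace B] [T2Space B] [CompactSpace Y]

/-- The positive function `radial` is bounded below on the compact support. -/
lemma exists_pos_forall_radial_lt (M : ConicManifold n B Y) {φ : B → ℂ} (hφ : M.IsTest φ) :
    ∃ δ : ℝ, 0 < δ ∧ ∀ p, M.radial p < δ → φ p = 0 := by
  obtain ⟨δ, hδ, h⟩ := (isClosed_tsupport φ).isCompact.exists_forall_le'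
    M.continuous_radial.continuousOn (a := 0) fun p hp => (M.radial_pos_iff p).2 (hφ.2.2 hp)
  exact ⟨δ, hδ, fun p hp => image_eq_zero_of_notMem_tsupport fun h' => (h p h').not_gt hp⟩

/-- A smooth cutoff in the coordinates of `collarParam`. -/
lemma exists_collar_cutoff (a : EuclideanSpace ℝ (Fin n)) {r : ℝ} (hr : 0 < r) :
    ∃ (θ : EuclideanSpace ℝ (Fin (n + 1)) → ℝ) (C : ℝ), ContDiff ℝ ∞ θ ∧ 0 ≤ C ∧
      (∀ z, |θ z| ≤ 1) ∧ (∀ z, |fderiv ℝ θ z (EuclideanSpace.single 0 1)| ≤ C) ∧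
      (∀ z ∈ slab (1 / 4) (Metric.ball a (r / 2)), θ z = 1) ∧
      (∀ z, 0 < z 0 → z ∉ slab (1 / 2) (Metric.closedBall a r) → θ z = 0) := by
  -- The radii match the slabs: `χ` falls from one to zero between `r / 2` and `r`, and `η` between
  -- `1 / 4` and `1 / 2`. The bump `η` is centred at zero, so no derivative arises near `x = 0`.
  let χ : ContDiffBump a := ⟨r / 2, r, by positivity, by linarith⟩
  let η : ContDiffBump (0 : ℝ) := ⟨1 / 4, 1 / 2, by norm_num, by norm_num⟩
  have hz0 : ContDiff ℝ ∞ fun z : EuclideanSpace ℝ (Fin (n + 1)) => z 0 := by fun_prop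
  have hs : ContDiff ℝ ∞ fun z : EuclideanSpace ℝ (Fin (n + 1)) => χ (tail z) * η (z 0) :=
    (χ.contDiff.comp contDiff_tail).mul (η.contDiff.comp hz0)
  have h0 : ∀ z : EuclideanSpace ℝ (Fin (n + 1)),
      z ∉ consEquiv n '' (Metric.closedBall 0 (1 / 2) ×ˢ Metric.closedBall a r) →
        χ (tail z) * η (z 0) = 0 := by
    intro z hz
    by_cases h1 : tail z ∈ Metric.closedBall a r
    · have : z 0 ∉ Metric.closedBall (0 : ℝ) (1 / 2) := fun h2 =>
        hz ⟨(z 0, tail z), ⟨h2, h1⟩, (consEquiv n).apply_symm_apply z⟩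
      rw [η.zero_of_le_dist (x := z 0), mul_zero]
      rw [Metric.mem_closedBall, not_le] at this
      exact this.le
    · rw [Metric.mem_closedBall, not_le] at h1
      rw [χ.zero_of_le_dist (x := tail z) h1.le, zero_mul]
  have hc : HasCompactSupport fun z : EuclideanSpace ℝ (Fin (n + 1)) => χ (tail z) * η (z 0) :=
    HasCompactSupport.intro (((isCompact_closedBall _ _).prod (isCompact_closedBall _ _)).image
      (consEquiv n).continuous) h0
  obtain ⟨C, hC⟩ := (hc.fderiv_apply (𝕜 := ℝ)
    (EuclideanSpace.single 0 1)).exists_bound_of_continuous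
    ((hs.continuous_fderiv (by simp)).clm_apply continuous_const)
  refine ⟨_, C, hs, (norm_nonneg _).trans (hC 0), fun z => ?_, hC, fun z hz => ?_,
    fun z hz hz' => h0 z ?_⟩
  · rw [abs_of_nonneg (mul_nonneg χ.nonneg η.nonneg)]
    exact mul_le_one₀ χ.le_one η.nonneg η.le_one
  · rw [χ.one_of_mem_closedBall (Metric.ball_subset_closedBall hz.2), one_mul,
      η.one_of_mem_closedBall]
    rw [Metric.mem_closedBall, Real.dist_eq, sub_zero, abs_of_pos hz.1.1]
    exact hz.1.2
  · rintro ⟨⟨x, w⟩, ⟨hx, hw⟩, rfl⟩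
    refine hz' ⟨⟨hz, ?_⟩, hw⟩
    rw [Metric.mem_closedBall, Real.dist_eq, sub_zero] at hx
    exact (le_abs_self _).trans hx

/-- The squared `H¹` norm of a smooth function. -/
noncomputable def energy (M : ConicManifold n B Y) (φ : B → ℂ) : ℝ≥0∞ :=
  ∫⁻ p, ENNReal.ofReal (‖φ p‖ ^ 2 + M.normSq p (M.grad φ p)) ∂M.riemMeasure

/-- The Euclidean inequality is applied to `θ · (φ ∘ Φ)`, extended by zero. The cutoff costs only a
multiple of `|φ|`, which the full `H¹` norm controls. -/
lemma exists_hardy_collarParam (M : ConicManifold n B Y) (hn : 1 ≤ n) {γ : ℝ} (hγ : -1 < γ)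
    (y₀ : Y) {r : ℝ} (hr : 0 < r) (hrt : Metric.closedBall (extChartAt (𝓡 n) y₀ y₀) r ⊆
      (extChartAt (𝓡 n) y₀).target) :
    ∃ C : ℝ, ∀ φ, M.IsTest φ →
      ∫⁻ p in M.collarParam y₀ '' slab (1 / 4) (Metric.ball (extChartAt (𝓡 n) y₀ y₀) (r / 2)),
        ENNReal.ofReal (M.radial p ^ (2 * γ) * ‖φ p‖ ^ 2) ∂M.riemMeasure ≤
      ENNReal.ofReal C * M.energy φ := by
  obtain ⟨c, C, hc, hC, hbd⟩ := M.exists_density_bounds y₀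
    (isCompact_closedBall (extChartAt (𝓡 n) y₀ y₀) r) hrt
  obtain ⟨θ, A, hθ, hA, hθ1, hθA, hθone, hθ0⟩ :=
    exists_collar_cutoff (extChartAt (𝓡 n) y₀ y₀) hr
  have hP := M.isParam_collar y₀
  set w := extChartAt (𝓡 n) y₀ y₀ with hw
  set Φ := M.collarParam y₀ with hΦ
  set S := collarDomain (n := n) y₀ with hS
  set T := slab (n := n) (1 / 2) (Metric.closedBall w r) with hT
  set T' := slab (n := n) (1 / 4) (Metric.ball w (r / 2)) with hT'
  set e : EuclideanSpace ℝ (Fin (n + 1)) := EuclideanSpace.single 0 1 with he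
  have hTS : T ⊆ S := slab_subset_collarDomain (by norm_num) hrt
  have hTT : T' ⊆ T := fun z hz => ⟨⟨hz.1.1, hz.1.2.trans (by norm_num)⟩,
    Metric.ball_subset_closedBall (Metric.ball_subset_ball (by linarith) hz.2)⟩
  have hTm : MeasurableSet T := measurableSet_slab _ Metric.isClosed_closedBall.measurableSet
  have hTm' : MeasurableSet T' := measurableSet_slab _ Metric.isOpen_ball.measurableSet
  have hn' : (1 : ℝ) ≤ n := by exact_mod_cast hn
  -- The weight `x^{2γ}` times the density `xⁿ`. The bounds `γ > -1` and `n ≥ 1` give `a + 1 > n - 1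
  -- ≥ 0`.
  set a : ℝ := 2 * γ + n with ha
  have ha1 : -1 < a := by linarith
  have hrad : ∀ z ∈ S, M.radial (Φ z) = z 0 := fun z hz =>
    M.radial_collar (M.collarCoord_mem_source hz)
  -- The factors are the upper density bound, the Hardy constant, and, for returning from `∂_x(θφ)`
  -- to the energy, the product rule bound divided by the lower density bound.
  refine ⟨C * (4 / (a + 1) ^ 2) * (2 * (A ^ 2 + 1) / c), fun φ hφ => ?_⟩
  obtain ⟨δ, hδ, hδφ⟩ := M.exists_pos_forall_radial_lt hφ
  have hm1 : AEMeasurable (fun p => ENNReal.ofReal (M.radial p ^ (2 * γ) * ‖φ p‖ ^ 2))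
      M.riemMeasure :=
    (((M.continuous_radial.measurable.pow_const _).mul
      (hφ.1.continuous.norm.pow 2).measurable).ennreal_ofReal).aemeasurable
  have hm2 : AEMeasurable (fun p => ENNReal.ofReal (‖φ p‖ ^ 2 + M.normSq p (M.grad φ p)))
      M.riemMeasure :=
    (((hφ.1.continuous.norm.pow 2).measurable.aemeasurable).add
      (M.aemeasurable_normSq_grad hφ.1)).ennreal_ofReal
  have hφS : ContDiffOn ℝ ∞ (φ ∘ Φ) S := hφ.1.contDiffOn_comp_param hP
  classical
  set W : EuclideanSpace ℝ (Fin (n + 1)) → ℂ := S.indicator fun z => (θ z : ℂ) * φ (Φ z) with hW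
  -- Since `φ` vanishes for `x < δ`, the localized function has compact support inside `x ≥ δ`, as
  -- the Euclidean inequality requires.
  set K : Set (EuclideanSpace ℝ (Fin (n + 1))) :=
    consEquiv n '' (Icc δ (1 / 2) ×ˢ Metric.closedBall w r) with hK
  have hKc : IsCompact K :=
    (isCompact_Icc.prod (isCompact_closedBall _ _)).image (consEquiv n).continuous
  have hKT : K ⊆ T := by
    rintro _ ⟨⟨x, y⟩, ⟨hx, hy⟩, rfl⟩
    exact ⟨⟨hδ.trans_le hx.1, hx.2⟩, hy⟩
  have hW0 : ∀ z, z ∉ K → W z = 0 := by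
    intro z hz
    by_cases hzS : z ∈ S
    · rw [hW, indicator_of_mem hzS]
      by_cases hzT : z ∈ T
      · have : z 0 < δ := by
          by_contra h
          exact hz ⟨(z 0, tail z), ⟨⟨not_lt.1 h, hzT.1.2⟩, hzT.2⟩,
            (consEquiv n).apply_symm_apply z⟩
        rw [hδφ _ ((hrad z hzS).trans_lt this), mul_zero]
      · rw [hθ0 z hzS.1.1 hzT]
        simp
    · rw [hW, indicator_of_notMem hzS]
  have hWs : ContDiff ℝ ∞ W := by
    refine contDiff_of_contDiffOn_of_eq_zero hP.isOpen hKc.isClosed (hKT.trans hTS) ?_ hW0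
    exact ((Complex.ofRealCLM.contDiff.comp hθ).contDiffOn.mul hφS).congr
      fun z hz => indicator_of_mem hz _
  have hWc : HasCompactSupport W := HasCompactSupport.intro hKc hW0
  have hWK : tsupport W ⊆ K :=
    closure_minimal (fun z hz => by_contra fun h => hz (hW0 z h)) hKc.isClosed
  have hdW : ∀ z, ENNReal.ofReal (z 0 ^ (a + 2) * ‖fderiv ℝ W z e‖ ^ 2) ≤
      T.indicator (fun z => ENNReal.ofReal (2 * (A ^ 2 + 1) / c) *
        (ENNReal.ofReal √(M.pullGram Φ z).det *
          ENNReal.ofReal (‖φ (Φ z)‖ ^ 2 + M.normSq (Φ z) (M.grad φ (Φ z))))) z := by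
    intro z
    by_cases hzT : z ∈ T
    · rw [indicator_of_mem hzT]
      have hzS := hTS hzT
      have hφd := hφ.1.mdifferentiable (by simp) (Φ z)
      have hev : W =ᶠ[𝓝 z] fun z => (θ z : ℂ) * (φ ∘ Φ) z := by
        filter_upwards [hP.isOpen.mem_nhds hzS] with y hy
        exact indicator_of_mem hy _
      have hθd : HasFDerivAt (fun z => (θ z : ℂ)) (Complex.ofRealCLM.comp (fderiv ℝ θ z)) z :=
        Complex.ofRealCLM.hasFDerivAt.comp z (hθ.differentiable (by simp) z).hasFDerivAt
      have hfd : fderiv ℝ W z e =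
          (θ z : ℂ) * fderiv ℝ (φ ∘ Φ) z e + φ (Φ z) * (fderiv ℝ θ z e : ℝ) := by
        rw [hev.fderiv_eq, (hθd.fun_mul ((hφS.contDiffAt
          (hP.isOpen.mem_nhds hzS)).differentiableAt (by simp)).hasFDerivAt).fderiv]
        simp
      have hdφ := M.norm_fderiv_comp_param_sq_le hP hzS hφd 0
      rw [M.pullGram_collarParam_zero hzS, if_pos rfl, mul_one] at hdφ
      have hN := M.normSq_nonneg (hP.mapsTo hzS) (M.grad φ (Φ z))
      set N := M.normSq (Φ z) (M.grad φ (Φ z))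
      have hnorm : ‖fderiv ℝ W z e‖ ≤ ‖fderiv ℝ (φ ∘ Φ) z e‖ + A * ‖φ (Φ z)‖ := by
        rw [hfd]
        refine (norm_add_le _ _).trans ?_
        rw [norm_mul, norm_mul, Complex.norm_real, Complex.norm_real, mul_comm A]
        refine add_le_add (mul_le_of_le_one_left (norm_nonneg _) (hθ1 z))
          (mul_le_mul_of_nonneg_left (hθA z) (norm_nonneg _))
      have hsq : ‖fderiv ℝ W z e‖ ^ 2 ≤ 2 * (A ^ 2 + 1) * (‖φ (Φ z)‖ ^ 2 + N) := by
        have h1 := pow_le_pow_left₀ (norm_nonneg _) hnorm 2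
        have h2 : (‖fderiv ℝ (φ ∘ Φ) z e‖ + A * ‖φ (Φ z)‖) ^ 2 ≤
            2 * ‖fderiv ℝ (φ ∘ Φ) z e‖ ^ 2 + 2 * (A ^ 2 * ‖φ (Φ z)‖ ^ 2) := by
          nlinarith [sq_nonneg (‖fderiv ℝ (φ ∘ Φ) z e‖ - A * ‖φ (Φ z)‖)]
        have h3 := mul_nonneg (sq_nonneg A) hN
        have h4 := sq_nonneg ‖φ (Φ z)‖
        linarith
      have hx := hzT.1.1
      have hx1 : z 0 ≤ 1 := hzT.1.2.trans (by norm_num)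
      -- Here `γ > -1` is used again: `a + 2 = 2γ + 2 + n ≥ n` and `x ≤ 1`, so the weight on the
      -- derivative is dominated by the density.
      have hpow : z 0 ^ (a + 2) ≤ z 0 ^ n := by
        rw [← Real.rpow_natCast (z 0) n]
        exact Real.rpow_le_rpow_of_exponent_ge hx hx1 (by linarith)
      have hD := (hbd z hzT.1 hzT.2).1
      set D := √(M.pullGram Φ z).det
      rw [← ENNReal.ofReal_mul (Real.sqrt_nonneg _), ← ENNReal.ofReal_mul (by positivity)]
      refine ENNReal.ofReal_le_ofReal ?_
      have hpD : z 0 ^ n ≤ D / c := by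
        rw [le_div_iff₀ hc]
        linarith
      calc z 0 ^ (a + 2) * ‖fderiv ℝ W z e‖ ^ 2
          ≤ D / c * (2 * (A ^ 2 + 1) * (‖φ (Φ z)‖ ^ 2 + N)) :=
            mul_le_mul (hpow.trans hpD) hsq (sq_nonneg _) (by positivity)
        _ = 2 * (A ^ 2 + 1) / c * (D * (‖φ (Φ z)‖ ^ 2 + N)) := by ring
    · have : fderiv ℝ W z e = 0 := by
        rw [(notMem_tsupport_iff_eventuallyEq.1 fun h => hzT (hKT (hWK h))).fderiv_eq]
        simp
      rw [indicator_of_notMem hzT, this]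
      simp
  calc ∫⁻ p in Φ '' T', ENNReal.ofReal (M.radial p ^ (2 * γ) * ‖φ p‖ ^ 2) ∂M.riemMeasure
      = ∫⁻ z in T', ENNReal.ofReal √(M.pullGram Φ z).det *
          ENNReal.ofReal (M.radial (Φ z) ^ (2 * γ) * ‖φ (Φ z)‖ ^ 2) :=
        hP.setLIntegral_image M hTm' (hTT.trans hTS) hm1
    _ ≤ ∫⁻ z in T', ENNReal.ofReal C * ENNReal.ofReal (z 0 ^ a * ‖W z‖ ^ 2) := by
        refine setLIntegral_mono' hTm' fun z hz => ?_
        have hzS := hTS (hTT hz)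
        have hx : 0 < z 0 := hz.1.1
        have h1 := (hbd z (hTT hz).1 (hTT hz).2).2
        rw [← ENNReal.ofReal_mul (Real.sqrt_nonneg _), ← ENNReal.ofReal_mul hC.le, hrad z hzS, hW,
          indicator_of_mem hzS, hθone z hz, Complex.ofReal_one, one_mul]
        refine ENNReal.ofReal_le_ofReal ?_
        have h2 : z 0 ^ a = z 0 ^ n * z 0 ^ (2 * γ) := by
          rw [ha, Real.rpow_add hx, Real.rpow_natCast, mul_comm]
        rw [h2]
        have h3 : 0 ≤ z 0 ^ (2 * γ) * ‖φ (Φ z)‖ ^ 2 := by positivity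
        calc _ ≤ C * z 0 ^ n * (z 0 ^ (2 * γ) * ‖φ (Φ z)‖ ^ 2) :=
              mul_le_mul_of_nonneg_right h1 h3
          _ = _ := by ring
    _ ≤ ∫⁻ z, ENNReal.ofReal C * ENNReal.ofReal (z 0 ^ a * ‖W z‖ ^ 2) :=
        setLIntegral_le_lintegral _ _
    _ = ENNReal.ofReal C * ∫⁻ z, ENNReal.ofReal (z 0 ^ a * ‖W z‖ ^ 2) :=
        lintegral_const_mul' _ _ ENNReal.ofReal_ne_top
    _ ≤ ENNReal.ofReal C * (ENNReal.ofReal (4 / (a + 1) ^ 2) *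
          ∫⁻ z, ENNReal.ofReal (z 0 ^ (a + 2) * ‖fderiv ℝ W z e‖ ^ 2)) :=
        mul_le_mul_right (lintegral_hardy hWs hWc (fun z hz => (hKT (hWK hz)).1.1) ha1) _
    _ ≤ ENNReal.ofReal C * (ENNReal.ofReal (4 / (a + 1) ^ 2) *
          (ENNReal.ofReal (2 * (A ^ 2 + 1) / c) * M.energy φ)) := by
        refine mul_le_mul_right (mul_le_mul_right ?_ _) _
        refine (lintegral_mono hdW).trans ?_
        rw [lintegral_indicator hTm, lintegral_const_mul' _ _ ENNReal.ofReal_ne_top,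
          ← hP.setLIntegral_image M hTm hTS hm2]
        exact mul_le_mul_right (setLIntegral_le_lintegral _ _) _
    _ = _ := by
        rw [ENNReal.ofReal_mul (by positivity), ENNReal.ofReal_mul hC.le]
        ring

/-- Hardy's inequality near the tip: for `γ > -1`, multiplication by `x^γ` is bounded from `H¹`
to `L²`. -/
lemma exists_hardy (M : ConicManifold n B Y) (hn : 1 ≤ n) {γ : ℝ} (hγ : -1 < γ) :
    ∃ C : ℝ≥0∞, C ≠ ⊤ ∧ ∀ φ, M.IsTest φ →
      ∫⁻ p, ENNReal.ofReal (M.radial p ^ (2 * γ) * ‖φ p‖ ^ 2) ∂M.riemMeasure ≤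
        C * M.energy φ := by
  obtain ⟨t, r, hr, ht⟩ := exists_collar_cover (Y := Y) n
  choose C hC using fun y => M.exists_hardy_collarParam hn hγ y (hr y).1 (hr y).2
  refine ⟨∑ y ∈ t, ENNReal.ofReal (C y) + ENNReal.ofReal ((1 / 4) ^ (2 * γ) + 1), by simp,
    fun φ hφ => ?_⟩
  set f : B → ℝ≥0∞ := fun p => ENNReal.ofReal (M.radial p ^ (2 * γ) * ‖φ p‖ ^ 2) with hf
  have hm : MeasurableSet {p | M.radial p ≤ 1 / 4} :=
    (isClosed_le M.continuous_radial continuous_const).measurableSet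
  have hsub : {p | M.radial p ≤ 1 / 4} ≤ᵐ[M.riemMeasure] ⋃ y ∈ t, M.collarParam y ''
      slab (1 / 4) (Metric.ball (extChartAt (𝓡 n) y y) (r y / 2)) := by
    filter_upwards [M.ae_mem_interior] with p hp hps
    obtain ⟨y₀, h0, h1⟩ := M.exists_mem_image_slab ht (by norm_num) hp hps
    exact mem_iUnion₂.2 ⟨y₀, h0, h1⟩
  have h1 : ∫⁻ p in {p | M.radial p ≤ 1 / 4}, f p ∂M.riemMeasure ≤
      (∑ y ∈ t, ENNReal.ofReal (C y)) * M.energy φ := by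
    refine (lintegral_mono_set' hsub).trans ?_
    rw [← iUnion_subtype (· ∈ t) fun y => M.collarParam y.1 ''
      slab (1 / 4) (Metric.ball (extChartAt (𝓡 n) y.1 y.1) (r y.1 / 2))]
    refine (lintegral_iUnion_le _ f).trans ?_
    rw [tsum_fintype, Finset.sum_mul,
      ← Finset.sum_coe_sort t fun y => ENNReal.ofReal (C y) * M.energy φ]
    exact Finset.sum_le_sum fun y _ => hC y φ hφ
  have h2 : ∫⁻ p in {p | M.radial p ≤ 1 / 4}ᶜ, f p ∂M.riemMeasure ≤
      ENNReal.ofReal ((1 / 4) ^ (2 * γ) + 1) * M.energy φ := by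
    rw [energy, ← lintegral_const_mul' _ _ ENNReal.ofReal_ne_top]
    refine (setLIntegral_mono_ae' hm.compl (g := fun p => ENNReal.ofReal ((1 / 4) ^ (2 * γ) + 1) *
      ENNReal.ofReal (‖φ p‖ ^ 2 + M.normSq p (M.grad φ p))) ?_).trans
      (setLIntegral_le_lintegral _ _)
    filter_upwards [M.ae_mem_interior] with p hp hps
    have hx : 1 / 4 < M.radial p := not_le.1 hps
    have hx1 := M.radial_le_one p
    have hN := M.normSq_nonneg hp (M.grad φ p)
    rw [hf, ← ENNReal.ofReal_mul (by positivity)]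
    refine ENNReal.ofReal_le_ofReal ?_
    -- Away from the tip the weight is bounded: by `1` if `γ ≥ 0`, by its value at `1/4` if `γ ≤ 0`;
    -- the sum serves both cases.
    have hpow : M.radial p ^ (2 * γ) ≤ (1 / 4) ^ (2 * γ) + 1 := by
      have h0 : 0 < M.radial p := lt_trans (by norm_num) hx
      rcases le_total 0 γ with h | h
      · have := Real.rpow_le_one h0.le hx1 (by linarith : 0 ≤ 2 * γ)
        have h' : (0 : ℝ) ≤ (1 / 4) ^ (2 * γ) := by positivity
        linarith
      · have := Real.rpow_le_rpow_of_nonpos (by norm_num : (0 : ℝ) < 1 / 4) hx.le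
          (by linarith : 2 * γ ≤ 0)
        linarith
    exact mul_le_mul hpow (by linarith) (sq_nonneg _) (by positivity)
  rw [← lintegral_add_compl f hm, add_mul]
  exact add_le_add h1 h2

end Hardy

/-! ### The constant function belongs to `H¹` -/

section One

/-- A smooth step in `2 + log x / k`, which runs from `0` to `1` as `x` goes from `e^{-2k}` to
`e^{-k}`. The chain rule gives the slope `O(1/(kx))`, with a constant independent of `k`. -/
lemma exists_log_cutoff : ∃ C : ℝ, 0 ≤ C ∧ ∀ k : ℕ, 1 ≤ k → ∃ F : ℝ → ℝ, ContDiff ℝ ∞ F ∧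
    (∀ x, 0 ≤ F x) ∧ (∀ x, F x ≤ 1) ∧ (∀ x, x < Real.exp (-(2 * k)) → F x = 0) ∧
    (∀ x, Real.exp (-k) < x → F x = 1) ∧
    ∀ x ∈ Icc (Real.exp (-(2 * k))) (Real.exp (-k)), |deriv F x| ≤ C / (k * x) := by
  have hS : ContDiff ℝ ∞ Real.smoothTransition := Real.smoothTransition.contDiff
  obtain ⟨C, hC⟩ := isCompact_Icc.exists_bound_of_continuousOn (s := Icc (0 : ℝ) 1)
    (hS.continuous_deriv (by simp)).continuousOn
  refine ⟨|C|, abs_nonneg C, fun k hk => ?_⟩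
  have hk0 : (0 : ℝ) < k := by exact_mod_cast hk
  set G : ℝ → ℝ := fun x => Real.smoothTransition (2 + Real.log x / k) with hG
  set F : ℝ → ℝ := (Ioi (0 : ℝ)).indicator G with hF
  have h0 : ∀ x, x < Real.exp (-(2 * k)) → F x = 0 := by
    intro x hx
    by_cases hx0 : x ∈ Ioi (0 : ℝ)
    · rw [hF, indicator_of_mem hx0]
      refine Real.smoothTransition.zero_of_nonpos ?_
      have h1 : Real.log x < -(2 * k) := (Real.log_lt_iff_lt_exp hx0).2 hx
      have h2 : Real.log x / k ≤ -2 := by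
        rw [div_le_iff₀ hk0]
        linarith
      linarith
    · exact indicator_of_notMem hx0 _
  have hFG : ∀ x, 0 < x → F x = G x := fun x hx => indicator_of_mem (mem_Ioi.2 hx) _
  have hFs : ContDiff ℝ ∞ F := by
    refine contDiff_of_contDiffOn_of_eq_zero (U := Ioi 0) (T := Ici (Real.exp (-(2 * k)))) isOpen_Ioi
      isClosed_Ici (fun x hx => (Real.exp_pos _).trans_le hx) ?_ fun x hx => h0 x (not_le.1 hx)
    refine ContDiffOn.congr ?_ fun x hx => hFG x hx
    exact hS.comp_contDiffOn (contDiffOn_const.add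
      ((contDiffOn_id.log fun x hx => (ne_of_gt hx)).div_const _))
  refine ⟨F, hFs, fun x => indicator_nonneg (fun x _ => Real.smoothTransition.nonneg _) x,
    fun x => indicator_le' (f := G) (g := fun _ => 1) (fun x _ => Real.smoothTransition.le_one _)
      (fun _ _ => zero_le_one) x, h0, fun x hx => ?_, fun x hx => ?_⟩
  · have hx0 : 0 < x := (Real.exp_pos _).trans hx
    rw [hFG x hx0]
    refine Real.smoothTransition.one_of_one_le ?_
    have h1 : -(k : ℝ) < Real.log x := (Real.lt_log_iff_exp_lt hx0).2 hx
    have h2 : -1 ≤ Real.log x / k := by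
      rw [le_div_iff₀ hk0]
      linarith
    linarith
  · have hx0 : 0 < x := (Real.exp_pos _).trans_le hx.1
    have hev : F =ᶠ[𝓝 x] G := by
      filter_upwards [lt_mem_nhds hx0] with y hy
      exact hFG y hy
    have hd : HasDerivAt G (deriv Real.smoothTransition (2 + Real.log x / k) * (x⁻¹ / k)) x :=
      ((hS.differentiable (by simp) _).hasDerivAt).comp x
        (((Real.hasDerivAt_log hx0.ne').div_const _).const_add 2)
    have h1 : -(2 * (k : ℝ)) ≤ Real.log x := (Real.le_log_iff_exp_le hx0).2 hx.1
    have h2 : Real.log x ≤ -k := (Real.log_le_iff_le_exp hx0).2 hx.2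
    have h3 := hC (2 + Real.log x / k) ⟨by
      have : -2 ≤ Real.log x / k := by
        rw [le_div_iff₀ hk0]
        linarith
      linarith, by
      have : Real.log x / k ≤ -1 := by
        rw [div_le_iff₀ hk0]
        linarith
      linarith⟩
    rw [hev.deriv_eq, hd.deriv, abs_mul, abs_of_pos (by positivity : 0 < x⁻¹ / k)]
    calc _ ≤ |C| * (x⁻¹ / k) :=
          mul_le_mul_of_nonneg_right (h3.trans (le_abs_self C)) (by positivity)
      _ = |C| / (k * x) := by
          field_simp

lemma grad_of_eventuallyEq_const (M : ConicManifold n B Y) {φ : B → ℂ} {p : B} {c : ℂ}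
    (h : φ =ᶠ[𝓝 p] fun _ => c) : M.grad φ p = 0 := by
  have : differential (n := n) φ p = 0 := by
    ext j
    rw [differential, h.mfderiv_eq, mfderiv_const]
    rfl
  rw [grad_eq_mulVec, this, Matrix.mulVec_zero]

lemma normSq_zero (M : ConicManifold n B Y) (p : B) : M.normSq p 0 = 0 := by
  simp [normSq, inner]

variable [T2Space B] [CompactSpace Y]

/-- On the collar `|∇x| = 1`, because the first row of the metric, and hence `g^{00}`, is that of
the identity. -/
lemma normSq_grad_comp_radial (M : ConicManifold n B Y) {F : ℝ → ℝ} (hF : ContDiff ℝ ∞ F) {a : ℝ}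
    (ha : a < 1) (hFa : ∀ x, a < x → F x = 1) {p : B} (hp : p ∈ (𝓡∂ (n + 1)).interior B)
    (hp1 : M.radial p < 1) :
    M.normSq p (M.grad (fun q => (F (M.radial q) : ℂ)) p) = deriv F (M.radial p) ^ 2 := by
  have hφ : ContMDiff (𝓡∂ (n + 1)) 𝓘(ℝ, ℂ) ∞ fun q => (F (M.radial q) : ℂ) :=
    M.contMDiff_comp_radial (F := fun x => (F x : ℂ)) (Complex.ofRealCLM.contDiff.comp hF) ha
      fun x hx => by rw [hFa x hx, Complex.ofReal_one]
  have hd := hφ.mdifferentiable (by simp) p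
  rw [M.normSq_grad_eq hφ]
  simp only [RCLike.star_def, Complex.conj_ofReal]
  have hpt := M.mem_target_of_radial_lt hp1
  rw [← M.radial_pos_iff] at hp
  -- `y₀` is made a free variable so that `p` can be eliminated in favour of its coordinates `z`.
  obtain ⟨y₀, hy₀⟩ : ∃ y, y = (M.collar.symm p).2 := ⟨_, rfl⟩
  obtain ⟨z, hz, rfl⟩ : ∃ z ∈ collarDomain (n := n) y₀, M.collarParam y₀ z = p := by
    rw [M.radial_of_mem hpt] at hp hp1
    refine ⟨consEquiv n ((M.collar.symm p).1, extChartAt (𝓡 n) y₀ (M.collar.symm p).2),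
      ⟨⟨hp, hp1⟩, ?_⟩, ?_⟩
    · change extChartAt (𝓡 n) y₀ (M.collar.symm p).2 ∈ _
      rw [← hy₀]
      exact mem_extChartAt_target y₀
    · have hq : collarCoord y₀ (consEquiv n ((M.collar.symm p).1,
          extChartAt (𝓡 n) y₀ (M.collar.symm p).2)) = M.collar.symm p :=
        Prod.ext rfl ((extChartAt (𝓡 n) y₀).left_inv (by rw [← hy₀]; exact mem_extChartAt_source y₀))
      rw [collarParam, hq, M.collar.right_inv hpt]
  have hP := M.isParam_collar y₀
  have hrad : ∀ w ∈ collarDomain (n := n) y₀, M.radial (M.collarParam y₀ w) = w 0 := fun w hw =>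
    M.radial_collar (M.collarCoord_mem_source hw)
  rw [hP.inner_grad_grad M hz hd hd, hrad z hz]
  have hev : (fun q => (F (M.radial q) : ℂ)) ∘ M.collarParam y₀ =ᶠ[𝓝 z]
      fun w : EuclideanSpace ℝ (Fin (n + 1)) => (F (w 0) : ℂ) := by
    filter_upwards [hP.isOpen.mem_nhds hz] with w hw
    simp [hrad w hw]
  have hder : HasFDerivAt (fun w : EuclideanSpace ℝ (Fin (n + 1)) => (F (w 0) : ℂ))
      (Complex.ofRealCLM.comp ((deriv F (z 0)) •
        (EuclideanSpace.proj 0 : EuclideanSpace ℝ (Fin (n + 1)) →L[ℝ] ℝ))) z :=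
    Complex.ofRealCLM.hasFDerivAt.comp z
      (((hF.differentiable (by simp) (z 0)).hasDerivAt).comp_hasFDerivAt z
        (EuclideanSpace.proj 0 : EuclideanSpace ℝ (Fin (n + 1)) →L[ℝ] ℝ).hasFDerivAt)
  have hj : ∀ j, fderiv ℝ ((fun q => (F (M.radial q) : ℂ)) ∘ M.collarParam y₀) z
      (EuclideanSpace.single j 1) = if j = 0 then ((deriv F (z 0) : ℝ) : ℂ) else 0 := by
    intro j
    rw [hev.fderiv_eq, hder.fderiv]
    by_cases h : j = 0
    · simp [h]
    · simp [h, Ne.symm h]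
  have h00 : (M.pullGram (M.collarParam y₀) z)⁻¹ 0 0 = 1 := by
    have h1 := congrFun (congrFun (Matrix.mul_nonsing_inv _
      ((hP.pullGram_posDef M hz).det_pos.ne'.isUnit)) 0) 0
    rw [Matrix.mul_apply] at h1
    simpa [M.pullGram_collarParam_zero hz] using h1
  simp only [hj]
  simp [h00, sq]

variable [MeasurableSpace B] [BorelSpace B] [CompactSpace B]

/-- The tip has zero capacity. On the layer `e^{-(j+1)} ≤ x ≤ e^{-j}` the squared gradient of the
cutoff is `O(e^{2j}/K²)` and the volume is `O(e^{-2j})`. Each of the `K` layers contributes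
`O(1/K²)`, in total `O(1/K)`. -/
lemma hasH1Gradient_one (M : ConicManifold n B Y) (hn : 1 ≤ n) :
    M.HasH1Gradient (fun _ => 1) (fun _ => 0) := by
  refine ⟨aestronglyMeasurable_const, fun ψ _ => ?_, ?_⟩
  · simp only [M.inner_zero_right]
    exact aestronglyMeasurable_const
  obtain ⟨A, hA, hA'⟩ := exists_log_cutoff
  -- The shift to `k + 1` avoids division by zero and ensures `e^{-(k+1)} ≤ 1/2`, the range of the
  -- volume estimate.
  choose F hFs hF0 hF1 hFz hFo hFd using fun k : ℕ => hA' (k + 1) (by omega)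
  obtain ⟨C, hC, hμ⟩ := M.exists_measure_radial_le hn
  have hexp : ∀ k : ℕ, Real.exp (-((k + 1 : ℕ) : ℝ)) ≤ 1 / 2 := by
    intro k
    have h1 : Real.exp (-((k + 1 : ℕ) : ℝ)) ≤ Real.exp (-1) :=
      Real.exp_le_exp.2 (by push_cast; linarith [(Nat.cast_nonneg k : (0 : ℝ) ≤ k)])
    refine h1.trans ?_
    rw [Real.exp_neg, inv_le_comm₀ (Real.exp_pos _) (by norm_num)]
    linarith [Real.add_one_le_exp 1]
  have hsm : ∀ k, ContMDiff (𝓡∂ (n + 1)) 𝓘(ℝ, ℂ) ∞ fun p => (F k (M.radial p) : ℂ) := fun k =>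
    M.contMDiff_comp_radial (F := fun x => (F k x : ℂ)) (Complex.ofRealCLM.contDiff.comp (hFs k))
      ((hexp k).trans_lt (by norm_num)) fun x hx => by rw [hFo k x hx, Complex.ofReal_one]
  refine ⟨fun k p => (F k (M.radial p) : ℂ), fun k => ⟨hsm k, ?_, ?_⟩, ?_, ?_⟩
  · exact HasCompactSupport.of_compactSpace _
  · have hcl : IsClosed {p | Real.exp (-(2 * ((k + 1 : ℕ) : ℝ))) ≤ M.radial p} :=
      isClosed_le continuous_const M.continuous_radial
    refine (closure_minimal (fun p hp => ?_) hcl).trans fun p hp =>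
      (M.radial_pos_iff p).1 ((Real.exp_pos _).trans_le hp)
    by_contra h
    exact hp (by simp [hFz k _ (not_le.1 h)])
  · have hlim : Tendsto (fun k : ℕ => ENNReal.ofReal (C * Real.exp (-((k + 1 : ℕ) : ℝ)) ^ 2))
        atTop (𝓝 0) := by
      have h1 : Tendsto (fun k : ℕ => Real.exp (-((k + 1 : ℕ) : ℝ))) atTop (𝓝 0) :=
        Real.tendsto_exp_neg_atTop_nhds_zero.comp
          (tendsto_natCast_atTop_atTop.comp (tendsto_add_atTop_nat 1))
      have h2 := ENNReal.tendsto_ofReal ((h1.pow 2).const_mul C)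
      simpa using h2
    refine tendsto_of_tendsto_of_tendsto_of_le_of_le tendsto_const_nhds hlim (fun _ => zero_le)
      fun k => ?_
    refine le_trans ?_ (hμ _ ⟨Real.exp_pos _, hexp k⟩)
    have hm : MeasurableSet {p | M.radial p ≤ Real.exp (-((k + 1 : ℕ) : ℝ))} :=
      (isClosed_le M.continuous_radial continuous_const).measurableSet
    rw [← lintegral_indicator_one hm]
    refine lintegral_mono fun p => ?_
    by_cases hp : M.radial p ≤ Real.exp (-((k + 1 : ℕ) : ℝ))
    · rw [indicator_of_mem (by exact hp), Pi.one_apply, ← ENNReal.ofReal_one]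
      refine ENNReal.ofReal_le_ofReal ?_
      rw [← Complex.ofReal_one, ← Complex.ofReal_sub, Complex.norm_real, Real.norm_eq_abs, sq_abs]
      nlinarith [hF0 k (M.radial p), hF1 k (M.radial p)]
    · simp [hFo k _ (not_le.1 hp)]
  · simp only [sub_zero]
    have hlim : Tendsto (fun k : ℕ => ENNReal.ofReal
        (A ^ 2 * Real.exp 2 * C / ((k + 1 : ℕ) : ℝ))) atTop (𝓝 0) := by
      have h1 := (tendsto_const_div_atTop_nhds_zero_nat (A ^ 2 * Real.exp 2 * C)).comp
        (tendsto_add_atTop_nat 1)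
      have h2 := ENNReal.tendsto_ofReal h1
      simpa using h2
    refine tendsto_of_tendsto_of_tendsto_of_le_of_le tendsto_const_nhds hlim (fun _ => zero_le)
      fun k => ?_
    set K : ℕ := k + 1 with hK
    have hK0 : (0 : ℝ) < K := by rw [hK]; positivity
    set s : ℕ → ℝ := fun j => Real.exp (-(j : ℝ)) with hs
    have hm : ∀ j, MeasurableSet {p | M.radial p ≤ s j} := fun j =>
      (isClosed_le M.continuous_radial continuous_const).measurableSet
    -- Bound for `(A/(Kx))²` on the `j`-th layer, where `1/x ≤ e^{j+1}`. The layer is then enlarged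
    -- to the sublevel set `{x ≤ e^{-j}}`, whose volume is known.
    set c : ℕ → ℝ := fun j => A ^ 2 / K ^ 2 * Real.exp (2 * (j + 1)) with hc
    have hae : ∀ᵐ p ∂M.riemMeasure,
        ENNReal.ofReal (M.normSq p (M.grad (fun p => (F k (M.radial p) : ℂ)) p)) ≤
          ∑ j ∈ Finset.Ico K (2 * K), {p | M.radial p ≤ s j}.indicator
            (fun _ => ENNReal.ofReal (c j)) p := by
      filter_upwards [M.ae_mem_interior] with p hp
      have hx0 := (M.radial_pos_iff p).2 hp
      by_cases h1 : M.radial p < Real.exp (-(2 * (K : ℝ)))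
      · rw [M.grad_of_eventuallyEq_const (c := 0), M.normSq_zero]
        · simp
        filter_upwards [M.continuous_radial.continuousAt.eventually_lt_const h1] with q hq
        simp [hFz k _ hq]
      by_cases h2 : Real.exp (-(K : ℝ)) < M.radial p
      · rw [M.grad_of_eventuallyEq_const (c := 1), M.normSq_zero]
        · simp
        filter_upwards [M.continuous_radial.continuousAt.eventually_const_lt h2] with q hq
        simp [hFo k _ hq]
      rw [not_lt] at h1 h2
      have hlt : Real.exp (-(K : ℝ)) < 1 := (hexp k).trans_lt (by norm_num)
      rw [M.normSq_grad_comp_radial (hFs k) hlt (hFo k) hp (h2.trans_lt hlt)]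
      have hd := hFd k _ ⟨h1, h2⟩
      set x := M.radial p with hx
      have hl1 : -(2 * (K : ℝ)) ≤ Real.log x := (Real.le_log_iff_exp_le hx0).2 h1
      have hl2 : Real.log x ≤ -K := (Real.log_le_iff_le_exp hx0).2 h2
      obtain ⟨j, hj, hxj, hjx⟩ : ∃ j ∈ Finset.Ico K (2 * K), x ≤ s j ∧ s (j + 1) ≤ x := by
        -- The layer is found by rounding down `-log x`. At the endpoint `x = e^{-2K}` this would
        -- give the excluded index `2K`, so the preceding layer is taken.
        by_cases hend : Real.log x = -(2 * (K : ℝ))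
        · refine ⟨2 * K - 1, Finset.mem_Ico.2 ⟨by omega, by omega⟩, ?_, ?_⟩
          · rw [← Real.log_le_iff_le_exp hx0, hend, Nat.cast_sub (by omega)]
            push_cast
            linarith
          · rw [← Real.le_log_iff_exp_le hx0, hend, Nat.sub_add_cancel (by omega)]
            push_cast
            linarith
        · have hlt2 : -Real.log x < 2 * K := by
            rcases hl1.lt_or_eq with h | h
            · linarith
            · exact absurd h.symm hend
          have hnn : 0 ≤ -Real.log x := by linarith
          refine ⟨⌊-Real.log x⌋₊, Finset.mem_Ico.2 ⟨?_, ?_⟩, ?_, ?_⟩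
          · exact Nat.le_floor (by linarith)
          · rw [Nat.floor_lt hnn]
            push_cast
            exact hlt2
          · rw [← Real.log_le_iff_le_exp hx0]
            linarith [Nat.floor_le hnn]
          · rw [← Real.le_log_iff_exp_le hx0]
            push_cast
            linarith [Nat.lt_floor_add_one (-Real.log x)]
      refine le_trans ?_ (Finset.single_le_sum (f := fun j => {p | M.radial p ≤ s j}.indicator
            (fun _ => ENNReal.ofReal (c j)) p) (fun _ _ => zero_le) hj)
      rw [indicator_of_mem (by exact hxj)]
      refine ENNReal.ofReal_le_ofReal ?_
      have hinv : x⁻¹ ≤ Real.exp (j + 1) := by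
        rw [inv_le_comm₀ hx0 (Real.exp_pos _), ← Real.exp_neg]
        simpa [hs] using hjx
      calc deriv (F k) x ^ 2 = |deriv (F k) x| ^ 2 := (sq_abs _).symm
        _ ≤ (A / (K * x)) ^ 2 := pow_le_pow_left₀ (abs_nonneg _) hd 2
        _ = A ^ 2 / K ^ 2 * x⁻¹ ^ 2 := by field_simp
        _ ≤ A ^ 2 / K ^ 2 * Real.exp (j + 1) ^ 2 :=
          mul_le_mul_of_nonneg_left (pow_le_pow_left₀ (by positivity) hinv 2) (by positivity)
        _ = c j := by
          rw [hc, ← Real.exp_nat_mul]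
          push_cast
          rfl
    refine (lintegral_mono_ae hae).trans ?_
    rw [lintegral_finsetSum _ fun j _ => measurable_const.indicator (hm j)]
    calc _ ≤ ∑ j ∈ Finset.Ico K (2 * K), ENNReal.ofReal (A ^ 2 * Real.exp 2 * C / K ^ 2) := by
          refine Finset.sum_le_sum fun j hj => ?_
          rw [lintegral_indicator (hm j), setLIntegral_const]
          have hj1 : 1 ≤ j := by have := (Finset.mem_Ico.1 hj).1; omega
          obtain ⟨i, rfl⟩ : ∃ i, j = i + 1 := ⟨j - 1, by omega⟩
          refine (mul_le_mul_right (hμ _ ⟨Real.exp_pos _, hexp i⟩) _).trans (le_of_eq ?_)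
          rw [← ENNReal.ofReal_mul (by positivity)]
          congr 1
          have : Real.exp (2 * (((i + 1 : ℕ) : ℝ) + 1)) * Real.exp (-((i + 1 : ℕ) : ℝ)) ^ 2 =
              Real.exp 2 := by
            rw [← Real.exp_nat_mul, ← Real.exp_add]
            congr 1
            push_cast
            ring
          rw [← this, hc]
          ring
      _ = ENNReal.ofReal (A ^ 2 * Real.exp 2 * C / K) := by
          rw [Finset.sum_const, Nat.card_Ico, nsmul_eq_mul, ← ENNReal.ofReal_natCast,
            ← ENNReal.ofReal_mul (by positivity)]
          congr 1
          rw [show 2 * K - K = K by omega]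
          field_simp

end One

/-! ### Measurability of vector fields -/

section Fields

/-- With `D` the matrix of the differentials and `A` the Gram matrix of `g`, the frame has Gram
matrix `H = D A⁻¹ Dᵀ`. If it is nonsingular, `Dᵀ H⁻¹ D = A`, which recovers the metric from pairings
with the frame. -/
lemma inner_eq_of_frame (M : ConicManifold n B Y) {p : B} (hp : p ∈ (𝓡∂ (n + 1)).interior B)
    {ψ : Fin (n + 1) → B → ℂ} {H : Matrix (Fin (n + 1)) (Fin (n + 1)) ℂ}
    (hH : H = Matrix.of fun a b => M.inner p (M.grad (ψ a) p) (M.grad (ψ b) p))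
    (hdet : H.det ≠ 0) (X Z : Fin (n + 1) → ℂ) :
    M.inner p X Z = ∑ a, ∑ b, H⁻¹ a b * (M.inner p (M.grad (ψ a) p) X *
      M.inner p (M.grad (ψ b) p) Z) := by
  set D : Matrix (Fin (n + 1)) (Fin (n + 1)) ℂ := Matrix.of fun a => differential (ψ a) p with hD
  set A := (M.gram p).map Complex.ofReal with hA
  have ht : ∀ W : Fin (n + 1) → ℂ, (fun a => M.inner p (M.grad (ψ a) p) W) = D *ᵥ W := by
    intro W
    ext a
    exact M.inner_grad_left hp (ψ a) W
  have hAdet : IsUnit A.det := by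
    have : A.det = Complex.ofReal (M.gram p).det := (RingHom.map_det Complex.ofRealHom _).symm
    rw [this]
    exact (Complex.ofReal_ne_zero.2 (M.gram_posDef hp).det_pos.ne').isUnit
  have hH' : H = D * A⁻¹ * Dᵀ := by
    ext a b
    rw [hH, Matrix.of_apply, M.inner_grad_left hp, grad_eq_mulVec, map_ofReal_inv, ← hA,
      Matrix.mul_assoc, Matrix.mul_apply]
    rfl
  have hD0 : IsUnit D.det := by
    refine IsUnit.mk0 _ fun h0 => hdet ?_
    rw [hH', Matrix.det_mul, Matrix.det_mul, h0, zero_mul, zero_mul]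
  have hDt : IsUnit Dᵀ.det := by rwa [Matrix.det_transpose]
  have hkey : Dᵀ * H⁻¹ * D = A := by
    rw [hH', Matrix.mul_inv_rev, Matrix.mul_inv_rev, Matrix.nonsing_inv_nonsing_inv _ hAdet,
      ← Matrix.mul_assoc, Matrix.mul_nonsing_inv _ hDt, Matrix.one_mul, Matrix.mul_assoc,
      Matrix.nonsing_inv_mul _ hD0, Matrix.mul_one]
  have hrhs : ∑ a, ∑ b, H⁻¹ a b * (M.inner p (M.grad (ψ a) p) X *
      M.inner p (M.grad (ψ b) p) Z) = (D *ᵥ X) ⬝ᵥ (H⁻¹ *ᵥ (D *ᵥ Z)) := by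
    rw [← ht X, ← ht Z]
    simp only [dotProduct, Matrix.mulVec, Finset.mul_sum]
    exact Finset.sum_congr rfl fun a _ => Finset.sum_congr rfl fun b _ => by ring
  rw [hrhs, inner_eq_dotProduct, ← hA, ← hkey, ← Matrix.mulVec_mulVec, ← Matrix.mulVec_mulVec,
    Matrix.dotProduct_mulVec X, Matrix.vecMul_transpose]

variable [T2Space B] [CompactSpace B]

/-- Around every interior point there is a frame of gradients of test functions. -/
lemma exists_frame (M : ConicManifold n B Y) {p : B} (hp : p ∈ (𝓡∂ (n + 1)).interior B) :
    ∃ ψ : Fin (n + 1) → B → ℂ, (∀ a, M.IsTest (ψ a)) ∧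
      (Matrix.of fun a b => M.inner p (M.grad (ψ a) p) (M.grad (ψ b) p)).det ≠ 0 := by
  have hpc : p ∈ chartInterior (n := n) p := ⟨mem_extChartAt_source (I := 𝓡∂ (n + 1)) p, hp⟩
  obtain ⟨t, htn, htc, htU⟩ := exists_mem_nhds_isClosed_subset
    ((isOpen_chartInterior (n := n) p).mem_nhds hpc)
  obtain ⟨ρ, hρ1, hρ0, -⟩ := exists_contMDiffMap_one_nhds_of_subset_interior (n := (⊤ : ℕ∞))
    (𝓡∂ (n + 1)) (isClosed_singleton (x := p)) (singleton_subset_iff.2 (mem_interior_iff_mem_nhds.2 htn))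
  rw [nhdsSet_singleton] at hρ1
  set κ := extChartAt (𝓡∂ (n + 1)) p with hκ
  have hP := isParam_chart (n := n) p
  -- Coordinate functions cut off near `p`. Their differentials at `p` are the coordinate covectors,
  -- so their Gram matrix is the transposed inverse metric.
  set ψ : Fin (n + 1) → B → ℂ := fun a q => (ρ q : ℂ) * ((κ q a : ℝ) : ℂ) with hψ
  have hψ0 : ∀ a q, q ∉ t → ψ a q = 0 := fun a q hq => by simp [hψ, hρ0 q hq]
  have hts : ∀ a, tsupport (ψ a) ⊆ t := fun a =>
    closure_minimal (fun q hq => by_contra fun h => hq (hψ0 a q h)) htc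
  have hsm : ∀ a, ContMDiff (𝓡∂ (n + 1)) 𝓘(ℝ, ℂ) ∞ (ψ a) := by
    intro a
    have h1 : ContMDiffOn (𝓡∂ (n + 1)) 𝓘(ℝ, ℂ) ∞ (ψ a) (chartInterior (n := n) p) := by
      have hκs : ContMDiffOn (𝓡∂ (n + 1)) 𝓘(ℝ, EuclideanSpace ℝ (Fin (n + 1))) ∞ κ
          (chartInterior (n := n) p) := (contMDiffOn_extChartAt (x := p)).mono fun q hq => by
            rw [← extChartAt_source (𝓡∂ (n + 1))]; exact hq.1
      have hc : ContDiff ℝ ∞ fun x : ℝ × EuclideanSpace ℝ (Fin (n + 1)) =>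
          (x.1 : ℂ) * ((x.2 a : ℝ) : ℂ) :=
        (Complex.ofRealCLM.contDiff.comp contDiff_fst).mul (Complex.ofRealCLM.contDiff.comp
          ((EuclideanSpace.proj a : EuclideanSpace ℝ (Fin (n + 1)) →L[ℝ] ℝ).contDiff.comp
            contDiff_snd))
      exact hc.contMDiff.comp_contMDiffOn (ρ.contMDiff.contMDiffOn.prodMk_space hκs)
    have h2 : ContMDiffOn (𝓡∂ (n + 1)) 𝓘(ℝ, ℂ) ∞ (ψ a) tᶜ :=
      (contMDiffOn_const (c := (0 : ℂ))).congr fun q hq => hψ0 a q hq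
    refine contMDiff_of_contMDiffOn_union_of_isOpen h1 h2 ?_ (isOpen_chartInterior p)
      htc.isOpen_compl
    exact eq_univ_of_forall fun q => (em (q ∈ t)).imp (fun h => htU h) id
  refine ⟨ψ, fun a => ⟨hsm a, HasCompactSupport.of_compactSpace _,
    (hts a).trans (htU.trans inter_subset_right)⟩, ?_⟩
  have hz : κ p ∈ interior κ.target := (mem_interior_iff hpc.1).1 hp
  have hinv : κ.symm (κ p) = p := κ.left_inv hpc.1
  have hd : ∀ a i, fderiv ℝ (ψ a ∘ κ.symm) (κ p) (EuclideanSpace.single i 1) =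
      if a = i then 1 else 0 := by
    intro a i
    have hev : ψ a ∘ κ.symm =ᶠ[𝓝 (κ p)]
        Complex.ofRealCLM.comp (EuclideanSpace.proj a : EuclideanSpace ℝ (Fin (n + 1)) →L[ℝ] ℝ) := by
      have hcont : Tendsto κ.symm (𝓝 (κ p)) (𝓝 p) := by
        have := (continuousAt_extChartAt_symm (I := 𝓡∂ (n + 1)) p).tendsto
        rwa [extChartAt_to_inv] at this
      filter_upwards [hcont.eventually hρ1, hP.isOpen.mem_nhds hz] with z h1 h2
      simp [hψ, h1, κ.right_inv (interior_subset h2)]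
    rw [hev.fderiv_eq, ContinuousLinearMap.fderiv]
    by_cases h : a = i <;> simp [h]
  have hH : (Matrix.of fun a b => M.inner p (M.grad (ψ a) p) (M.grad (ψ b) p)) =
      ((M.pullGram κ.symm (κ p))⁻¹.map Complex.ofReal)ᵀ := by
    ext a b
    have h := hP.inner_grad_grad M hz (φ := ψ a) (ψ := ψ b)
      ((hsm a).mdifferentiable (by simp) _) ((hsm b).mdifferentiable (by simp) _)
    rw [hinv] at h
    rw [Matrix.of_apply, h, ← hκ]
    simp only [hd]
    simp
  have hdet : ((M.pullGram κ.symm (κ p)).map Complex.ofReal).det =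
      Complex.ofReal (M.pullGram κ.symm (κ p)).det :=
    (RingHom.map_det Complex.ofRealHom _).symm
  rw [hH, Matrix.det_transpose, map_ofReal_inv, Matrix.det_nonsing_inv, hdet, Ring.inverse_eq_inv']
  exact inv_ne_zero (Complex.ofReal_ne_zero.2 (hP.pullGram_posDef M hz).det_pos.ne')

variable [MeasurableSpace B] [BorelSpace B]

/-- Measurability is given only for pairings with gradients of test functions. Near each interior
point a frame of such gradients expresses `⟨X,Z⟩` by these pairings with continuous coefficients,
and countably many neighbourhoods suffice because `B` is second countable. -/
lemma MeasurableField.inner {M : ConicManifold n B Y} {X Z : B → Fin (n + 1) → ℂ}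
    (hX : M.MeasurableField X) (hZ : M.MeasurableField Z) :
    AEStronglyMeasurable (fun p => M.inner p (X p) (Z p)) M.riemMeasure := by
  have : SecondCountableTopology (EuclideanHalfSpace (n + 1)) :=
    inferInstanceAs (SecondCountableTopology {x : EuclideanSpace ℝ (Fin (n + 1)) // 0 ≤ x 0})
  have := ChartedSpace.secondCountable_of_sigmaCompact (EuclideanHalfSpace (n + 1)) B
  choose ψ hψ hdet using fun p : (𝓡∂ (n + 1)).interior B => M.exists_frame p.2
  set H : (𝓡∂ (n + 1)).interior B → B → Matrix (Fin (n + 1)) (Fin (n + 1)) ℂ := fun c p =>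
    Matrix.of fun a b => M.inner p (M.grad (ψ c a) p) (M.grad (ψ c b) p) with hH
  set U : (𝓡∂ (n + 1)).interior B → Set B := fun c =>
    (𝓡∂ (n + 1)).interior B ∩ {p | (H c p).det ≠ 0} with hU
  have hHc : ∀ c, ContinuousOn (H c) ((𝓡∂ (n + 1)).interior B) := fun c =>
    continuousOn_pi.2 fun a => continuousOn_pi.2 fun b =>
      M.continuousOn_inner_grad (hψ c a).1 (hψ c b).1
  have hHd : ∀ c, ContinuousOn (fun p => (H c p).det) ((𝓡∂ (n + 1)).interior B) := fun c =>
    (Continuous.matrix_det continuous_id).comp_continuousOn (hHc c)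
  have hUo : ∀ c, IsOpen (U c) := fun c =>
    (hHd c).isOpen_inter_preimage (isOpen_interior n B) isOpen_ne
  obtain ⟨T, hT, hTU⟩ := TopologicalSpace.isOpen_iUnion_countable U hUo
  have hcov : (⋃ c ∈ T, U c) = (𝓡∂ (n + 1)).interior B := by
    rw [hTU]
    refine Subset.antisymm (iUnion_subset fun c => inter_subset_left) fun p hp => ?_
    exact mem_iUnion.2 ⟨⟨p, hp⟩, hp, hdet ⟨p, hp⟩⟩
  rw [← Measure.restrict_eq_self_of_ae_mem M.ae_mem_interior, ← hcov, biUnion_eq_iUnion]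
  have := hT.to_subtype
  refine aestronglyMeasurable_iUnion_iff.2 fun c => ?_
  have hUi : U c ⊆ (𝓡∂ (n + 1)).interior B := inter_subset_left
  have hi : ∀ a b, ContinuousOn (fun p => (H c p)⁻¹ a b) (U c) := by
    intro a b
    simp only [Matrix.inv_def, Ring.inverse_eq_inv', Matrix.smul_apply, smul_eq_mul]
    refine ((hHd c).mono hUi).inv₀ (fun p hp => hp.2) |>.mul ?_
    exact ((Continuous.matrix_elem (Continuous.matrix_adjugate continuous_id) a b).comp_continuousOn
      ((hHc c).mono hUi))
  have hm : AEStronglyMeasurable (fun p => ∑ a, ∑ b, (H c p)⁻¹ a b *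
      (M.inner p (M.grad (ψ c a) p) (X p) * M.inner p (M.grad (ψ c b) p) (Z p)))
      (M.riemMeasure.restrict (U c)) :=
    Finset.aestronglyMeasurable_fun_sum _ fun a _ => Finset.aestronglyMeasurable_fun_sum _ fun b _ =>
      ((hi a b).aestronglyMeasurable (hUo c).measurableSet).mul
        ((hX _ (hψ c a)).restrict.mul (hZ _ (hψ c b)).restrict)
  refine hm.congr ?_
  filter_upwards [ae_restrict_mem (hUo c).measurableSet] with p hp
  exact (M.inner_eq_of_frame hp.1 rfl hp.2 _ _).symm

lemma MeasurableField.star {M : ConicManifold n B Y} {X : B → Fin (n + 1) → ℂ}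
    (hX : M.MeasurableField X) : M.MeasurableField fun p => star (X p) := by
  intro ψ hψ
  refine (Complex.continuous_conj.comp_aestronglyMeasurable (hX _ (isTest_star hψ))).congr
    (Eventually.of_forall fun p => ?_)
  change Star.star (M.inner p _ _) = _
  rw [← M.inner_star, M.grad_star ψ (hψ.1.mdifferentiable (by simp) p), star_star]

lemma MeasurableField.sub {M : ConicManifold n B Y} {X Z : B → Fin (n + 1) → ℂ}
    (hX : M.MeasurableField X) (hZ : M.MeasurableField Z) :
    M.MeasurableField fun p => X p - Z p := by
  intro ψ hψ
  simp only [inner_sub_right]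
  exact (hX ψ hψ).sub (hZ ψ hψ)

lemma measurableField_grad (M : ConicManifold n B Y) {φ : B → ℂ}
    (hφ : ContMDiff (𝓡∂ (n + 1)) 𝓘(ℝ, ℂ) ∞ φ) : M.MeasurableField (M.grad φ) := fun _ hψ =>
  M.aestronglyMeasurable_of_continuousOn (M.continuousOn_inner_grad hψ.1 hφ)

lemma MeasurableField.normSq {M : ConicManifold n B Y} {X : B → Fin (n + 1) → ℂ}
    (hX : M.MeasurableField X) : AEMeasurable (fun p => M.normSq p (X p)) M.riemMeasure :=
  (Complex.continuous_re.comp_aestronglyMeasurable (hX.inner hX.star)).aemeasurable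

end Fields

/-! ### Passage to the limit in Green's formula -/

section Limits

section Measure

variable {α : Type*} {mα : MeasurableSpace α} {μ : Measure α}

/-- Cauchy–Schwarz. Nonnegativity of `a` and `b` is not required, since square root and
`ENNReal.ofReal` both send negative numbers to zero; this is convenient because `normSq` is
nonnegative only at interior points. -/
lemma _root_.MeasureTheory.lintegral_enorm_le_of_norm_le_sqrt_mul_sqrt {F : α → ℂ} {a b : α → ℝ}
    (ha : AEMeasurable a μ) (hb : AEMeasurable b μ) (h : ∀ᵐ p ∂μ, ‖F p‖ ≤ √(a p) * √(b p)) :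
    ∫⁻ p, ‖F p‖ₑ ∂μ ≤ (∫⁻ p, ENNReal.ofReal (a p) ∂μ) ^ (1 / 2 : ℝ) *
      (∫⁻ p, ENNReal.ofReal (b p) ∂μ) ^ (1 / 2 : ℝ) := by
  have hsq : ∀ x : ℝ, ENNReal.ofReal (√x) ^ (2 : ℝ) = ENNReal.ofReal x := by
    intro x
    rw [ENNReal.rpow_two, ← ENNReal.ofReal_pow (Real.sqrt_nonneg x)]
    rcases le_total 0 x with hx | hx
    · rw [Real.sq_sqrt hx]
    · rw [Real.sqrt_eq_zero_of_nonpos hx, ENNReal.ofReal_of_nonpos hx]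
      simp
  have h1 := ENNReal.lintegral_mul_le_Lp_mul_Lq μ Real.HolderConjugate.two_two
    ha.sqrt.ennreal_ofReal hb.sqrt.ennreal_ofReal
  simp only [hsq] at h1
  refine (lintegral_mono_ae ?_).trans h1
  filter_upwards [h] with p hp
  rw [Pi.mul_apply, ← ENNReal.ofReal_mul (Real.sqrt_nonneg _), ← ofReal_norm]
  exact ENNReal.ofReal_le_ofReal hp

lemma _root_.MeasureTheory.integrable_of_norm_le_sqrt_mul_sqrt {F : α → ℂ} {a b : α → ℝ}
    (hF : AEStronglyMeasurable F μ) (ha : AEMeasurable a μ) (hb : AEMeasurable b μ)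
    (h : ∀ᵐ p ∂μ, ‖F p‖ ≤ √(a p) * √(b p)) (ha' : ∫⁻ p, ENNReal.ofReal (a p) ∂μ ≠ ⊤)
    (hb' : ∫⁻ p, ENNReal.ofReal (b p) ∂μ ≠ ⊤) : Integrable F μ :=
  ⟨hF, (lintegral_enorm_le_of_norm_le_sqrt_mul_sqrt ha hb h).trans_lt (ENNReal.mul_lt_top
    (ENNReal.rpow_lt_top_of_nonneg (by norm_num) ha')
    (ENNReal.rpow_lt_top_of_nonneg (by norm_num) hb'))⟩

/-- Cauchy–Schwarz gives convergence in `L¹`. Every passage to the limit in Green's formula has this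
shape, with `a k` the squared error and `b` a fixed integrable factor. -/
lemma _root_.MeasureTheory.tendsto_integral_of_norm_sub_le_sqrt_mul_sqrt {F : ℕ → α → ℂ} {f : α → ℂ}
    {a : ℕ → α → ℝ} {b : α → ℝ} (hF : ∀ k, Integrable (F k) μ) (hf : AEStronglyMeasurable f μ)
    (ha : ∀ k, AEMeasurable (a k) μ) (hb : AEMeasurable b μ)
    (h : ∀ k, ∀ᵐ p ∂μ, ‖F k p - f p‖ ≤ √(a k p) * √(b p))
    (ha' : Tendsto (fun k => ∫⁻ p, ENNReal.ofReal (a k p) ∂μ) atTop (𝓝 0))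
    (hb' : ∫⁻ p, ENNReal.ofReal (b p) ∂μ ≠ ⊤) :
    Tendsto (fun k => ∫ p, F k p ∂μ) atTop (𝓝 (∫ p, f p ∂μ)) := by
  refine tendsto_integral_of_L1 f hf (Eventually.of_forall hF) ?_
  have h1 : Tendsto (fun k => (∫⁻ p, ENNReal.ofReal (a k p) ∂μ) ^ (1 / 2 : ℝ) *
      (∫⁻ p, ENNReal.ofReal (b p) ∂μ) ^ (1 / 2 : ℝ)) atTop (𝓝 0) := by
    have h2 := ENNReal.Tendsto.mul_const (b := (∫⁻ p, ENNReal.ofReal (b p) ∂μ) ^ (1 / 2 : ℝ))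
      (ha'.ennrpow_const (1 / 2))
      (Or.inr (ENNReal.rpow_lt_top_of_nonneg (by norm_num) hb').ne)
    simpa using h2
  exact tendsto_of_tendsto_of_tendsto_of_le_of_le tendsto_const_nhds h1 (fun _ => zero_le)
    fun k => lintegral_enorm_le_of_norm_le_sqrt_mul_sqrt (ha k) hb (h k)

end Measure

lemma differential_sub {φ ψ : B → ℂ} {p : B}
    (hφ : MDifferentiableAt (𝓡∂ (n + 1)) 𝓘(ℝ, ℂ) φ p)
    (hψ : MDifferentiableAt (𝓡∂ (n + 1)) 𝓘(ℝ, ℂ) ψ p) :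
    differential (n := n) (φ - ψ) p = differential φ p - differential ψ p := by
  ext j
  exact congrArg (fun L : EuclideanSpace ℝ (Fin (n + 1)) →L[ℝ] ℂ => L (EuclideanSpace.single j 1))
    (hφ.hasMFDerivAt.sub hψ.hasMFDerivAt).mfderiv

lemma grad_sub (M : ConicManifold n B Y) {φ ψ : B → ℂ} {p : B}
    (hφ : MDifferentiableAt (𝓡∂ (n + 1)) 𝓘(ℝ, ℂ) φ p)
    (hψ : MDifferentiableAt (𝓡∂ (n + 1)) 𝓘(ℝ, ℂ) ψ p) :
    M.grad (φ - ψ) p = M.grad φ p - M.grad ψ p := by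
  rw [grad_eq_mulVec, differential_sub hφ hψ, Matrix.mulVec_sub]
  rfl

lemma isTest_sub {M : ConicManifold n B Y} {φ ψ : B → ℂ} (hφ : M.IsTest φ) (hψ : M.IsTest ψ) :
    M.IsTest (φ - ψ) :=
  ⟨hφ.1.sub hψ.1, hφ.2.1.sub hψ.2.1,
    (tsupport_sub φ ψ).trans (union_subset hφ.2.2 hψ.2.2)⟩

lemma laplacian_of_notMem_tsupport (M : ConicManifold n B Y) {φ : B → ℂ} {p : B}
    (hp : p ∉ tsupport φ) : M.laplacian φ p = 0 := by
  set κ := extChartAt (𝓡∂ (n + 1)) p with hκ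
  have hcont : Tendsto κ.symm (𝓝 (κ p)) (𝓝 p) := by
    have := (continuousAt_extChartAt_symm (I := 𝓡∂ (n + 1)) p).tendsto
    rwa [extChartAt_to_inv] at this
  have h1 : (fun z => φ (κ.symm z)) =ᶠ[𝓝 (κ p)] fun _ => 0 :=
    hcont.eventually (notMem_tsupport_iff_eventuallyEq.1 hp)
  have h2 : ∀ i, (fun z => (M.chartDensity p z : ℂ) * ∑ j, (((M.chartMetric p z)⁻¹ i j : ℝ) : ℂ) *
      fderiv ℝ (fun z' => φ (κ.symm z')) z (EuclideanSpace.single j 1)) =ᶠ[𝓝 (κ p)] fun _ => 0 := by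
    intro i
    filter_upwards [h1.eventuallyEq_nhds] with z hz
    simp [hz.fderiv_eq]
  rw [laplacian]
  simp only [← hκ, (h2 _).fderiv_eq]
  simp

variable [MeasurableSpace B] [BorelSpace B] [T2Space B] [CompactSpace B]

lemma lintegral_ne_top_of_continuous (M : ConicManifold n B Y) [IsFiniteMeasure M.riemMeasure]
    {f : B → ℝ} (hf : Continuous f) : ∫⁻ p, ENNReal.ofReal (f p) ∂M.riemMeasure ≠ ⊤ :=
  (hf.integrable_of_hasCompactSupport (HasCompactSupport.of_compactSpace f)).lintegral_lt_top.ne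

lemma continuous_normSq_grad (M : ConicManifold n B Y) {φ : B → ℂ} (hφ : M.IsTest φ) :
    Continuous fun p => M.normSq p (M.grad φ p) :=
  continuous_of_continuousOn_of_eq_zero (isOpen_interior n B) (isClosed_tsupport φ) hφ.2.2
    (M.continuousOn_normSq_grad hφ.1)
    fun p hp => by rw [M.grad_of_notMem_tsupport hp, M.normSq_zero]

lemma continuous_inner_grad (M : ConicManifold n B Y) {φ ψ : B → ℂ} (hφ : M.IsTest φ)
    (hψ : M.IsTest ψ) : Continuous fun p => M.inner p (M.grad φ p) (M.grad ψ p) :=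
  continuous_of_continuousOn_of_eq_zero (isOpen_interior n B) (isClosed_tsupport φ) hφ.2.2
    (M.continuousOn_inner_grad hφ.1 hψ.1)
    fun p hp => by rw [M.grad_of_notMem_tsupport hp, M.inner_zero_left]

lemma continuous_laplacian [CompactSpace Y] (M : ConicManifold n B Y) (hn : 1 ≤ n) {φ : B → ℂ}
    (hφ : M.IsTest φ) :
    Continuous (M.laplacian φ) :=
  continuous_of_continuousOn_of_eq_zero (isOpen_interior n B) (isClosed_tsupport φ) hφ.2.2
    (M.continuousOn_laplacian hn hφ.1) fun _ hp => M.laplacian_of_notMem_tsupport hp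

/-- Write `X` as `∇φ_k` minus the error `∇φ_k - X`, for one `k` with finite error. -/
lemma HasH1Gradient.lintegral_normSq_ne_top {M : ConicManifold n B Y}
    [IsFiniteMeasure M.riemMeasure] {u : B → ℂ} {X : B → Fin (n + 1) → ℂ}
    (h : M.HasH1Gradient u X) : ∫⁻ p, ENNReal.ofReal (M.normSq p (X p)) ∂M.riemMeasure ≠ ⊤ := by
  obtain ⟨-, hX, φ, hφ, -, hlim⟩ := h
  obtain ⟨k, hk⟩ := (hlim.eventually_lt_const ENNReal.zero_lt_top).exists
  have hm := ((M.measurableField_grad (hφ k).1).sub hX).normSq.ennreal_ofReal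
  have hle : ∫⁻ p, ENNReal.ofReal (M.normSq p (X p)) ∂M.riemMeasure ≤
      2 * ∫⁻ p, ENNReal.ofReal (M.normSq p (M.grad (φ k) p)) ∂M.riemMeasure +
      2 * ∫⁻ p, ENNReal.ofReal (M.normSq p (M.grad (φ k) p - X p)) ∂M.riemMeasure := by
    rw [← lintegral_const_mul' _ _ (by simp), ← lintegral_const_mul' _ _ (by simp),
      ← lintegral_add_right' _ (hm.const_mul 2)]
    refine lintegral_mono_ae ?_
    filter_upwards [M.ae_mem_interior] with p hp
    have h1 := M.normSq_sub_le hp (M.grad (φ k) p) (M.grad (φ k) p - X p)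
    rw [sub_sub_cancel] at h1
    have h2 : (2 : ℝ≥0∞) = ENNReal.ofReal 2 := by simp
    rw [h2, ← ENNReal.ofReal_mul zero_le_two, ← ENNReal.ofReal_mul zero_le_two,
      ← ENNReal.ofReal_add (mul_nonneg zero_le_two (M.normSq_nonneg hp _))
        (mul_nonneg zero_le_two (M.normSq_nonneg hp _))]
    exact ENNReal.ofReal_le_ofReal h1
  refine ne_top_of_le_ne_top (ENNReal.add_ne_top.2 ⟨ENNReal.mul_ne_top (by simp) ?_,
    ENNReal.mul_ne_top (by simp) hk.ne⟩) hle
  exact M.lintegral_ne_top_of_continuous (M.continuous_normSq_grad (hφ k))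

variable [CompactSpace Y]

/-- A distributional Laplacian on the interior is a weak Laplacian. -/
lemma integral_inner_grad_eq_neg_of_hasDistribLaplacian (M : ConicManifold n B Y) (hn : 1 ≤ n)
    {v f : B → ℂ} {Z : B → Fin (n + 1) → ℂ} (hv : M.HasH1Gradient v Z)
    (hf : M.HasDistribLaplacian v f) {φ : B → ℂ} (hφ : M.IsTest φ) :
    ∫ p, M.inner p (M.grad φ p) (Z p) ∂M.riemMeasure = -∫ p, f p * φ p ∂M.riemMeasure := by
  have := M.isFiniteMeasure_riemMeasure hn
  obtain ⟨hvm, hZ, ψ, hψ, h1, h2⟩ := hv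
  have hΔ := M.continuous_laplacian hn hφ
  have hL : Tendsto (fun k => ∫ p, M.inner p (M.grad φ p) (M.grad (ψ k) p) ∂M.riemMeasure) atTop
      (𝓝 (∫ p, M.inner p (M.grad φ p) (Z p) ∂M.riemMeasure)) := by
    refine tendsto_integral_of_norm_sub_le_sqrt_mul_sqrt
      (a := fun k p => M.normSq p (M.grad (ψ k) p - Z p))
      (b := fun p => M.normSq p (M.grad φ p))
      (fun k => (M.continuous_inner_grad hφ (hψ k)).integrable_of_hasCompactSupport
        (HasCompactSupport.of_compactSpace _)) (hZ φ hφ)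
      (fun k => ((M.measurableField_grad (hψ k).1).sub hZ).normSq) (M.aemeasurable_normSq_grad hφ.1)
      (fun k => ?_) h2 (M.lintegral_ne_top_of_continuous (M.continuous_normSq_grad hφ))
    filter_upwards [M.ae_mem_interior] with p hp
    rw [← inner_sub_right, mul_comm]
    exact M.norm_inner_le hp _ _
  have hR : Tendsto (fun k => ∫ p, ψ k p * M.laplacian φ p ∂M.riemMeasure) atTop
      (𝓝 (∫ p, v p * M.laplacian φ p ∂M.riemMeasure)) := by
    refine tendsto_integral_of_norm_sub_le_sqrt_mul_sqrt
      (a := fun k p => ‖ψ k p - v p‖ ^ 2) (b := fun p => ‖M.laplacian φ p‖ ^ 2)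
      (fun k => ((hψ k).1.continuous.mul hΔ).integrable_of_hasCompactSupport
        (HasCompactSupport.of_compactSpace _)) (hvm.mul hΔ.aestronglyMeasurable)
      (fun k => ((hψ k).1.continuous.aestronglyMeasurable.sub hvm).norm.aemeasurable.pow_const 2)
      (hΔ.norm.pow 2).aemeasurable
      (fun k => Eventually.of_forall fun p => ?_) h1
      (M.lintegral_ne_top_of_continuous (hΔ.norm.pow 2))
    rw [← sub_mul, norm_mul, Real.sqrt_sq (norm_nonneg _), Real.sqrt_sq (norm_nonneg _)]
  -- The distributional equation moves the Laplacian onto `φ`; both sides are then limits of Green's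
  -- formula for `φ` and `ψ k`.
  rw [hf.2.2 φ hφ]
  refine tendsto_nhds_unique hL (hR.neg.congr fun k => ?_)
  exact (M.integral_inner_grad_eq_neg hn hφ.1 (hψ k)).symm

/-- Hardy's inequality, with the approximating sequence and its limit. -/
lemma HasH1Gradient.tendsto_weighted {M : ConicManifold n B Y} (hn : 1 ≤ n) {γ : ℝ} (hγ : -1 < γ)
    {u : B → ℂ} {X : B → Fin (n + 1) → ℂ} (hu : AEStronglyMeasurable u M.riemMeasure)
    (hX : M.MeasurableField X) {φ : ℕ → B → ℂ} (hφ : ∀ k, M.IsTest (φ k))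
    (h1 : Tendsto (fun k => ∫⁻ p, ENNReal.ofReal (‖φ k p - u p‖ ^ 2) ∂M.riemMeasure) atTop (𝓝 0))
    (h2 : Tendsto (fun k => ∫⁻ p, ENNReal.ofReal (M.normSq p (M.grad (φ k) p - X p))
      ∂M.riemMeasure) atTop (𝓝 0)) :
    Tendsto (fun k => ∫⁻ p, ENNReal.ofReal (M.radial p ^ (2 * γ) * ‖φ k p - u p‖ ^ 2)
      ∂M.riemMeasure) atTop (𝓝 0) := by
  obtain ⟨C, hC, hH⟩ := M.exists_hardy hn hγ
  set e : ℕ → ℝ≥0∞ := fun k => ∫⁻ p, ENNReal.ofReal (‖φ k p - u p‖ ^ 2) ∂M.riemMeasure +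
    ∫⁻ p, ENNReal.ofReal (M.normSq p (M.grad (φ k) p - X p)) ∂M.riemMeasure with he
  have he0 : Tendsto e atTop (𝓝 0) := by
    have h3 := h1.add h2
    rwa [add_zero] at h3
  have hφm : ∀ k, AEStronglyMeasurable (φ k) M.riemMeasure := fun k =>
    (hφ k).1.continuous.aestronglyMeasurable
  have hm1 : ∀ k, AEMeasurable (fun p => ENNReal.ofReal (‖φ k p - u p‖ ^ 2)) M.riemMeasure :=
    fun k => (((hφm k).sub hu).norm.aemeasurable.pow_const 2).ennreal_ofReal
  have hm2 : ∀ k, AEMeasurable (fun p => ENNReal.ofReal (M.normSq p (M.grad (φ k) p - X p)))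
      M.riemMeasure := fun k => ((M.measurableField_grad (hφ k).1).sub hX).normSq.ennreal_ofReal
  have henergy : ∀ k l, M.energy (φ k - φ l) ≤ 2 * (e k + e l) := by
    intro k l
    simp only [he]
    rw [← lintegral_add_left' (hm1 k), ← lintegral_add_left' (hm1 l),
      ← lintegral_add_left' ((hm1 k).fun_add (hm2 k)), ← lintegral_const_mul' _ _ (by simp), energy]
    refine lintegral_mono_ae ?_
    filter_upwards [M.ae_mem_interior] with p hp
    have hN := M.normSq_nonneg hp
    rw [show (2 : ℝ≥0∞) = ENNReal.ofReal 2 by simp,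
      ← ENNReal.ofReal_add (sq_nonneg _) (hN _), ← ENNReal.ofReal_add (sq_nonneg _) (hN _),
      ← ENNReal.ofReal_add (add_nonneg (sq_nonneg _) (hN _)) (add_nonneg (sq_nonneg _) (hN _)),
      ← ENNReal.ofReal_mul zero_le_two]
    refine ENNReal.ofReal_le_ofReal ?_
    rw [M.grad_sub ((hφ k).1.mdifferentiable (by simp) p) ((hφ l).1.mdifferentiable (by simp) p)]
    have h3 := M.normSq_sub_le hp (M.grad (φ k) p - X p) (M.grad (φ l) p - X p)
    rw [sub_sub_sub_cancel_right] at h3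
    have h4 : ‖(φ k - φ l) p‖ ≤ ‖φ k p - u p‖ + ‖φ l p - u p‖ := by
      rw [Pi.sub_apply, ← sub_sub_sub_cancel_right _ _ (u p)]
      exact norm_sub_le _ _
    have h5 := pow_le_pow_left₀ (norm_nonneg _) h4 2
    nlinarith [sq_nonneg (‖φ k p - u p‖ - ‖φ l p - u p‖)]
  -- Hardy's inequality is known only for test functions, so it is applied to `φ k - φ l`. An almost
  -- everywhere convergent subsequence in `l` then allows `φ l` to be replaced by `u` with Fatou's
  -- lemma.
  obtain ⟨l, hl, hae⟩ : ∃ l : ℕ → ℕ, StrictMono l ∧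
      ∀ᵐ p ∂M.riemMeasure, Tendsto (fun i => φ (l i) p) atTop (𝓝 (u p)) := by
    refine (tendstoInMeasure_of_tendsto_eLpNorm (p := 2) (by simp) hφm hu ?_).exists_seq_tendsto_ae
    have h3 := h1.ennrpow_const (1 / 2)
    rw [ENNReal.zero_rpow_of_pos (by norm_num)] at h3
    refine h3.congr fun k => ?_
    rw [eLpNorm_eq_lintegral_rpow_enorm_toReal (by simp) (by simp)]
    simp only [ENNReal.toReal_ofNat, ENNReal.rpow_two, Pi.sub_apply]
    congr 1
    refine lintegral_congr fun p => ?_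
    rw [← ofReal_norm, ENNReal.ofReal_pow (norm_nonneg _)]
  have hfatou : ∀ k, ∫⁻ p, ENNReal.ofReal (M.radial p ^ (2 * γ) * ‖φ k p - u p‖ ^ 2)
      ∂M.riemMeasure ≤ C * (2 * e k) := by
    intro k
    have hlim : Tendsto (fun i => C * (2 * (e k + e (l i)))) atTop (𝓝 (C * (2 * e k))) := by
      have h3 := ENNReal.Tendsto.const_mul (ENNReal.Tendsto.const_mul
        (tendsto_const_nhds.add (he0.comp hl.tendsto_atTop) : Tendsto (fun i => e k + e (l i))
          atTop (𝓝 (e k + 0))) (a := 2) (Or.inr (by simp))) (a := C) (Or.inr hC)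
      simpa using h3
    have hmeas : ∀ i, AEMeasurable (fun p => ENNReal.ofReal
        (M.radial p ^ (2 * γ) * ‖(φ k - φ (l i)) p‖ ^ 2)) M.riemMeasure := fun i =>
      ((M.continuous_radial.measurable.pow_const _).aemeasurable.mul
        (((hφm k).sub (hφm (l i))).norm.aemeasurable.pow_const 2)).ennreal_ofReal
    calc _ ≤ ∫⁻ p, liminf (fun i => ENNReal.ofReal
            (M.radial p ^ (2 * γ) * ‖(φ k - φ (l i)) p‖ ^ 2)) atTop ∂M.riemMeasure := by
          refine lintegral_mono_ae ?_
          filter_upwards [hae] with p hp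
          refine le_of_eq (Tendsto.liminf_eq ?_).symm
          exact ENNReal.tendsto_ofReal
            (((tendsto_const_nhds.sub hp).norm.pow 2).const_mul _)
      _ ≤ liminf (fun i => ∫⁻ p, ENNReal.ofReal
            (M.radial p ^ (2 * γ) * ‖(φ k - φ (l i)) p‖ ^ 2) ∂M.riemMeasure) atTop :=
          lintegral_liminf_le' hmeas
      _ ≤ liminf (fun i => C * (2 * (e k + e (l i)))) atTop :=
          liminf_le_liminf (Eventually.of_forall fun i =>
            (hH _ (isTest_sub (hφ k) (hφ (l i)))).trans (mul_le_mul_right (henergy k (l i)) C))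
      _ = C * (2 * e k) := hlim.liminf_eq
  have hlim : Tendsto (fun k => C * (2 * e k)) atTop (𝓝 0) := by
    have h3 := ENNReal.Tendsto.const_mul (ENNReal.Tendsto.const_mul he0 (a := 2)
      (Or.inr (by simp))) (a := C) (Or.inr hC)
    simpa using h3
  exact tendsto_of_tendsto_of_tendsto_of_le_of_le tendsto_const_nhds hlim (fun _ => zero_le) hfatou

/-- Density of test functions in the first argument. The pairing with `f` is continuous on `H¹` by
Hardy's inequality, which is where `γ > -1` enters. -/
lemma integral_inner_eq_neg (M : ConicManifold n B Y) (hn : 1 ≤ n) {γ : ℝ} (hγ : -1 < γ)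
    {u v f : B → ℂ} {X Z : B → Fin (n + 1) → ℂ} (hu : M.HasH1Gradient u X)
    (hv : M.HasH1Gradient v Z) (hf : M.HasDistribLaplacian v f) (hfγ : M.MemMellin γ f) :
    Integrable (fun p => M.inner p (X p) (Z p)) M.riemMeasure ∧
      Integrable (fun p => u p * f p) M.riemMeasure ∧
      ∫ p, M.inner p (X p) (Z p) ∂M.riemMeasure = -∫ p, u p * f p ∂M.riemMeasure := by
  have := M.isFiniteMeasure_riemMeasure hn
  have hXt := hu.lintegral_normSq_ne_top
  have hZt := hv.lintegral_normSq_ne_top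
  have hZm := hv.2.1
  obtain ⟨hum, hXm, φ, hφ, h1, h2⟩ := hu
  have hw := HasH1Gradient.tendsto_weighted hn hγ hum hXm hφ h1 h2
  have hCS : ∀ (W W' : B → Fin (n + 1) → ℂ), ∀ᵐ p ∂M.riemMeasure,
      ‖M.inner p (W p) (W' p)‖ ≤ √(M.normSq p (W p)) * √(M.normSq p (W' p)) := by
    intro W W'
    filter_upwards [M.ae_mem_interior] with p hp
    exact M.norm_inner_le hp _ _
  have hint : ∀ k, Integrable (fun p => M.inner p (M.grad (φ k) p) (Z p)) M.riemMeasure := fun k =>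
    integrable_of_norm_le_sqrt_mul_sqrt (hZm _ (hφ k)) (M.aemeasurable_normSq_grad (hφ k).1)
      hZm.normSq (hCS _ _) (M.lintegral_ne_top_of_continuous (M.continuous_normSq_grad (hφ k))) hZt
  have hL : Tendsto (fun k => ∫ p, M.inner p (M.grad (φ k) p) (Z p) ∂M.riemMeasure) atTop
      (𝓝 (∫ p, M.inner p (X p) (Z p) ∂M.riemMeasure)) := by
    refine tendsto_integral_of_norm_sub_le_sqrt_mul_sqrt
      (a := fun k p => M.normSq p (M.grad (φ k) p - X p)) hint (hXm.inner hZm)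
      (fun k => ((M.measurableField_grad (hφ k).1).sub hXm).normSq) hZm.normSq
      (fun k => ?_) h2 hZt
    filter_upwards [hCS (fun p => M.grad (φ k) p - X p) Z] with p hp
    rwa [← inner_sub_left]
  have hrm : Measurable fun p => M.radial p := M.continuous_radial.measurable
  set b : B → ℝ := fun p => ‖((M.radial p ^ (-γ) : ℝ) : ℂ) * f p‖ ^ 2 with hb
  have hbm : AEMeasurable b M.riemMeasure := hfγ.1.norm.aemeasurable.pow_const 2
  have hbt : ∫⁻ p, ENNReal.ofReal (b p) ∂M.riemMeasure ≠ ⊤ := by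
    have h3 := hfγ.integrable_norm_pow (p := 2) (by simp)
    exact h3.lintegral_lt_top.ne
  have hpos : ∀ᵐ p ∂M.riemMeasure, 0 < M.radial p := by
    filter_upwards [M.ae_mem_interior] with p hp
    exact (M.radial_pos_iff p).2 hp
  -- Only `x^{-γ} f` is known to be measurable on all of `B`; multiplying by `x^γ` recovers `f`
  -- where `x > 0`, that is, almost everywhere.
  have hfm : AEStronglyMeasurable f M.riemMeasure := by
    have hr : AEStronglyMeasurable (fun p => ((M.radial p ^ γ : ℝ) : ℂ)) M.riemMeasure :=
      (Complex.measurable_ofReal.comp (hrm.pow_const γ)).aestronglyMeasurable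
    refine (hr.mul hfγ.1).congr ?_
    filter_upwards [hpos] with p hp
    rw [Pi.mul_apply, ← mul_assoc, ← Complex.ofReal_mul, ← Real.rpow_add hp, add_neg_cancel,
      Real.rpow_zero, Complex.ofReal_one, one_mul]
  have hsplit : ∀ w : B → ℂ, ∀ᵐ p ∂M.riemMeasure,
      ‖w p * f p‖ ≤ √(M.radial p ^ (2 * γ) * ‖w p‖ ^ 2) * √(b p) := by
    intro w
    filter_upwards [hpos] with p hp
    have e1 : M.radial p ^ (2 * γ) = (M.radial p ^ γ) ^ 2 := by
      rw [mul_comm, Real.rpow_mul hp.le, Real.rpow_two]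
    have hp0 := Real.rpow_pos_of_pos hp γ
    rw [hb, Real.sqrt_sq (norm_nonneg _), e1, ← mul_pow, Real.sqrt_sq (by positivity), norm_mul,
      norm_mul, Complex.norm_real, Real.norm_of_nonneg (Real.rpow_nonneg hp.le _),
      Real.rpow_neg hp.le]
    refine le_of_eq ?_
    field_simp
  have hwm : ∀ w : B → ℂ, AEStronglyMeasurable w M.riemMeasure →
      AEMeasurable (fun p => M.radial p ^ (2 * γ) * ‖w p‖ ^ 2) M.riemMeasure := fun w hw =>
    (hrm.pow_const _).aemeasurable.mul (hw.norm.aemeasurable.pow_const 2)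
  have hφm : ∀ k, AEStronglyMeasurable (φ k) M.riemMeasure := fun k =>
    (hφ k).1.continuous.aestronglyMeasurable
  have hintφ : ∀ k, Integrable (fun p => φ k p * f p) M.riemMeasure := by
    intro k
    refine integrable_of_norm_le_sqrt_mul_sqrt ((hφm k).mul hfm) (hwm _ (hφm k)) hbm
      (hsplit (φ k)) ?_ hbt
    obtain ⟨C, hC, hH⟩ := M.exists_hardy hn hγ
    refine ne_top_of_le_ne_top (ENNReal.mul_ne_top hC ?_) (hH _ (hφ k))
    exact M.lintegral_ne_top_of_continuous
      (((hφ k).1.continuous.norm.pow 2).add (M.continuous_normSq_grad (hφ k)))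
  have hdiff : ∀ k, ∀ᵐ p ∂M.riemMeasure, ‖φ k p * f p - u p * f p‖ ≤
      √(M.radial p ^ (2 * γ) * ‖φ k p - u p‖ ^ 2) * √(b p) := by
    intro k
    filter_upwards [hsplit fun p => φ k p - u p] with p hp
    rwa [← sub_mul]
  have hR : Tendsto (fun k => ∫ p, φ k p * f p ∂M.riemMeasure) atTop
      (𝓝 (∫ p, u p * f p ∂M.riemMeasure)) :=
    tendsto_integral_of_norm_sub_le_sqrt_mul_sqrt hintφ (hum.mul hfm)
      (fun k => hwm _ ((hφm k).sub hum)) hbm hdiff hw hbt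
  refine ⟨integrable_of_norm_le_sqrt_mul_sqrt (hXm.inner hZm) hXm.normSq hZm.normSq (hCS _ _) hXt
    hZt, ?_, tendsto_nhds_unique hL (hR.neg.congr fun k => ?_)⟩
  -- `u f = φ_k f - (φ_k - u) f`, where the second term is integrable once the weighted error of
  -- `φ_k` is finite.
  · obtain ⟨k, hk⟩ := (hw.eventually_lt_const ENNReal.zero_lt_top).exists
    have h3 := integrable_of_norm_le_sqrt_mul_sqrt (((hφm k).mul hfm).sub (hum.mul hfm))
      (hwm _ ((hφm k).sub hum)) hbm (hdiff k) hk.ne hbt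
    refine ((hintφ k).sub h3).congr (Eventually.of_forall fun p => ?_)
    simp
  · rw [M.integral_inner_grad_eq_neg_of_hasDistribLaplacian hn hv hf (hφ k)]
    simp only [mul_comm]

end Limits

end ConicManifold

theorem mainTheorem7 {n : ℕ} (hn : 1 ≤ n) {B Y : Type*}
    [TopologicalSpace B] [T2Space B] [CompactSpace B]
    [ChartedSpace (EuclideanHalfSpace (n + 1)) B] [IsManifold (𝓡∂ (n + 1)) ∞ B]
    [MeasurableSpace B] [BorelSpace B]
    [TopologicalSpace Y] [T2Space Y] [CompactSpace Y]
    [ChartedSpace (EuclideanSpace ℝ (Fin n)) Y] [IsManifold (𝓡 n) ∞ Y]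
    (M : ConicManifold n B Y) (γ : ℝ) (hγ : -1 < γ) :
    (∀ (u v f : B → ℂ) (X Z : B → Fin (n + 1) → ℂ),
      M.HasH1Gradient u X → M.HasH1Gradient v Z →
      M.HasDistribLaplacian v f → M.MemMellin γ f →
        Integrable (fun p => M.inner p (X p) (Z p)) M.riemMeasure ∧
        Integrable (fun p => u p * f p) M.riemMeasure ∧
        ∫ p, M.inner p (X p) (Z p) ∂M.riemMeasure = -∫ p, u p * f p ∂M.riemMeasure) ∧
    (∀ u f : B → ℂ, M.MemH1 u → M.HasDistribLaplacian u f → M.MemMellin γ f →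
        Integrable f M.riemMeasure ∧ ∫ p, f p ∂M.riemMeasure = 0) := by
  refine ⟨fun u v f X Z hu hv hf hfγ => M.integral_inner_eq_neg hn hγ hu hv hf hfγ,
    fun u f ⟨Z, hu⟩ hf hfγ => ?_⟩
  -- The zero gradient of the constant `1` makes the left side vanish.
  have h := M.integral_inner_eq_neg hn hγ (M.hasH1Gradient_one hn) hu hf hfγ
  simp only [ConicManifold.inner_zero_left, one_mul, integral_zero] at h
  exact ⟨h.2.1, neg_eq_zero.1 h.2.2.symm⟩
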